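/- All graphs are finite, simple and undirected. A graph is chordal if each of its cycles of length at least four has a chord. A minimal triangulation of a graph $G=(V,E)$ is a chordal graph $H=(V,E')$ with $E\subseteq E'$ such that no graph $(V,E'')$ with $E\subseteq E''\subsetneq E'$ is chordal. A potential maximal clique of $G$ is a set of vertices that is an inclusion-maximal clique of some minimal triangulation of $G$; let $\Pi_G$ be the set of all of them. For non-adjacent vertices $u\neq v$, a $u,v$-separator is a set $S\subseteq V\setminus\{u,v\}$ such that $u$ and $v$ lie in different connected components of $G[V\setminus S]$; a minimal separator of $G$ is a set that, for some $u,v$, is a $u,v$-separator none of whose proper subsets is a $u,v$-separator; let $\Delta_G$ be the set of all of them. The treewidth of a graph is the minimum, over its tree decompositions, of the maximum bag size minus one (the graph without vertices counts as having treewidth at most $t$ for every $t\ge 0$). **Theorem.** There is an algorithm (a single program for a unit-cost random access machine) that, given a graph $G$ with $n\ge 1$ vertices and $m$ edges by its adjacency matrix, lists of the elements of $\Pi_G$ and of $\Delta_G$ (each without repetitions, in any order, each element given by its characteristic vector), and integers $0\le t,\ell\le n$, decides whether $G$ has an induced subgraph with exactly $\ell$ vertices and treewidth at most $t$, and that runs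 in time $$\mathcal{O}\bigl(n^{t+4}\cdot \max(m,1)\cdot(|\Pi_G|+|\Delta_G|)\bigr),$$ where the constant hidden in $\mathcal{O}$ is absolute (independent of $G$, $t$ and $\ell$), and the machine works with words whose length in bits is $\mathcal{O}(\log B)$, $B=n^{t+4}\max(m,1)(|\Pi_G|+|\Delta_G|)\ge 1$ (that is, for an absolute constant $c$, all numbers occurring are below $(cB)^c$). -/

import Mathlib

/-! ### Graph-theoretic notions -/

namespace SimpleGraph

variable {V : Type}

/-- Every cycle of length at least four has a chord: an edge of the graph that joins two vertices
of the cycle and is not an edge of the cycle. -/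
def IsChordalGraph (H : SimpleGraph V) : Prop :=
  ∀ (v : V) (c : H.Walk v v), c.IsCycle → 4 ≤ c.length →
    ∃ x ∈ c.support, ∃ y ∈ c.support, H.Adj x y ∧ s(x, y) ∉ c.edges

/-- `H` is a triangulation of `G`. -/
def IsTriangulation (G H : SimpleGraph V) : Prop :=
  G ≤ H ∧ H.IsChordalGraph

/-- `H` is a (inclusion-)minimal triangulation of `G`. -/
def IsMinimalTriangulation (G H : SimpleGraph V) : Prop :=
  G.IsTriangulation H ∧ ∀ F : SimpleGraph V, G ≤ F → F < H → ¬ F.IsChordalGraph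

/-- The set of all potential maximal cliques of `G`: the maximal cliques of the minimal
triangulations of `G`. -/
def potentialMaximalCliques (G : SimpleGraph V) : Set (Finset V) :=
  {K | ∃ H : SimpleGraph V, G.IsMinimalTriangulation H ∧ Maximal H.IsClique (K : Set V)}

/-- `u` and `v` are non-adjacent and lie in different connected components of `G ∖ S`. -/
def IsSeparator (G : SimpleGraph V) (u v : V) (S : Finset V) : Prop :=
  u ≠ v ∧ ¬ G.Adj u v ∧ ∃ (hu : u ∉ S) (hv : v ∉ S),
    ¬ (G.induce {x | x ∉ S}).Reachable ⟨u, hu⟩ ⟨v, hv⟩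

/-- The set of all minimal separators of `G`: the sets that are a minimal `u,v`-separator for some
pair `u, v` of vertices. -/
def minimalSeparators (G : SimpleGraph V) : Set (Finset V) :=
  {S | ∃ u v : V, G.IsSeparator u v S ∧ ∀ S' : Finset V, S' ⊂ S → ¬ G.IsSeparator u v S'}

/-- A tree decomposition of `G`; the nodes of the (finite) tree are numbered `0, …, k - 1`. -/
structure TreeDecomposition (G : SimpleGraph V) where
  k : ℕ
  tree : SimpleGraph (Fin k)
  bag : Fin k → Finset V
  isTree : tree.IsTree
  vertex_mem : ∀ v : V, ∃ i, v ∈ bag i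
  edge_mem : ∀ u v : V, G.Adj u v → ∃ i, u ∈ bag i ∧ v ∈ bag i
  connected : ∀ v : V, (tree.induce {i | v ∈ bag i}).Connected

/-- The maximum of `|bag i| - 1`. (It is `0` if all bags are empty, which is possible only for the
graph without vertices.) -/
def TreeDecomposition.width {G : SimpleGraph V} (D : G.TreeDecomposition) : ℕ :=
  (Finset.univ.sup fun i => (D.bag i).card) - 1

/-- The minimum width of a tree decomposition. A finite graph has a tree decomposition with a
single bag, so the infimum is over a non-empty set. -/
noncomputable def treewidth (G : SimpleGraph V) : ℕ :=
  sInf {w | ∃ D : G.TreeDecomposition, D.width = w}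

end SimpleGraph

/-! ### The machine model

Programs for a random access machine with unit cost per operation, written in structured form. The
machine has registers and an addressable memory. All of its cells, and all
intermediate results, are words, that is natural numbers below a bound `M` (words of `log₂ M` bits):
a computation in which some value reaches `M` has no run. -/

namespace WordRAM

/-- The content of the registers and of the memory. -/
structure State where
  reg : ℕ → ℕ
  mem : ℕ → ℕ

/-- The arithmetic and comparison operations of the machine. -/
inductive BinOp where
  | add
  | sub
  | mul
  | div
  | mod
  | lt
  | eq

/-- Subtraction is truncated at `0`; comparisons return `1` for true and `0` for false. -/
def BinOp.eval : BinOp → ℕ → ℕ → ℕ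
  | .add, a, b => a + b
  | .sub, a, b => a - b
  | .mul, a, b => a * b
  | .div, a, b => a / b
  | .mod, a, b => a % b
  | .lt, a, b => if a < b then 1 else 0
  | .eq, a, b => if a = b then 1 else 0

/-- Expressions: constants, registers, memory cells with a computed address, operations. -/
inductive Expr where
  | const (k : ℕ)
  | reg (x : ℕ)
  | load (addr : Expr)
  | op (o : BinOp) (e₁ e₂ : Expr)

namespace Expr

/-- The value of an expression. -/
def eval (s : State) : Expr → ℕ
  | const k => k
  | reg x => s.reg x
  | load a => s.mem (a.eval s)
  | op o e₁ e₂ => o.eval (e₁.eval s) (e₂.eval s)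

/-- The cost of evaluating an expression: one unit for every constant, register access, memory
access and operation in it. -/
def cost : Expr → ℕ
  | const _ => 1
  | reg _ => 1
  | load a => a.cost + 1
  | op _ e₁ e₂ => e₁.cost + e₂.cost + 1

/-- All values that arise in the evaluation, addresses included, are words. -/
def Fits (M : ℕ) (s : State) : Expr → Prop
  | const k => k < M
  | reg x => s.reg x < M
  | load a => a.Fits M s ∧ s.mem (a.eval s) < M
  | op o e₁ e₂ => e₁.Fits M s ∧ e₂.Fits M s ∧ o.eval (e₁.eval s) (e₂.eval s) < M

end Expr

/-- Programs. A condition is true if its value is not `0`. -/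
inductive Prog where
  | skip
  | assign (x : ℕ) (e : Expr)
  | store (addr e : Expr)
  | seq (p q : Prog)
  | ite (e : Expr) (p q : Prog)
  | while (e : Expr) (p : Prog)

/-- `Runs M p s T s'`: with words below `M`, the program `p` started in the state `s` halts in the
state `s'` after exactly `T` time units. -/
inductive Runs (M : ℕ) : Prog → State → ℕ → State → Prop
  | skip (s : State) : Runs M .skip s 1 s
  | assign (s : State) (x : ℕ) (e : Expr) (he : e.Fits M s) :
      Runs M (.assign x e) s (e.cost + 1) ⟨Function.update s.reg x (e.eval s), s.mem⟩
  | store (s : State) (a e : Expr) (ha : a.Fits M s) (he : e.Fits M s) :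
      Runs M (.store a e) s (a.cost + e.cost + 1)
        ⟨s.reg, Function.update s.mem (a.eval s) (e.eval s)⟩
  | seq {p q : Prog} {s s' s'' : State} {T T' : ℕ} (hp : Runs M p s T s')
      (hq : Runs M q s' T' s'') : Runs M (.seq p q) s (T + T') s''
  | ite_true {e : Expr} {p q : Prog} {s s' : State} {T : ℕ} (he : e.Fits M s)
      (h : e.eval s ≠ 0) (hp : Runs M p s T s') : Runs M (.ite e p q) s (e.cost + 1 + T) s'
  | ite_false {e : Expr} {p q : Prog} {s s' : State} {T : ℕ} (he : e.Fits M s)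
      (h : e.eval s = 0) (hq : Runs M q s T s') : Runs M (.ite e p q) s (e.cost + 1 + T) s'
  | while_true {e : Expr} {p : Prog} {s s' s'' : State} {T T' : ℕ} (he : e.Fits M s)
      (h : e.eval s ≠ 0) (hp : Runs M p s T s') (hw : Runs M (.while e p) s' T' s'') :
      Runs M (.while e p) s (e.cost + 1 + T + T') s''
  | while_false {e : Expr} {p : Prog} {s : State} (he : e.Fits M s) (h : e.eval s = 0) :
      Runs M (.while e p) s (e.cost + 1) s

/-- The memory holds the input words, followed by zeros; all registers are zero. -/
def initState (input : List ℕ) : State where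
  reg := fun _ => 0
  mem := fun a => input.getD a 0

end WordRAM

/-! ### Encoding of the instances -/

open Classical in
/-- The characteristic vector of a vertex set, as a list of `n` words `0` or `1`. -/
noncomputable def vertexSetWords {n : ℕ} (K : Finset (Fin n)) : List ℕ :=
  (List.finRange n).map fun v => if v ∈ K then 1 else 0

open Classical in
/-- The adjacency matrix of a graph, row by row. -/
noncomputable def graphWords {n : ℕ} (G : SimpleGraph (Fin n)) : List ℕ :=
  (List.finRange n).flatMap fun u => (List.finRange n).map fun v => if G.Adj u v then 1 else 0

/-- The input: the numbers `n`, `t`, `ℓ`, the lengths of the two lists of vertex sets, the adjacency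
matrix of the graph, and the characteristic vectors of the sets of the first and of the second
list. -/
noncomputable def instanceWords {n : ℕ} (G : SimpleGraph (Fin n)) (cliques seps : List (Finset (Fin n)))
    (t ℓ : ℕ) : List ℕ :=
  [n, t, ℓ, cliques.length, seps.length] ++ graphWords G ++
    cliques.flatMap vertexSetWords ++ seps.flatMap vertexSetWords

/-- The list `L` enumerates the set `A`, without repetitions and in some order. -/
def Enumerates {α : Type} (L : List α) (A : Set α) : Prop :=
  L.Nodup ∧ ∀ a, a ∈ L ↔ a ∈ A

/-- The quantity `n ^ (t + 4) * m * (|Π_G| + |Δ_G|)`, where the number `m` of edges is replaced by `1`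
for a graph without edges. -/
noncomputable def timeBound {n : ℕ} (G : SimpleGraph (Fin n)) (t : ℕ) : ℕ :=
  n ^ (t + 4) * max G.edgeSet.ncard 1 *
    (G.potentialMaximalCliques.ncard + G.minimalSeparators.ncard)

/-! The proof is a dynamic program over the potential maximal cliques. Two facts about chordal
graphs drive it. If `G[U]` has treewidth at most `t`, then some minimal triangulation `H` of `G` has
at most `t + 1` vertices of `U` in each clique (`exists_isMinimalTriangulation_card_le`): fill the
bags of a tree decomposition of `G[U]`, join the vertices outside `U` to everything, and pass to a
minimal triangulation inside this chordal graph. Moreover, `H` unfolds recursively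
(`IsMinimalTriangulation.exists_next`): if `C` is a component of `G ∖ Ω'` for a maximal clique `Ω'`
of `H` and `S ⊆ Ω'` is its neighbourhood, then some vertex of `C` is `H`-adjacent to all of `S`, so
a maximal clique `Ω ⊆ C ∪ S` contains `S` and meets `C`. Then `C` consists of `Ω ∖ S` and of
components of `G ∖ Ω` strictly smaller than `C`.

A table has an entry for each pair of a block `C` and a set `W`, the trace of a partial solution on
the boundary of `C`. One step picks a clique `Ω`, a vertex `v` whose component in `G ∖ Ω` determines
the gate `S` and thereby the block, and a set `W ⊆ Ω` of at most `t + 1` vertices. It adds the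
number of vertices of `W` in the block to the entries of the components of `G ∖ Ω` inside the block
(`stepVal`).

Entries are never too large: each is realized by a set that extends every compatible partial tree
decomposition by attaching bags (`Extends`, `extends_stepVal`, `Built.treewidth_induce_le`). They
are not too small: after `r` rounds, the entries of the components with at most `r` vertices
dominate every admissible `U` (`TableComplete.succ`, `TableComplete.card_le`). A solution with too
many vertices can be cut down to exactly `ℓ`.

A component has at most `2m + 1` vertices, so `2m + 2` rounds suffice, the last one serving the
whole graph. A round treats every clique, `n + 1` selections `v` and `(n + 1) ^ (t + 1)` codes for
`W`, each code in quadratic time because the table is a trie with lookups in linear time. Finally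
`(n + 1) ^ (t + 4) ≤ 64 * n ^ (t + 4)` for `t ≤ n`. The program is written in a small array language
whose assignments are reduced modulo a word bound; word size and time are then read off from the
syntax (`runs_compile`), and the specifications show that the reductions never change a value. -/

namespace SimpleGraph

/-! ### Chordality expressed through the neighbours of a vertex -/

variable {V : Type}

/-- `x` and `y` are joined by a walk of `G` all of whose interior vertices lie in `D`. -/
inductive Conn (G : SimpleGraph V) (D : Set V) : V → V → Prop
  | refl (x : V) : Conn G D x x
  | adj {x y : V} (h : G.Adj x y) : Conn G D x y
  | trans {x y z : V} (h₁ : Conn G D x y) (hy : y ∈ D) (h₂ : Conn G D y z) : Conn G D x z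

namespace Conn

variable {G H : SimpleGraph V} {D E : Set V} {x y : V}

theorem symm (h : G.Conn D x y) : G.Conn D y x := by
  induction h with
  | refl x => exact .refl x
  | adj h => exact .adj h.symm
  | trans _ hy _ ih₁ ih₂ => exact .trans ih₂ hy ih₁

theorem mono (hG : G ≤ H) (hD : D ⊆ E) (h : G.Conn D x y) : H.Conn E x y := by
  induction h with
  | refl x => exact .refl x
  | adj h => exact .adj (hG h)
  | trans _ hy _ ih₁ ih₂ => exact .trans ih₁ (hD hy) ih₂

/-- Splitting a walk at its visits to a vertex. -/
theorem insert_iff {k : V} :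
    G.Conn (insert k D) x y ↔ G.Conn D x y ∨ (G.Conn D x k ∧ G.Conn D k y) := by
  constructor
  · intro h
    induction h with
    | refl x => exact .inl (.refl x)
    | adj h => exact .inl (.adj h)
    | @trans x z y _ hz _ ih₁ ih₂ =>
      rcases hz with rfl | hz
      · exact .inr ⟨by tauto, by tauto⟩
      · rcases ih₁ with a | ⟨a, b⟩ <;> rcases ih₂ with c | ⟨c, d⟩
        · exact .inl (a.trans hz c)
        · exact .inr ⟨a.trans hz c, d⟩
        · exact .inr ⟨a, b.trans hz c⟩
        · exact .inr ⟨a, d⟩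
  · rintro (h | ⟨h₁, h₂⟩)
    · exact h.mono le_rfl (Set.subset_insert _ _)
    · exact (h₁.mono le_rfl (Set.subset_insert _ _)).trans (Set.mem_insert _ _)
        (h₂.mono le_rfl (Set.subset_insert _ _))

/-- A walk with interior outside `S` cannot leave a set whose neighbourhood is contained in `S`. -/
theorem mem_of_mem {C S : Set V} (hC : ∀ c ∈ C, ∀ z, G.Adj c z → z ∈ C ∪ S)
    (hD : ∀ z ∈ D, z ∉ S) (h : G.Conn D x y) (hx : x ∈ C) : y ∈ C ∪ S := by
  induction h with
  | refl x => exact .inl hx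
  | adj h => exact hC _ hx _ h
  | trans _ hy _ ih₁ ih₂ => exact ih₂ ((ih₁ hx).resolve_right (hD _ hy))

/-- A walk inside `C` either avoids `N` or has a first visit to `N`. -/
theorem avoid_or_hit {C N : Set V} (h : G.Conn C x y) :
    G.Conn (C \ N) x y ∨ ∃ d ∈ C ∩ N, G.Conn (C \ N) x d := by
  induction h with
  | refl x => exact .inl (.refl x)
  | adj h => exact .inl (.adj h)
  | @trans x z y _ hz _ ih₁ ih₂ =>
    rcases ih₁ with a | a
    · by_cases hN : z ∈ N
      · exact .inr ⟨z, ⟨hz, hN⟩, a⟩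
      · rcases ih₂ with b | ⟨d, hd, b⟩
        · exact .inl (a.trans ⟨hz, hN⟩ b)
        · exact .inr ⟨d, hd, a.trans ⟨hz, hN⟩ b⟩
    · exact .inr a

end Conn

/-- Two neighbours of a vertex `v` that are joined outside the closed neighbourhood of `v` are equal
or adjacent. -/
def NeighborsJoined (H : SimpleGraph V) : Prop :=
  ∀ v a b, H.Adj v a → H.Adj v b → H.Conn {x | x ≠ v ∧ ¬ H.Adj v x} a b → a = b ∨ H.Adj a b

/-- The positions `1, …, c.length` of a cycle carry distinct vertices, so an edge determines its two
positions. Position `0` repeats position `c.length`; this is the source of the second alternative.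
-/
theorem Walk.IsCycle.index_of_mem_edges {H : SimpleGraph V} {v : V} {c : H.Walk v v}
    (hc : c.IsCycle) {i j : ℕ} (hi : 1 ≤ i) (hij : i < j) (hj : j ≤ c.length)
    (h : s(c.getVert i, c.getVert j) ∈ c.edges) : j = i + 1 ∨ (i = 1 ∧ j = c.length) := by
  obtain ⟨k, hk, hk'⟩ := (Walk.mk_mem_edges_iff_exists c).1 h
  have inj : ∀ a b, 1 ≤ a → a ≤ c.length → 1 ≤ b → b ≤ c.length →
      c.getVert a = c.getVert b → a = b :=
    fun a b h1 h2 h3 h4 h5 => hc.getVert_injOn ⟨h1, h2⟩ ⟨h3, h4⟩ h5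
  obtain ⟨k', hk1, hk2, hk3⟩ : ∃ k', 1 ≤ k' ∧ k' ≤ c.length ∧ c.getVert k = c.getVert k' ∧
      (k' = k ∨ (k = 0 ∧ k' = c.length)) := by
    rcases Nat.eq_zero_or_pos k with rfl | hk0
    · exact ⟨c.length, by omega, le_rfl, by simp⟩
    · exact ⟨k, hk0, hk.le, rfl, .inl rfl⟩
  rw [hk3.1] at hk'
  rw [Sym2.eq_iff] at hk'
  rcases hk' with ⟨h1, h2⟩ | ⟨h1, h2⟩
  · have e1 := inj _ _ hk1 hk2 hi (by omega) h1
    have e2 := inj _ _ (by omega) (by omega) (by omega) hj h2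
    omega
  · have e1 := inj _ _ hk1 hk2 (by omega) hj h1
    have e2 := inj _ _ (by omega) (by omega) hi (by omega) h2
    omega

/-- If there were no chord, the base point `v` would be adjacent only to its two neighbours on the
cycle, and the rest of the cycle would join these two outside the closed neighbourhood of `v`. Hence
they are adjacent, which is a chord as the length is at least four. -/
theorem NeighborsJoined.isChordalGraph {H : SimpleGraph V} (hH : H.NeighborsJoined) :
    H.IsChordalGraph := by
  intro v c hc hlen
  by_contra! hcon
  have hmem : ∀ i, c.getVert i ∈ c.support := fun i => c.getVert_mem_support i
  have hvl : c.getVert c.length = v := c.getVert_length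
  have hD : ∀ i, 2 ≤ i → i + 2 ≤ c.length →
      c.getVert i ∈ {x | x ≠ v ∧ ¬ H.Adj v x} := by
    intro i h2 hi
    refine ⟨fun h => ?_, fun h => ?_⟩
    · have := hc.getVert_injOn (x₁ := i) (x₂ := c.length) ⟨by omega, by omega⟩ ⟨by omega, le_rfl⟩
        (by rw [h, hvl])
      omega
    · have := hcon _ (hmem i) v c.start_mem_support h.symm
      have := hc.index_of_mem_edges (i := i) (j := c.length) (by omega) (by omega) le_rfl
        (by rwa [hvl])
      omega
  have hconn : ∀ i, 2 ≤ i → i + 1 ≤ c.length →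
      H.Conn {x | x ≠ v ∧ ¬ H.Adj v x} (c.getVert 1) (c.getVert i) := by
    intro i h2
    induction i, h2 using Nat.le_induction with
    | base => intro h; exact .adj (c.adj_getVert_succ (by omega))
    | succ i hi ih =>
      intro h
      exact (ih (by omega)).trans (hD i hi (by omega)) (.adj (c.adj_getVert_succ (by omega)))
  have h1 : H.Adj v (c.getVert 1) := by
    simpa using c.adj_getVert_succ (i := 0) (by omega)
  have h2 : H.Adj v (c.getVert (c.length - 1)) := by
    have := c.adj_getVert_succ (i := c.length - 1) (by omega)
    rw [Nat.sub_add_cancel (by omega), hvl] at this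
    exact this.symm
  rcases hH v _ _ h1 h2 (hconn _ (by omega) (by omega)) with h | h
  · have := hc.getVert_injOn (x₁ := 1) (x₂ := c.length - 1) ⟨by omega, by omega⟩
      ⟨by omega, by omega⟩ h
    omega
  · have := hc.index_of_mem_edges (i := 1) (j := c.length - 1) (by omega) (by omega) (by omega)
      (hcon _ (hmem _) _ (hmem _) h)
    omega

/-- A graph with a perfect elimination ordering, given by a rank function, is chordal. -/
theorem isChordalGraph_of_rank {H : SimpleGraph V} (d : V → ℕ)
    (h : ∀ v a b, H.Adj v a → H.Adj v b → d a ≤ d v → d b ≤ d v → a ≠ b → H.Adj a b) :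
    H.IsChordalGraph := by
  classical
  intro v₀ c₀ hc₀ hlen₀
  -- The two cycle neighbours of a vertex of maximal rank are adjacent by hypothesis and form the
  -- chord. Rotation makes that vertex the base point.
  obtain ⟨v, hv, hmax⟩ := c₀.support.toFinset.exists_max_image d
    ⟨_, List.mem_toFinset.2 c₀.start_mem_support⟩
  simp only [List.mem_toFinset] at hv hmax
  set c := c₀.rotate v hv with hcdef
  have hc : c.IsCycle := (Walk.isCycle_rotate hv).2 hc₀
  have hlen : 4 ≤ c.length := by rw [hcdef, Walk.length_rotate]; exact hlen₀
  have hsup : ∀ x, x ∈ c.support → x ∈ c₀.support := fun x =>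
    (Walk.mem_support_rotate_iff c₀ v hv).1
  have hmem : ∀ i, c.getVert i ∈ c₀.support := fun i => hsup _ (c.getVert_mem_support i)
  have hvl : c.getVert c.length = v := c.getVert_length
  have h1 : H.Adj v (c.getVert 1) := by
    simpa using c.adj_getVert_succ (i := 0) (by omega)
  have h2 : H.Adj v (c.getVert (c.length - 1)) := by
    have := c.adj_getVert_succ (i := c.length - 1) (by omega)
    rw [Nat.sub_add_cancel (by omega), hvl] at this
    exact this.symm
  have hne : c.getVert 1 ≠ c.getVert (c.length - 1) := fun h => by
    have := hc.getVert_injOn (x₁ := 1) (x₂ := c.length - 1) ⟨by omega, by omega⟩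
      ⟨by omega, by omega⟩ h
    omega
  refine ⟨_, hmem 1, _, hmem (c.length - 1),
    h v _ _ h1 h2 (hmax _ (hmem _)) (hmax _ (hmem _)) hne, fun he => ?_⟩
  have := hc.index_of_mem_edges (i := 1) (j := c.length - 1) (by omega) (by omega) (by omega)
    ((Walk.rotate_edges c₀ v hv).mem_iff.2 he)
  omega

/-- If `a` and `b` were distinct and non-adjacent, a shortest path between them with interior
outside the closed neighbourhood of `v` would be induced. Closed up through `v`, it would be a
chordless cycle of length at least four. -/
theorem IsChordalGraph.neighborsJoined {H : SimpleGraph V} (hH : H.IsChordalGraph) :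
    H.NeighborsJoined := by
  intro v a b hva hvb hconn
  by_contra! hcon
  obtain ⟨hab, hnab⟩ := hcon
  set D : Set V := {x | x ≠ v ∧ ¬ H.Adj v x}
  -- Only the edges inside `D ∪ {a, b}` are kept, so that a path realizing the distance in `H'` is
  -- shortest among those with interior in `D`.
  let H' : SimpleGraph V :=
    { Adj := fun x y => H.Adj x y ∧ (x ∈ D ∨ x = a ∨ x = b) ∧ (y ∈ D ∨ y = a ∨ y = b)
      symm := ⟨fun _ _ h => ⟨h.1.symm, h.2.2, h.2.1⟩⟩
      loopless := ⟨fun _ h => h.1.ne rfl⟩ }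
  have hle : H' ≤ H := fun _ _ h => h.1
  have hreach : H'.Reachable a b := by
    have : ∀ x y, H.Conn D x y → (x ∈ D ∨ x = a ∨ x = b) → (y ∈ D ∨ y = a ∨ y = b) →
        H'.Reachable x y := by
      intro x y h
      induction h with
      | refl x => exact fun _ _ => .refl _
      | adj h => exact fun hx hy => Adj.reachable (G := H') ⟨h, hx, hy⟩
      | trans _ hy _ ih₁ ih₂ => exact fun hx hz => (ih₁ hx (.inl hy)).trans (ih₂ (.inl hy) hz)
    exact this a b hconn (by tauto) (by tauto)
  have hsup : ∀ x y (q : H'.Walk x y), (x ∈ D ∨ x = a ∨ x = b) →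
      ∀ z ∈ q.support, z ∈ D ∨ z = a ∨ z = b := by
    intro x y q
    induction q with
    | nil => intro hx z hz; simp only [Walk.support_nil, List.mem_singleton] at hz; exact hz ▸ hx
    | cons h q ih =>
      intro hx z hz
      rw [Walk.support_cons, List.mem_cons] at hz
      rcases hz with rfl | hz
      · exact hx
      · exact ih h.2.2 z hz
  obtain ⟨q, hq⟩ := hreach.exists_walk_length_eq_dist
  have hqpath : q.IsPath := q.isPath_of_length_eq_dist hq
  have hqD := hsup a b q (by tauto)
  have hvq : v ∉ q.support := fun h => by
    rcases hqD v h with h | h | h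
    · exact h.1 rfl
    · exact hva.ne h
    · exact hvb.ne h
  have hlen : 2 ≤ q.length := by
    rcases Nat.lt_or_ge q.length 2 with h | h
    · exfalso
      interval_cases hl : q.length
      · exact hab (Walk.eq_of_length_eq_zero hl)
      · exact hnab (hle (Walk.adj_of_length_eq_one hl))
    · exact h
  have hshort : ∀ i j, i < j → j ≤ q.length → H.Adj (q.getVert i) (q.getVert j) → j = i + 1 := by
    intro i j hij hj hadj
    have hadj' : H'.Adj (q.getVert i) (q.getVert j) :=
      ⟨hadj, hqD _ (q.getVert_mem_support i), hqD _ (q.getVert_mem_support j)⟩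
    have := dist_le ((q.take i).append (Walk.cons hadj' (q.drop j)))
    rw [Walk.length_append, Walk.length_cons, Walk.take_length, Walk.drop_length, ← hq,
      min_eq_left (by omega)] at this
    omega
  set p : H.Walk a b := q.mapLe hle
  have hpsup : p.support = q.support := by simp [p]
  have hpe : p.edges = q.edges := by simp [p]
  have hplen : p.length = q.length := by simp [p]
  have hppath : p.IsPath := hqpath.mapLe hle
  let c : H.Walk v v := Walk.cons hva (p.concat hvb.symm)
  have hcyc : c.IsCycle := by
    rw [Walk.cons_isCycle_iff]
    refine ⟨hppath.concat (by rwa [hpsup]) _, ?_⟩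
    rw [Walk.edges_concat, List.concat_eq_append, List.mem_append, List.mem_singleton]
    rintro (h | h)
    · exact hvq (hpsup ▸ p.fst_mem_support_of_mem_edges h)
    · rw [Sym2.eq_iff] at h
      rcases h with h | h
      · exact hvb.ne h.1
      · exact hab h.2
  have hclen : 4 ≤ c.length := by
    simp only [c, Walk.length_cons, Walk.length_concat, hplen]; omega
  have hcedge : ∀ e, e ∈ c.edges ↔ e = s(v, a) ∨ e ∈ q.edges ∨ e = s(b, v) := by
    intro e; simp [c, Walk.edges_concat, hpe]
  have hcsup : ∀ x ∈ c.support, x = v ∨ x ∈ q.support := by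
    intro x hx
    simp only [c, Walk.support_cons, Walk.support_concat, List.mem_cons,
      List.mem_append, hpsup, List.not_mem_nil, or_false] at hx
    tauto
  have hcase : ∀ x, H.Adj v x → x ∈ q.support → s(v, x) ∈ c.edges := by
    intro x hx hxq
    rw [hcedge]
    rcases hqD x hxq with h | rfl | rfl
    · exact absurd hx h.2
    · exact .inl rfl
    · exact .inr (.inr Sym2.eq_swap)
  have hind : ∀ i j, i < j → j ≤ q.length → H.Adj (q.getVert i) (q.getVert j) →
      s(q.getVert i, q.getVert j) ∈ c.edges := by
    intro i j hij hj hadj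
    have := hshort i j hij hj hadj
    subst this
    exact (hcedge _).2 (.inr (.inl ((Walk.mk_mem_edges_iff_exists q).2 ⟨i, by omega, rfl⟩)))
  obtain ⟨x, hx, y, hy, hxy, hne⟩ := hH v c hcyc hclen
  rcases hcsup x hx with rfl | hxq
  · rcases hcsup y hy with rfl | hyq
    · exact hxy.ne rfl
    · exact hne (hcase y hxy hyq)
  · rcases hcsup y hy with rfl | hyq
    · exact hne (Sym2.eq_swap ▸ hcase x hxy.symm hxq)
    · obtain ⟨i, rfl, hi⟩ := Walk.mem_support_iff_exists_getVert.1 hxq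
      obtain ⟨j, rfl, hj⟩ := Walk.mem_support_iff_exists_getVert.1 hyq
      rcases lt_trichotomy i j with h | rfl | h
      · exact hne (hind i j h hj hxy)
      · exact hxy.ne rfl
      · exact hne (Sym2.eq_swap ▸ hind j i h hi hxy.symm)

end SimpleGraph

/-! ### Minimal triangulations and the recursive structure of their maximal cliques -/

namespace SimpleGraph

variable {V : Type}

/-- Excursions of a walk outside `A` begin and end in the clique `A ∩ B`, so single edges of `H` can
replace them. The last two clauses serve the induction: a walk with one end in `A` is followed from
that end to a clique vertex `s`, which may become an interior vertex because it is that end or lies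
in `D`. -/
theorem Conn.of_glue {H H' : SimpleGraph V} {A B D : Set V} (hle : H' ≤ H)
    (hS : ∀ x ∈ A ∩ B, ∀ y ∈ A ∩ B, x ≠ y → H.Adj x y)
    (hcross : ∀ x y, H'.Adj x y → (x ∈ A ∧ y ∈ A) ∨ (x ∈ B ∧ y ∈ B)) {x y : V}
    (h : H'.Conn D x y) :
    (x ∈ A → y ∈ A → H.Conn (D ∩ A) x y) ∧
    (x ∈ A → y ∉ A → ∃ s ∈ A ∩ B, (s = x ∨ s ∈ D) ∧ H.Conn (D ∩ A) x s) ∧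
    (x ∉ A → y ∈ A → ∃ s ∈ A ∩ B, (s = y ∨ s ∈ D) ∧ H.Conn (D ∩ A) s y) := by
  induction h with
  | refl x => exact ⟨fun _ _ => .refl x, by tauto, by tauto⟩
  | @adj x y h =>
    refine ⟨fun _ _ => .adj (hle h), fun hx hy => ⟨x, ?_, .inl rfl, .refl x⟩,
      fun hx hy => ⟨y, ?_, .inl rfl, .refl y⟩⟩ <;>
    · rcases hcross x y h with h | h
      · tauto
      · exact ⟨by tauto, by tauto⟩
  | @trans x k y _ hk _ ih₁ ih₂ =>
    have hstep : ∀ s ∈ A ∩ B, ∀ s' ∈ A ∩ B, H.Conn (D ∩ A) s s' := by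
      intro s hs s' hs'
      by_cases h : s = s'
      · exact h ▸ .refl s
      · exact .adj (hS s hs s' hs' h)
    by_cases hkA : k ∈ A
    · have hk' : k ∈ D ∩ A := ⟨hk, hkA⟩
      refine ⟨fun hx hy => (ih₁.1 hx hkA).trans hk' (ih₂.1 hkA hy), fun hx hy => ?_,
        fun hx hy => ?_⟩
      · obtain ⟨s, hs, hs', hc⟩ := ih₂.2.1 hkA hy
        refine ⟨s, hs, .inr ?_, (ih₁.1 hx hkA).trans hk' hc⟩
        rcases hs' with rfl | h
        · exact hk
        · exact h
      · obtain ⟨s, hs, hs', hc⟩ := ih₁.2.2 hx hkA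
        refine ⟨s, hs, .inr ?_, hc.trans hk' (ih₂.1 hkA hy)⟩
        rcases hs' with rfl | h
        · exact hk
        · exact h
    · refine ⟨fun hx hy => ?_, fun hx hy => ih₁.2.1 hx hkA, fun hx hy => ih₂.2.2 hkA hy⟩
      obtain ⟨s, hs, hs', hc⟩ := ih₁.2.1 hx hkA
      obtain ⟨s₁, hs₁, hs₁', hc₁⟩ := ih₂.2.2 hkA hy
      have h1 : H.Conn (D ∩ A) s y := by
        rcases hs₁' with rfl | h
        · exact hstep s hs s₁ hs₁
        · exact (hstep s hs s₁ hs₁).trans ⟨h, hs₁.1⟩ hc₁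
      rcases hs' with rfl | h
      · exact h1
      · exact hc.trans ⟨h, hs.1⟩ h1

/-- Gluing along a clique. -/
theorem NeighborsJoined.glue {H H' : SimpleGraph V} (hH : H.NeighborsJoined) {A B : Set V}
    (hle : H' ≤ H)
    (hS : ∀ x ∈ A ∩ B, ∀ y ∈ A ∩ B, x ≠ y → H.Adj x y)
    (hcross : ∀ x y, H'.Adj x y → (x ∈ A ∧ y ∈ A) ∨ (x ∈ B ∧ y ∈ B))
    (hA : ∀ x ∈ A, ∀ y ∈ A, H.Adj x y → H'.Adj x y)
    (hB : ∀ x ∈ B, ∀ y ∈ B, H.Adj x y → H'.Adj x y) : H'.NeighborsJoined := by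
  intro v a b hva hvb hab
  have hA' : v ∈ A → a ∈ A → b ∈ A → a = b ∨ H'.Adj a b := by
    intro hv ha hb
    have := (hab.of_glue hle hS hcross).1 ha hb
    refine (hH v a b (hle hva) (hle hvb) (this.mono le_rfl ?_)).imp_right (hA a ha b hb)
    rintro x ⟨⟨hx, hx'⟩, hxA⟩
    exact ⟨hx, fun h => hx' (hA v hv x hxA h)⟩
  have hB' : v ∈ B → a ∈ B → b ∈ B → a = b ∨ H'.Adj a b := by
    intro hv ha hb
    have := (hab.of_glue (A := B) (B := A) hle
      (by rw [Set.inter_comm]; exact hS) (fun x y h => (hcross x y h).symm)).1 ha hb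
    refine (hH v a b (hle hva) (hle hvb) (this.mono le_rfl ?_)).imp_right (hB a ha b hb)
    rintro x ⟨⟨hx, hx'⟩, hxA⟩
    exact ⟨hx, fun h => hx' (hB v hv x hxA h)⟩
  -- For `v` in the clique `A ∩ B`, the whole clique lies in the closed neighbourhood of `v`. A walk
  -- whose interior avoids this neighbourhood therefore cannot cross from `A ∖ B` to `B ∖ A`.
  have key : ∀ p q, v ∈ A ∩ B → H'.Conn {x | x ≠ v ∧ ¬ H'.Adj v x} p q → p ∈ A → p ∉ B → q ∈ A := by
    intro p q hv hpq hp hp'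
    have := hpq.mem_of_mem (C := A \ B) (S := A ∩ B) ?_ ?_ ⟨hp, hp'⟩
    · rcases this with h | h
      · exact h.1
      · exact h.1
    · rintro c ⟨hcA, hcB⟩ z hz
      have : z ∈ A := by rcases hcross c z hz with h | h <;> tauto
      by_cases hzB : z ∈ B
      · exact .inr ⟨this, hzB⟩
      · exact .inl ⟨this, hzB⟩
    · rintro z ⟨hz, hz'⟩ hzS
      exact hz' (hA v hv.1 z hzS.1 (hS v hv z hzS hz.symm))
  rcases hcross v a hva with h1 | h1 <;> rcases hcross v b hvb with h2 | h2
  · exact hA' h1.1 h1.2 h2.2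
  · by_cases ha : a ∈ B
    · exact hB' h2.1 ha h2.2
    · exact hA' h1.1 h1.2 (key a b ⟨h1.1, h2.1⟩ hab h1.2 ha)
  · by_cases hb : b ∈ B
    · exact hB' h1.1 h1.2 hb
    · exact hA' h2.1 (key b a ⟨h2.1, h1.1⟩ hab.symm h2.2 hb) h2.2
  · exact hB' h1.1 h1.2 h2.2

/-- In a graph in which all cycles of length at least four have chords, a connected set whose
neighbourhood is a clique contains a vertex that is adjacent to the whole neighbourhood. -/
theorem NeighborsJoined.exists_dominating {H : SimpleGraph V} (hH : H.NeighborsJoined) {C : Set V}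
    (hne : C.Nonempty) (hC : ∀ x ∈ C, ∀ y ∈ C, H.Conn C x y) (S : Finset V)
    (hcl : ∀ s ∈ S, ∀ s' ∈ S, s ≠ s' → H.Adj s s') (hSC : ∀ s ∈ S, s ∉ C ∧ ∃ e ∈ C, H.Adj e s) :
    ∃ c ∈ C, ∀ s ∈ S, H.Adj c s := by
  classical
  induction S using Finset.induction_on with
  | empty => obtain ⟨c, hc⟩ := hne; exact ⟨c, hc, by simp⟩
  | insert s S hs ih =>
    obtain ⟨c, hc, hcS⟩ := ih
      (fun a ha b hb => hcl a (Finset.mem_insert_of_mem ha) b (Finset.mem_insert_of_mem hb))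
      (fun a ha => hSC a (Finset.mem_insert_of_mem ha))
    have hs1 := Finset.mem_insert_self s S
    obtain ⟨hsC, e, he, hes⟩ := hSC s hs1
    by_cases hcs : H.Adj c s
    · exact ⟨c, hc, by simpa using ⟨hcs, hcS⟩⟩
    -- Let `d` be the first neighbour of `s` on a walk in `C` that starts at `c`. For `s'` in the
    -- old set, going back from `d` to `c` and on to `s'` avoids the closed neighbourhood of `s` in
    -- the interior; as `d` and `s'` are neighbours of `s`, they are adjacent.
    · obtain ⟨d, ⟨hdC, hds⟩, hcd⟩ : ∃ d ∈ C ∩ {x | H.Adj x s},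
          H.Conn (C \ {x | H.Adj x s}) c d := by
        rcases (hC c hc e he).avoid_or_hit (N := {x | H.Adj x s}) with h | h
        · exact ⟨e, ⟨he, hes⟩, h⟩
        · exact h
      refine ⟨d, hdC, ?_⟩
      intro s' hs'
      rcases Finset.mem_insert.1 hs' with rfl | hs''
      · exact hds
      · have hss' : s ≠ s' := fun h => hs (h ▸ hs'')
        have hmem : ∀ x ∈ C \ {x | H.Adj x s}, x ∈ {x | x ≠ s ∧ ¬ H.Adj s x} :=
          fun x hx => ⟨fun h => hsC (h ▸ hx.1), fun h => hx.2 h.symm⟩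
        have hcon : H.Conn {x | x ≠ s ∧ ¬ H.Adj s x} d s' :=
          (hcd.symm.mono le_rfl hmem).trans (hmem c ⟨hc, hcs⟩) (.adj (hcS s' hs''))
        rcases hH s d s' hds.symm (hcl s hs1 s' hs' hss') hcon with h | h
        · exact absurd hdC (h ▸ (hSC s' hs').1)
        · exact h

/-- A minimal triangulation has no edges that leave a set through a clique which contains the
neighbourhood of the set in the original graph. -/
theorem IsMinimalTriangulation.mem_of_adj {G H : SimpleGraph V} (h : G.IsMinimalTriangulation H)
    {C S : Set V} (hS : H.IsClique S)
    (hCS : ∀ c ∈ C, ∀ z, G.Adj c z → z ∈ C ∪ S) {c z : V} (hc : c ∈ C) (hz : H.Adj c z) :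
    z ∈ C ∪ S := by
  by_contra hzn
  -- The edges between `C` and the complement of `C ∪ S` are deleted. What remains is glued from the
  -- parts of `H` on `C ∪ S` and on the complement of `C` along a clique, so it is chordal, against
  -- the minimality of `H`.
  let H' : SimpleGraph V :=
    { Adj := fun x y => H.Adj x y ∧ (x ∈ C ∪ S ∧ y ∈ C ∪ S ∨ x ∉ C ∧ y ∉ C)
      symm := ⟨fun _ _ h => ⟨h.1.symm, h.2.imp And.symm And.symm⟩⟩
      loopless := ⟨fun _ h => h.1.ne rfl⟩ }
  have hle : H' ≤ H := fun _ _ h => h.1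
  have hH' : H'.NeighborsJoined := by
    refine h.1.2.neighborsJoined.glue (A := C ∪ S) (B := Cᶜ) hle ?_ (fun _ _ h => h.2)
      (fun x hx y hy h => ⟨h, .inl ⟨hx, hy⟩⟩) (fun x hx y hy h => ⟨h, .inr ⟨hx, hy⟩⟩)
    rintro x ⟨hx | hx, hx'⟩ y ⟨hy | hy, hy'⟩ hxy
    · exact absurd hx hx'
    · exact absurd hx hx'
    · exact absurd hy hy'
    · exact hS hx hy hxy
  refine h.2 H' ?_ (lt_of_le_of_ne hle ?_) hH'.isChordalGraph
  · intro x y hxy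
    refine ⟨h.1.1 hxy, ?_⟩
    by_cases hx : x ∈ C
    · exact .inl ⟨.inl hx, hCS x hx y hxy⟩
    · by_cases hy : y ∈ C
      · exact .inl ⟨hCS y hy x hxy.symm, .inl hy⟩
      · exact .inr ⟨hx, hy⟩
  · intro e
    have : H'.Adj c z := by rw [e]; exact hz
    rcases this.2 with h | h
    · exact hzn h.2
    · exact h.1 hc

/-- The connected component of `u` in `G ∖ Ω`. -/
def outerComp (G : SimpleGraph V) (Ω : Finset V) (u : V) : Set V :=
  {z | z ∉ Ω ∧ G.Conn {x | x ∉ Ω} u z}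

/-- The vertices of `Ω` that are adjacent to the connected component of `u` in `G ∖ Ω`. -/
def outerNbrs (G : SimpleGraph V) (Ω : Finset V) (u : V) : Set V :=
  {z | z ∈ Ω ∧ G.Conn {x | x ∉ Ω} u z}

/-- The part of the graph that is behind `Ω ∖ S`. -/
def innerSide (G : SimpleGraph V) (Ω : Finset V) (S : Set V) : Set V :=
  {z | (z ∈ Ω ∧ z ∉ S) ∨ (z ∉ Ω ∧ ∃ x ∈ Ω, x ∉ S ∧ G.Conn {x | x ∉ Ω} z x)}

section

variable {G : SimpleGraph V} {Ω : Finset V} {u : V}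

theorem mem_outer_of_adj {c z : V} (hc : c ∈ G.outerComp Ω u) (hz : G.Adj c z) :
    z ∈ G.outerComp Ω u ∪ G.outerNbrs Ω u := by
  by_cases h : z ∈ Ω
  · exact .inr ⟨h, hc.2.trans hc.1 (.adj hz)⟩
  · exact .inl ⟨h, hc.2.trans hc.1 (.adj hz)⟩

theorem outerComp_preconnected (hu : u ∉ Ω) {x y : V} (hx : x ∈ G.outerComp Ω u)
    (hy : y ∈ G.outerComp Ω u) : G.Conn (G.outerComp Ω u) x y := by
  have key : ∀ a b, G.Conn {x | x ∉ Ω} a b → a ∈ G.outerComp Ω u → b ∉ Ω →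
      G.Conn (G.outerComp Ω u) a b := by
    intro a b h
    induction h with
    | refl x => exact fun _ _ => .refl x
    | adj h => exact fun _ _ => .adj h
    | trans h₁ hy h₂ ih₁ ih₂ =>
      intro ha hb
      have hm : _ ∈ G.outerComp Ω u := ⟨hy, ha.2.trans ha.1 h₁⟩
      exact (ih₁ ha hy).trans hm (ih₂ hm hb)
  exact key x y (hx.2.symm.trans hu hy.2) hx hy.1

theorem exists_adj_of_mem_outerNbrs (hu : u ∉ Ω) {s : V} (hs : s ∈ G.outerNbrs Ω u) :
    ∃ e ∈ G.outerComp Ω u, G.Adj e s := by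
  have key : ∀ a b, G.Conn {x | x ∉ Ω} a b → a ∈ G.outerComp Ω u → b ∈ Ω →
      ∃ e ∈ G.outerComp Ω u, G.Adj e b := by
    intro a b h
    induction h with
    | refl x => exact fun h1 h2 => absurd h2 h1.1
    | adj h => exact fun ha _ => ⟨_, ha, h⟩
    | trans h₁ hy h₂ ih₁ ih₂ =>
      intro ha hb
      exact ih₂ ⟨hy, ha.2.trans ha.1 h₁⟩ hb
  exact key u s hs.2 ⟨hu, .refl u⟩ hs.1

end

/-- The component is connected already by edges of `G`, and its neighbourhood is part of the clique
`Ω`, so the chordal graph `H` supplies a dominating vertex. -/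
theorem IsMinimalTriangulation.exists_dominating [Finite V] {G H : SimpleGraph V}
    (h : G.IsMinimalTriangulation H) {Ω : Finset V} (hΩ : H.IsClique (Ω : Set V)) {u : V}
    (hu : u ∉ Ω) : ∃ c ∈ G.outerComp Ω u, ∀ s ∈ G.outerNbrs Ω u, H.Adj c s := by
  classical
  have hfin : (G.outerNbrs Ω u).Finite := Set.toFinite _
  have := h.1.2.neighborsJoined.exists_dominating (C := G.outerComp Ω u) ⟨u, hu, .refl u⟩
    (fun x hx y hy => (outerComp_preconnected hu hx hy).mono h.1.1 subset_rfl) hfin.toFinset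
    (fun s hs s' hs' hne => hΩ (by simpa using (hfin.mem_toFinset.1 hs).1)
      (by simpa using (hfin.mem_toFinset.1 hs').1) hne)
    (fun s hs => by
      have hs := hfin.mem_toFinset.1 hs
      refine ⟨fun hc => hc.1 hs.1, ?_⟩
      obtain ⟨e, he, hes⟩ := exists_adj_of_mem_outerNbrs hu hs
      exact ⟨e, he, h.1.1 hes⟩)
  simpa using this

theorem exists_maximal_isClique [Finite V] {H : SimpleGraph V} {K : Set V} (hK : H.IsClique K) :
    ∃ Ω : Finset V, K ⊆ Ω ∧ Maximal H.IsClique (Ω : Set V) := by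
  obtain ⟨Ω, hle, hmax⟩ := (Set.toFinite {A : Set V | H.IsClique A}).exists_le_maximal hK
  have := Set.toFinite Ω
  exact ⟨this.toFinset, by simpa using hle, by simpa using hmax⟩

/-- The recursive structure of a minimal triangulation: behind a maximal clique `Ω'` and a component
of `G ∖ Ω'` there is another maximal clique `Ω`, from which that component is recovered. -/
theorem IsMinimalTriangulation.exists_next [Finite V] {G H : SimpleGraph V}
    (h : G.IsMinimalTriangulation H) {Ω' : Finset V} (hΩ' : Maximal H.IsClique (Ω' : Set V)) {u : V}
    (hu : u ∉ Ω') :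
    ∃ Ω : Finset V, Maximal H.IsClique (Ω : Set V) ∧ ∃ v, G.outerNbrs Ω v = G.outerNbrs Ω' u ∧
      G.innerSide Ω (G.outerNbrs Ω v) = G.outerComp Ω' u ∧
      ∀ u' ∈ G.outerComp Ω' u, u' ∉ Ω → G.outerComp Ω u' ⊂ G.outerComp Ω' u := by
  obtain ⟨c, hc, hcS⟩ := h.exists_dominating hΩ'.1 hu
  set C := G.outerComp Ω' u with hCdef
  set S := G.outerNbrs Ω' u with hSdef
  have hSC : ∀ z ∈ C, z ∉ S := fun z hz hz' => hz.1 hz'.1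
  have hSΩ' : S ⊆ Ω' := fun s hs => by simpa using hs.1
  have hScl : H.IsClique S := hΩ'.1.subset hSΩ'
  have hclosed : ∀ z ∈ C, ∀ y, G.Adj z y → y ∈ C ∪ S := fun z hz y hy => mem_outer_of_adj hz hy
  have hcl : H.IsClique (insert c S) := hScl.insert fun s hs _ => hcS s hs
  obtain ⟨Ω, hle, hΩ⟩ := exists_maximal_isClique hcl
  have hcΩ : c ∈ Ω := by simpa using hle (Set.mem_insert c S)
  have hSΩ : ∀ s ∈ S, s ∈ Ω := fun s hs => by simpa using hle (Set.mem_insert_of_mem c hs)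
  have hΩCS : ∀ x ∈ Ω, x ∈ C ∪ S := by
    intro x hx
    by_cases hxc : x = c
    · exact .inl (hxc ▸ hc)
    · exact h.mem_of_adj hScl hclosed hc (hΩ.1 (by simpa using hcΩ) (by simpa using hx)
        (Ne.symm hxc))
  -- `S` cannot exhaust `Ω'`, since otherwise `c` could be added to the maximal clique `Ω'`. The
  -- vertex `y` lies on the far side of `S`; it is the selector of the block `C` for `Ω`.
  obtain ⟨y, hyΩ', hyS⟩ : ∃ y ∈ Ω', y ∉ S := by
    by_contra! hall
    have h2 := hΩ'.2 hcl (fun x hx => Set.mem_insert_of_mem c (hall x (by simpa using hx)))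
      (Set.mem_insert c S)
    exact hc.1 (by simpa using h2)
  have hyC : y ∉ C := fun hy => hy.1 hyΩ'
  have hyΩ : y ∉ Ω := fun hy => by
    rcases hΩCS y hy with h | h
    · exact hyC h
    · exact hyS h
  have houtS : ∀ z ∈ {x | x ∉ Ω}, z ∉ S := fun z hz hzS => hz (hSΩ z hzS)
  have hback : ∀ {a b}, G.Conn {x | x ∉ Ω} a b → a ∈ C → b ∈ C ∪ S := fun hab ha =>
    hab.mem_of_mem hclosed houtS ha
  have hN : G.outerNbrs Ω y = S := by
    have hsub : G.outerNbrs Ω y ⊆ S := by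
      rintro x ⟨hxΩ, hx⟩
      by_contra hxS
      have hxC : x ∈ C := (hΩCS x hxΩ).resolve_right hxS
      rcases hback hx.symm hxC with h | h
      · exact hyC h
      · exact hyS h
    refine hsub.antisymm fun s hs => ?_
    -- `y` and `s` are adjacent in `H`, both being in `Ω'`. By minimality, `H`-edges that leave the
    -- component of `y` in `G ∖ Ω` end in its `G`-neighbourhood, so `s` belongs to that
    -- neighbourhood.
    have hsy : H.Adj y s := hΩ'.1 (by simpa using hyΩ') (hSΩ' hs) (fun e => hyS (e ▸ hs))
    have := h.mem_of_adj (C := G.outerComp Ω y) (S := G.outerNbrs Ω y) (hScl.subset hsub)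
      (fun z hz w hw => mem_outer_of_adj hz hw) ⟨hyΩ, .refl y⟩ hsy
    exact this.resolve_left fun h => h.1 (hSΩ s hs)
  refine ⟨Ω, hΩ, y, hN, ?_, ?_⟩
  · rw [hN]
    ext z
    constructor
    · rintro (⟨hz, hzS⟩ | ⟨hz, x, hx, hxS, hzx⟩)
      · exact (hΩCS z hz).resolve_right hzS
      · exact (hback hzx.symm ((hΩCS x hx).resolve_right hxS)).resolve_right (houtS z hz)
    · intro hz
      by_cases hzΩ : z ∈ Ω
      · exact .inl ⟨hzΩ, hSC z hz⟩
      · refine .inr ⟨hzΩ, ?_⟩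
        -- On a walk inside `C` from `z` to `c ∈ Ω`, the first vertex in `Ω` is outside `S`; it puts
        -- `z` on the inner side.
        have hzc : G.Conn C z c := outerComp_preconnected hu hz hc
        rcases hzc.avoid_or_hit (N := {x | x ∈ Ω}) with h | ⟨d, hd, h⟩
        · exact ⟨c, hcΩ, hSC c hc, h.mono le_rfl fun x hx => hx.2⟩
        · exact ⟨d, hd.2, hSC d hd.1, h.mono le_rfl fun x hx => hx.2⟩
  · intro u' hu' hu'Ω
    refine ⟨fun z hz => (hback hz.2 hu').resolve_right (houtS z hz.1), fun hall => ?_⟩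
    exact (hall hc).1 hcΩ

end SimpleGraph

/-! ### Tree decompositions: from bags to triangulations, and back by attaching bags -/

namespace SimpleGraph

variable {V : Type}

/-- In a tree with root `r`, let `a` and `b` be the nodes nearest to `r` of two connected sets of
nodes that have a common node. If `b` is not farther from `r` than `a`, then `a` belongs to both
sets. -/
theorem IsTree.mem_of_dist_le {I : Type} {T : SimpleGraph I} (hT : T.IsTree) (r : I)
    {A B : Set I} (hA : (T.induce A).Connected) (hB : (T.induce B).Connected) {i a b : I}
    (hiA : i ∈ A) (hiB : i ∈ B) (ha : a ∈ A) (hb : b ∈ B) (ha' : ∀ x ∈ A, T.dist a r ≤ T.dist x r)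
    (hb' : ∀ x ∈ B, T.dist b r ≤ T.dist x r) (hab : T.dist b r ≤ T.dist a r) : a ∈ B := by
  -- Go from `i` inside `A` to its node `a` nearest to the root, then along a shortest path to the
  -- root. Beyond `a` the distances to the root are smaller than at any node of `A`, so no node is
  -- repeated.
  have key : ∀ (A : Set I) (a : I), (T.induce A).Connected → i ∈ A → a ∈ A →
      (∀ x ∈ A, T.dist a r ≤ T.dist x r) → ∃ (q : T.Walk i a) (p : T.Walk a r),
        (q.append p).IsPath ∧ p.length = T.dist a r ∧ ∀ x ∈ q.support, x ∈ A := by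
    intro A a hA hiA ha hmin
    obtain ⟨q₀, hq₀⟩ := hA.exists_isPath ⟨i, hiA⟩ ⟨a, ha⟩
    let q : T.Walk i a := q₀.map (Embedding.induce A).toHom
    have hq : q.IsPath := hq₀.map Subtype.val_injective
    have hqA : ∀ x ∈ q.support, x ∈ A := by
      intro x hx
      rw [show q.support = q₀.support.map Subtype.val from Walk.support_map _ _] at hx
      obtain ⟨y, _, rfl⟩ := List.mem_map.1 hx
      exact y.2
    obtain ⟨p, hp⟩ := hT.connected.exists_walk_length_eq_dist a r
    refine ⟨q, p, ?_, hp, hqA⟩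
    have hpp : p.IsPath := p.isPath_of_length_eq_dist hp
    rw [Walk.isPath_def, Walk.support_append, List.nodup_append]
    refine ⟨hq.support_nodup, hpp.support_nodup.tail, ?_⟩
    rintro x hx y hy rfl
    have h1 := hmin x (hqA x hx)
    have hne : x ≠ a := by
      rintro rfl
      have := hpp.support_nodup
      rw [← Walk.cons_tail_support p] at this
      exact (List.nodup_cons.1 this).1 hy
    obtain ⟨j, rfl, hj⟩ := Walk.mem_support_iff_exists_getVert.1 (List.mem_of_mem_tail hy)
    have hj0 : j ≠ 0 := by rintro rfl; simp at hne
    have := dist_le (p.drop j)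
    rw [Walk.drop_length] at this
    omega
  obtain ⟨q, p, hqp, hp, hqA⟩ := key A a hA hiA ha ha'
  obtain ⟨q', p', hqp', hp', hqB⟩ := key B b hB hiB hb hb'
  -- Both routes are the unique path from `i` to `r`. Since `a` is at least as far from `r` as `b`,
  -- it is met no later than `b`, on the section that runs inside `B`.
  have heq : q.append p = q'.append p' :=
    (hT.existsUnique_path i r).unique hqp hqp'
  have hl := congrArg Walk.length heq
  rw [Walk.length_append, Walk.length_append] at hl
  have h1 : (q.append p).getVert q.length = a := by rw [Walk.getVert_append]; simp
  rw [heq, Walk.getVert_append', if_pos (by omega)] at h1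
  exact hqB a (h1 ▸ Walk.getVert_mem_support _ _)

theorem exists_treeDecomposition [Finite V] (G : SimpleGraph V) :
    ∃ D : G.TreeDecomposition, D.width = G.treewidth := by
  have : Fintype V := Fintype.ofFinite V
  refine Nat.sInf_mem (s := {w | ∃ D : G.TreeDecomposition, D.width = w}) 
    ⟨_, ⟨1, ⊥, fun _ => Finset.univ, .of_subsingleton, ?_, ?_, ?_⟩, rfl⟩
  · simp
  · simp
  · intro v
    have : Nonempty {i : Fin 1 | v ∈ (Finset.univ : Finset V)} := ⟨0, by simp⟩
    exact ⟨Preconnected.of_subsingleton⟩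

/-- If the subgraph induced by `U` has treewidth at most `t`, then there is a minimal triangulation
all of whose cliques have at most `t + 1` vertices in `U`. -/
theorem exists_isMinimalTriangulation_card_le [Finite V] (G : SimpleGraph V) (U : Finset V) (t : ℕ)
    (ht : (G.induce (U : Set V)).treewidth ≤ t) :
    ∃ H : SimpleGraph V, G.IsMinimalTriangulation H ∧
      ∀ K : Finset V, H.IsClique (K : Set V) → K ⊆ U → K.card ≤ t + 1 := by
  classical
  obtain ⟨D, hD⟩ := exists_treeDecomposition (G.induce (U : Set V))
  obtain ⟨r⟩ := D.isTree.connected.nonempty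
  have htop : ∀ v : (U : Set V), ∃ a, v ∈ D.bag a ∧ ∀ x, v ∈ D.bag x →
      D.tree.dist a r ≤ D.tree.dist x r := by
    intro v
    obtain ⟨i, hi⟩ := D.vertex_mem v
    obtain ⟨a, ha, ha'⟩ := (Finset.univ.filter fun i => v ∈ D.bag i).exists_min_image
      (fun i => D.tree.dist i r) ⟨i, by simpa using hi⟩
    exact ⟨a, by simpa using ha, fun x hx => ha' x (by simpa using hx)⟩
  choose top htop htop' using htop
  have hmeet : ∀ (v w : (U : Set V)) (i), v ∈ D.bag i → w ∈ D.bag i →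
      D.tree.dist (top w) r ≤ D.tree.dist (top v) r → w ∈ D.bag (top v) := by
    intro v w i hv hw hle
    exact D.isTree.mem_of_dist_le r (A := {i | v ∈ D.bag i}) (B := {i | w ∈ D.bag i})
      (D.connected v) (D.connected w) hv hw (htop v) (htop w) (htop' v) (htop' w) hle
  -- Vertices outside `U` do not count in the bound and are joined to everything, since the
  -- condition is void for them; two vertices of `U` are joined if they share a bag.
  let H₀ : SimpleGraph V :=
    { Adj := fun x y => x ≠ y ∧ ∀ (hx : x ∈ U) (hy : y ∈ U),
        ∃ i, (⟨x, hx⟩ : (U : Set V)) ∈ D.bag i ∧ (⟨y, hy⟩ : (U : Set V)) ∈ D.bag i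
      symm := ⟨fun x y h => ⟨h.1.symm, fun hy hx => (h.2 hx hy).imp fun _ => And.symm⟩⟩
      loopless := ⟨fun _ h => h.1 rfl⟩ }
  have hG : G ≤ H₀ := fun x y h => ⟨h.ne, fun hx hy => D.edge_mem ⟨x, hx⟩ ⟨y, hy⟩ h⟩
  -- The depth of the topmost bag gives a perfect elimination ordering: for `v ∈ U`, the neighbours
  -- of `v` in `U` of no larger rank all lie in the topmost bag of `v`. Rank `0` is kept for the
  -- vertices outside `U`, hence the shift by one.
  let d : V → ℕ := fun x => if hx : x ∈ U then D.tree.dist (top ⟨x, hx⟩) r + 1 else 0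
  have hd : ∀ v a (hv : v ∈ U) (ha : a ∈ U), (v = a ∨ H₀.Adj v a) → d a ≤ d v →
      (⟨a, ha⟩ : (U : Set V)) ∈ D.bag (top ⟨v, hv⟩) := by
    intro v a hv ha hva hle
    simp only [d, hv, ha, dif_pos, add_le_add_iff_right] at hle
    rcases hva with rfl | hva
    · exact htop _
    · obtain ⟨i, hi1, hi2⟩ := hva.2 hv ha
      exact hmeet _ _ i hi1 hi2 hle
  have hch : H₀.IsChordalGraph := by
    refine isChordalGraph_of_rank d fun v a b hva hvb ha hb hab => ⟨hab, fun haU hbU => ?_⟩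
    have hv : v ∈ U := by
      by_contra hv
      simp [d, hv, haU] at ha
    exact ⟨_, hd v a hv haU (.inr hva) ha, hd v b hv hbU (.inr hvb) hb⟩
  -- Every clique of a subgraph of `H₀` is a clique of `H₀`, so the bound on cliques survives when
  -- edges are removed to reach a minimal triangulation.
  obtain ⟨H, hle, hmin⟩ := (Set.toFinite {H : SimpleGraph V | G.IsTriangulation H}).exists_le_minimal
    (⟨hG, hch⟩ : G.IsTriangulation H₀)
  refine ⟨H, ⟨hmin.1, fun F hGF hF hF' => hF.not_ge (hmin.2 ⟨hGF, hF'⟩ hF.le)⟩, ?_⟩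
  intro K hK hKU
  rcases K.eq_empty_or_nonempty with rfl | hne
  · simp
  obtain ⟨v, hv, hmax⟩ := K.exists_max_image d hne
  -- The topmost bag of a vertex of maximal rank contains the whole clique.
  have hsub : K ⊆ (D.bag (top ⟨v, hKU hv⟩)).map (Function.Embedding.subtype _) := by
    intro a ha
    refine Finset.mem_map.2 ⟨⟨a, hKU ha⟩, hd v a (hKU hv) (hKU ha) ?_ (hmax a ha), rfl⟩
    by_cases h : v = a
    · exact .inl h
    · exact .inr (hle (hK hv ha h))
  have h1 := Finset.card_le_card hsub
  rw [Finset.card_map] at h1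
  have h2 := Finset.le_sup (f := fun i => (D.bag i).card) (Finset.mem_univ (top ⟨v, hKU hv⟩))
  have h3 : (Finset.univ.sup fun i => (D.bag i).card) - 1 ≤ t := hD.trans_le ht
  omega

/-- `G.Built t X 𝓑`: a tree decomposition of the subgraph induced by `X`, with bags `𝓑` of size at
most `t + 1`, has been built by successively attaching bags to existing ones. -/
inductive Built [DecidableEq V] (G : SimpleGraph V) (t : ℕ) : Finset V → Set (Finset V) → Prop
  | empty : Built G t ∅ {∅}
  | attach {X A S B : Finset V} {𝓑 : Set (Finset V)} (h : Built G t X 𝓑) (hB : B ∈ 𝓑) (hS : S ⊆ B)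
      (hA : Disjoint A X) (hnb : ∀ a ∈ A, ∀ x ∈ X, G.Adj a x → x ∈ S) (hc : (S ∪ A).card ≤ t + 1) :
      Built G t (X ∪ A) (insert (S ∪ A) 𝓑)

/-- A numbering of the bags in which every bag but the first has an earlier parent. -/
theorem Built.exists_parent [DecidableEq V] {G : SimpleGraph V} {t : ℕ} {X : Finset V}
    {𝓑 : Set (Finset V)} (h : G.Built t X 𝓑) :
    ∃ (k : ℕ) (par : ℕ → ℕ) (bag : ℕ → Finset V), (∀ i, 0 < i → par i < i) ∧
      (∀ B ∈ 𝓑, ∃ i ≤ k, bag i = B) ∧ (∀ i ≤ k, (bag i).card ≤ t + 1 ∧ bag i ⊆ X) ∧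
      (∀ v ∈ X, ∃ a ≤ k, v ∈ bag a ∧ ∀ i ≤ k, v ∈ bag i → i = a ∨ (0 < i ∧ v ∈ bag (par i))) ∧
      (∀ u ∈ X, ∀ v ∈ X, G.Adj u v → ∃ i ≤ k, u ∈ bag i ∧ v ∈ bag i) := by
  induction h with
  | empty => exact ⟨0, fun _ => 0, fun _ => ∅, by simp⟩
  | @attach X A S B 𝓑 h hB hS hA hnb hc ih =>
    obtain ⟨k, par, bag, hpar, hbag, hcard, htop, hedge⟩ := ih
    obtain ⟨p, hp, rfl⟩ := hbag B hB
    have hSX : S ⊆ X := hS.trans (hcard p hp).2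
    let bag' : ℕ → Finset V := fun i => if i = k + 1 then S ∪ A else bag i
    let par' : ℕ → ℕ := fun i => if i = k + 1 then p else par i
    have hb1 : bag' (k + 1) = S ∪ A := if_pos rfl
    have hb2 : ∀ i ≤ k, bag' i = bag i := fun i hi => if_neg (by omega)
    have hp1 : par' (k + 1) = p := if_pos rfl
    have hp2 : ∀ i ≤ k, par' i = par i := fun i hi => if_neg (by omega)
    refine ⟨k + 1, par', bag', ?_, ?_, ?_, ?_, ?_⟩
    · intro i hi
      by_cases h : i = k + 1
      · rw [h, hp1]; omega
      · simp only [par', if_neg h]; exact hpar i hi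
    · rintro B (rfl | hB)
      · exact ⟨k + 1, le_rfl, hb1⟩
      · obtain ⟨i, hi, rfl⟩ := hbag B hB
        exact ⟨i, by omega, hb2 i hi⟩
    · intro i hi
      rcases Nat.le_succ_iff.1 hi with hi | rfl
      · rw [hb2 i hi]
        exact ⟨(hcard i hi).1, (hcard i hi).2.trans Finset.subset_union_left⟩
      · rw [hb1]
        exact ⟨hc, Finset.union_subset_union_left hSX⟩
    · intro v hv
      by_cases hvX : v ∈ X
      · obtain ⟨a, ha, hva, hva'⟩ := htop v hvX
        refine ⟨a, by omega, by rwa [hb2 a ha], fun i hi hvi => ?_⟩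
        rcases Nat.le_succ_iff.1 hi with hi | rfl
        · rw [hb2 i hi] at hvi
          refine (hva' i hi hvi).imp_right fun h => ⟨h.1, ?_⟩
          have := hpar i h.1
          rw [hp2 i hi, hb2 _ (by omega)]
          exact h.2
        · refine .inr ⟨by omega, ?_⟩
          rw [hp1, hb2 p hp]
          rw [hb1] at hvi
          rcases Finset.mem_union.1 hvi with h | h
          · exact hS h
          · exact absurd hvX (Finset.disjoint_left.1 hA h)
      · have hvA : v ∈ A := (Finset.mem_union.1 hv).resolve_left hvX
        refine ⟨k + 1, le_rfl, by rw [hb1]; exact Finset.mem_union_right _ hvA, fun i hi hvi => ?_⟩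
        rcases Nat.le_succ_iff.1 hi with hi | rfl
        · rw [hb2 i hi] at hvi
          exact absurd ((hcard i hi).2 hvi) hvX
        · exact .inl rfl
    · have hnew : ∀ u ∈ A, ∀ v ∈ X ∪ A, G.Adj u v → u ∈ bag' (k + 1) ∧ v ∈ bag' (k + 1) := by
        intro u hu v hv huv
        rw [hb1]
        refine ⟨Finset.mem_union_right _ hu, ?_⟩
        rcases Finset.mem_union.1 hv with h | h
        · exact Finset.mem_union_left _ (hnb u hu v h huv)
        · exact Finset.mem_union_right _ h
      intro u hu v hv huv
      rcases Finset.mem_union.1 hu with hu' | hu'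
      · rcases Finset.mem_union.1 hv with hv' | hv'
        · obtain ⟨i, hi, h⟩ := hedge u hu' v hv' huv
          exact ⟨i, by omega, by rwa [hb2 i hi]⟩
        · exact ⟨k + 1, le_rfl, (hnew v hv' u hu huv.symm).symm⟩
      · exact ⟨k + 1, le_rfl, hnew u hu' v hv huv⟩

/-- The tree on `0, …, k` in which the node `i > 0` is joined to `par i`. -/
def parentTree (k : ℕ) (par : ℕ → ℕ) : SimpleGraph (Fin (k + 1)) where
  Adj i j := ((i : ℕ) < j ∧ par j = i) ∨ ((j : ℕ) < i ∧ par i = j)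
  symm := ⟨fun _ _ h => h.symm⟩
  loopless := ⟨fun _ h => by omega⟩

/-- Passing to parents reaches `0`, which gives connectedness. The largest node of a cycle would
have two distinct smaller neighbours, but its only smaller neighbour is its parent. -/
theorem parentTree_isTree {k : ℕ} {par : ℕ → ℕ} (hpar : ∀ i, 0 < i → par i < i) :
    (parentTree k par).IsTree := by
  classical
  refine ⟨?_, ?_⟩
  · have : ∀ (i : ℕ) (hi : i < k + 1), (parentTree k par).Reachable 0 ⟨i, hi⟩ := by
      intro i
      induction i using Nat.strong_induction_on with
      | _ i ih =>
        intro hi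
        rcases Nat.eq_zero_or_pos i with rfl | h
        · exact .refl _
        · have := hpar i h
          refine (ih (par i) this (by omega)).trans (Adj.reachable ?_)
          exact .inl ⟨this, rfl⟩
    exact ⟨fun i j => (this i i.2).symm.trans (this j j.2)⟩
  · intro v₀ c₀ hc₀
    obtain ⟨v, hv, hmax⟩ := c₀.support.toFinset.exists_max_image id
      ⟨_, List.mem_toFinset.2 c₀.start_mem_support⟩
    simp only [List.mem_toFinset, id] at hv hmax
    set c := c₀.rotate v hv
    have hc : c.IsCycle := (Walk.isCycle_rotate hv).2 hc₀
    have hlen := hc.three_le_length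
    have hmem : ∀ i, c.getVert i ≤ v := fun i =>
      hmax _ ((Walk.mem_support_rotate_iff c₀ v hv).1 (c.getVert_mem_support i))
    have hpv : ∀ w, (parentTree k par).Adj v w → w ≤ v → (w : ℕ) = par v := by
      intro w hw hle
      have : (w : ℕ) ≤ v := hle
      rcases hw with h | h
      · omega
      · exact h.2.symm
    have h1 : (parentTree k par).Adj v (c.getVert 1) := by
      simpa using c.adj_getVert_succ (i := 0) (by omega)
    have h2 : (parentTree k par).Adj v (c.getVert (c.length - 1)) := by
      have := c.adj_getVert_succ (i := c.length - 1) (by omega)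
      rw [Nat.sub_add_cancel (by omega), c.getVert_length] at this
      exact this.symm
    have := hc.getVert_injOn (x₁ := 1) (x₂ := c.length - 1) ⟨by omega, by omega⟩
      ⟨by omega, by omega⟩ (Fin.ext ((hpv _ h1 (hmem _)).trans (hpv _ h2 (hmem _)).symm))
    omega

/-- In the numbering of the bags, each vertex has a top bag, and any other bag that contains it has
a parent that also contains it. Following parents thus stays among the bags of this vertex, which
shows that they are connected. Restricting the bags to `Y` covers all induced subgraphs of the built
part. -/
theorem Built.treewidth_induce_le [DecidableEq V] {G : SimpleGraph V} {t : ℕ} {X : Finset V}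
    {𝓑 : Set (Finset V)} (h : G.Built t X 𝓑) {Y : Finset V} (hY : Y ⊆ X) :
    (G.induce (Y : Set V)).treewidth ≤ t := by
  obtain ⟨k, par, bag, hpar, -, hcard, htop, hedge⟩ := h.exists_parent
  let D : (G.induce (Y : Set V)).TreeDecomposition :=
    { k := k + 1
      tree := parentTree k par
      bag := fun i => (bag i).subtype (· ∈ (Y : Set V))
      isTree := parentTree_isTree hpar
      vertex_mem := by
        rintro ⟨v, hv⟩
        obtain ⟨a, ha, hva, -⟩ := htop v (hY hv)
        exact ⟨⟨a, by omega⟩, by simpa using hva⟩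
      edge_mem := by
        rintro ⟨u, hu⟩ ⟨v, hv⟩ huv
        obtain ⟨i, hi, h1, h2⟩ := hedge u (hY hu) v (hY hv) huv
        exact ⟨⟨i, by omega⟩, by simpa using h1, by simpa using h2⟩
      connected := by
        rintro ⟨v, hv⟩
        obtain ⟨a, ha, hva, hup⟩ := htop v (hY hv)
        set I : Set (Fin (k + 1)) := {i | (⟨v, hv⟩ : (Y : Set V)) ∈ (bag i).subtype (· ∈ (Y : Set V))}
        have hI : ∀ i : Fin (k + 1), i ∈ I ↔ v ∈ bag i := fun i => by simp [I]
        have haI : (⟨a, by omega⟩ : Fin (k + 1)) ∈ I := (hI _).2 hva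
        have : ∀ (i : ℕ) (hi : i < k + 1) (hiI : (⟨i, hi⟩ : Fin (k + 1)) ∈ I),
            ((parentTree k par).induce I).Reachable ⟨_, haI⟩ ⟨⟨i, hi⟩, hiI⟩ := by
          intro i
          induction i using Nat.strong_induction_on with
          | _ i ih =>
            intro hi hiI
            rcases hup i (by omega) ((hI _).1 hiI) with rfl | ⟨h0, hm⟩
            · exact .refl _
            · have hlt := hpar i h0
              have hpI : (⟨par i, by omega⟩ : Fin (k + 1)) ∈ I := (hI _).2 hm
              refine (ih (par i) hlt (by omega) hpI).trans (Adj.reachable ?_)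
              exact .inl ⟨hlt, rfl⟩
        have hne : Nonempty I := ⟨⟨_, haI⟩⟩
        exact ⟨fun i j => (this i.1 i.1.2 i.2).symm.trans (this j.1 j.1.2 j.2)⟩ }
  have hle : (G.induce (Y : Set V)).treewidth ≤ D.width := Nat.sInf_le ⟨D, rfl⟩
  refine hle.trans ?_
  have : (Finset.univ.sup fun i => (D.bag i).card) ≤ t + 1 := by
    refine Finset.sup_le fun i _ => ?_
    have hi : (i : ℕ) < k + 1 := i.2
    calc (D.bag i).card = ((bag i).filter (· ∈ (Y : Set V))).card := by
          simp only [D]; rw [Finset.card_subtype]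
      _ ≤ (bag i).card := Finset.card_filter_le _ _
      _ ≤ t + 1 := (hcard i (by omega)).1
  unfold TreeDecomposition.width
  omega

end SimpleGraph

/-! ### The dynamic program as a statement about sets: soundness and completeness -/

namespace SimpleGraph

open scoped Classical in
/-- The vertices that are minimal in their component of `G ∖ Ω`. -/
noncomputable def outerReps {V : Type} [Fintype V] [LinearOrder V] (G : SimpleGraph V)
    (Ω : Finset V) : Finset V :=
  Finset.univ.filter fun u => u ∉ Ω ∧ ∀ x < u, x ∉ Ω → ¬ G.Conn {x | x ∉ Ω} x u

/-- The vertices through which the block selected by `v` is left; `none` selects the whole graph. -/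
def gate {V : Type} (G : SimpleGraph V) (Ω : Finset V) : Option V → Set V
  | none => ∅
  | some v => G.outerNbrs Ω v

/-- The block selected by `v`; `none` selects the whole graph. -/
def block {V : Type} (G : SimpleGraph V) (Ω : Finset V) : Option V → Set V
  | none => Set.univ
  | some v => G.innerSide Ω (G.outerNbrs Ω v)

open scoped Classical in
/-- The number of vertices obtained from a table of solutions for smaller blocks if the solution
meets `Ω` in `W`. -/
noncomputable def stepVal {V : Type} [Fintype V] [LinearOrder V] (G : SimpleGraph V)
    (tab : Set V → Set V → ℕ) (Ω : Finset V) (v : Option V) (W : Finset V) : ℕ :=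
  (W.filter (· ∈ G.block Ω v)).card +
    ∑ u ∈ (G.outerReps Ω).filter (· ∈ G.block Ω v),
      tab (G.outerComp Ω u) (↑W ∩ G.outerNbrs Ω u)

/-- There is a set of `a` vertices of the block `C` by which every partial solution that meets the
boundary of `C` in `W` can be extended. -/
def Extends {V : Type} [DecidableEq V] (G : SimpleGraph V) (t : ℕ) (C W : Set V) (a : ℕ) : Prop :=
  ∃ F : Finset V, ↑F ⊆ C ∧ F.card = a ∧ ∀ X 𝓑, G.Built t X 𝓑 → (∀ x ∈ X, x ∉ C) →
    (∀ x ∈ X, ∀ c ∈ C, G.Adj c x → x ∈ W) → (∃ B ∈ 𝓑, W ⊆ ↑B) →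
    ∃ 𝓑', 𝓑 ⊆ 𝓑' ∧ G.Built t (X ∪ F) 𝓑'

variable {V : Type} {G : SimpleGraph V} {Ω : Finset V}

theorem outerComp_subset_block {v : Option V} {u : V} (hu : u ∉ Ω) (huv : u ∈ G.block Ω v) :
    G.outerComp Ω u ⊆ G.block Ω v := by
  cases v with
  | none => exact Set.subset_univ _
  | some v =>
    intro z hz
    rcases huv with h | ⟨_, x, hx, hxS, hux⟩
    · exact absurd h.1 hu
    · exact .inr ⟨hz.1, x, hx, hxS, hz.2.symm.trans hu hux⟩

theorem mem_block_or_mem_gate {v : Option V} {x : V} (hx : x ∈ Ω) :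
    x ∈ G.block Ω v ∨ x ∈ G.gate Ω v := by
  cases v with
  | none => exact .inl trivial
  | some v =>
    by_cases h : x ∈ G.outerNbrs Ω v
    · exact .inr h
    · exact .inl (.inl ⟨hx, h⟩)

/-- This makes the all-zero table sound, from which the computation starts. -/
theorem extends_zero [DecidableEq V] (t : ℕ) (C W : Set V) : G.Extends t C W 0 :=
  ⟨∅, by simp, rfl, fun X 𝓑 h _ _ _ => ⟨𝓑, subset_rfl, by simpa using h⟩⟩

theorem mem_outerReps [Fintype V] [LinearOrder V] {u : V} :
    u ∈ G.outerReps Ω ↔ u ∉ Ω ∧ ∀ x < u, x ∉ Ω → ¬ G.Conn {x | x ∉ Ω} x u := by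
  simp [outerReps]

theorem outerReps_disjoint [Fintype V] [LinearOrder V] {u u' : V} (hu : u ∈ G.outerReps Ω)
    (hu' : u' ∈ G.outerReps Ω) (hne : u ≠ u') {z : V} (hz : z ∈ G.outerComp Ω u) :
    z ∉ G.outerComp Ω u' := by
  intro hz'
  rw [mem_outerReps] at hu hu'
  rcases hne.lt_or_gt with h | h
  · exact hu'.2 u h hu.1 (hz.2.trans hz.1 hz'.2.symm)
  · exact hu.2 u' h hu'.1 (hz'.2.trans hz.1 hz.2.symm)

theorem exists_outerRep [Fintype V] [LinearOrder V] {x : V} (hx : x ∉ Ω) :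
    ∃ u ∈ G.outerReps Ω, x ∈ G.outerComp Ω u := by
  classical
  obtain ⟨u, hu, hmin⟩ := (Finset.univ.filter (· ∈ G.outerComp Ω x)).exists_min_image id
    ⟨x, by simpa using ⟨hx, .refl x⟩⟩
  simp only [Finset.mem_filter, Finset.mem_univ, true_and, id] at hu hmin
  refine ⟨u, mem_outerReps.2 ⟨hu.1, fun y hy hyΩ hyu => ?_⟩, hx, hu.2.symm⟩
  exact (hmin y ⟨hyΩ, hu.2.trans hu.1 hyu.symm⟩).not_gt hy

/-- A bag equal to `W` is attached to a bag that contains the part of `W` in the gate; then the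
components of `G ∖ Ω` inside the block are filled one after another. Edges leaving a component end
in `Ω`, so what was chosen in other components does not interfere, and its own boundary trace lies
in the bag just attached. -/
theorem extends_stepVal [Fintype V] [LinearOrder V] {t : ℕ} {tab : Set V → Set V → ℕ}
    (htab : ∀ C W, G.Extends t C W (tab C W)) (v : Option V) {W : Finset V} (hW : W ⊆ Ω)
    (hWt : W.card ≤ t + 1) :
    G.Extends t (G.block Ω v) (↑W ∩ G.gate Ω v) (G.stepVal tab Ω v W) := by
  classical
  choose F hFC hFcard hFext using fun u => htab (G.outerComp Ω u) (↑W ∩ G.outerNbrs Ω u)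
  set C := G.block Ω v with hC
  set A := W.filter (· ∈ C) with hA
  set R := (G.outerReps Ω).filter (· ∈ C) with hR
  have hRrep : ∀ u ∈ R, u ∈ G.outerReps Ω := fun u hu => (Finset.mem_filter.1 hu).1
  have hRΩ : ∀ u ∈ R, u ∉ Ω := fun u hu => (mem_outerReps.1 (hRrep u hu)).1
  have hRC : ∀ u ∈ R, G.outerComp Ω u ⊆ C := fun u hu =>
    outerComp_subset_block (hRΩ u hu) (Finset.mem_filter.1 hu).2
  have hFΩ : ∀ u, ∀ x ∈ F u, x ∉ Ω := fun u x hx => (hFC u hx).1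
  have hAΩ : ∀ x ∈ A, x ∈ Ω := fun x hx => hW (Finset.mem_filter.1 hx).1
  refine ⟨A ∪ R.biUnion F, ?_, ?_, ?_⟩
  · intro x hx
    rcases Finset.mem_union.1 (Finset.mem_coe.1 hx) with h | h
    · exact (Finset.mem_filter.1 h).2
    · obtain ⟨u, hu, hxu⟩ := Finset.mem_biUnion.1 h
      exact hRC u hu (hFC u hxu)
  · rw [Finset.card_union_of_disjoint, Finset.card_biUnion]
    · rw [stepVal]
      congr 1
      exact Finset.sum_congr rfl fun u _ => hFcard u
    · intro u hu u' hu' hne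
      exact Finset.disjoint_left.2 fun x hx hx' =>
        outerReps_disjoint (hRrep u hu) (hRrep u' hu') hne (hFC u hx) (hFC u' hx')
    · refine Finset.disjoint_left.2 fun x hx hx' => ?_
      obtain ⟨u, hu, hxu⟩ := Finset.mem_biUnion.1 hx'
      exact hFΩ u x hxu (hAΩ x hx)
  · rintro X 𝓑 hX hXC hXW ⟨B, hB, hWB⟩
    set S₀ := W.filter (· ∈ G.gate Ω v) with hS₀
    have hbase : G.Built t (X ∪ A) (insert (S₀ ∪ A) 𝓑) := by
      refine hX.attach hB ?_ ?_ ?_ ?_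
      · intro x hx
        have := Finset.mem_filter.1 hx
        exact hWB ⟨this.1, this.2⟩
      · exact Finset.disjoint_left.2 fun x hx hx' => hXC x hx' (Finset.mem_filter.1 hx).2
      · intro a ha x hx hax
        have := hXW x hx a (Finset.mem_filter.1 ha).2 hax
        exact Finset.mem_filter.2 ⟨this.1, this.2⟩
      · refine (Finset.card_le_card ?_).trans hWt
        exact Finset.union_subset (Finset.filter_subset _ _) (Finset.filter_subset _ _)
    have hind : ∀ R' ⊆ R, ∃ 𝓑', insert (S₀ ∪ A) 𝓑 ⊆ 𝓑' ∧
        G.Built t ((X ∪ A) ∪ R'.biUnion F) 𝓑' := by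
      intro R'
      induction R' using Finset.induction_on with
      | empty => exact fun _ => ⟨_, subset_rfl, by simpa using hbase⟩
      | insert u R' huR' ih =>
        intro hsub
        obtain ⟨𝓑₁, hsub₁, hb₁⟩ := ih ((Finset.subset_insert _ _).trans hsub)
        have huR := hsub (Finset.mem_insert_self u R')
        have hmem : ∀ x ∈ (X ∪ A) ∪ R'.biUnion F,
            x ∈ X ∨ x ∈ A ∨ ∃ u' ∈ R', x ∈ F u' := by
          intro x hx
          rcases Finset.mem_union.1 hx with h | h
          · rcases Finset.mem_union.1 h with h | h
            · exact .inl h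
            · exact .inr (.inl h)
          · exact .inr (.inr (Finset.mem_biUnion.1 h))
        have hnot : ∀ x ∈ (X ∪ A) ∪ R'.biUnion F, x ∉ G.outerComp Ω u := by
          intro x hx hxu
          rcases hmem x hx with h | h | ⟨u', hu', h⟩
          · exact hXC x h (hRC u huR hxu)
          · exact hxu.1 (hAΩ x h)
          · have hne : u ≠ u' := fun e => huR' (e ▸ hu')
            exact outerReps_disjoint (hRrep u huR)
              (hRrep u' (hsub (Finset.mem_insert_of_mem hu'))) hne hxu (hFC u' h)
        have hW₁ : ∃ B ∈ 𝓑₁, ↑W ∩ G.outerNbrs Ω u ⊆ ↑B := by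
          -- The new bag contains all of `W`, because every vertex of `Ω` is in the block or in the
          -- gate.
          refine ⟨S₀ ∪ A, hsub₁ (Set.mem_insert _ _), ?_⟩
          rintro x ⟨hxW, hxN⟩
          rw [Finset.coe_union]
          rcases mem_block_or_mem_gate (G := G) (v := v) hxN.1 with h | h
          · exact .inr (by simpa [hA] using ⟨hxW, h⟩)
          · exact .inl (by simpa [hS₀] using ⟨hxW, h⟩)
        have hnb : ∀ x ∈ (X ∪ A) ∪ R'.biUnion F, ∀ c ∈ G.outerComp Ω u, G.Adj c x →
            x ∈ ↑W ∩ G.outerNbrs Ω u := by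
          intro x hx c hc hcx
          have hxN := (mem_outer_of_adj hc hcx).resolve_left (hnot x hx)
          refine ⟨?_, hxN⟩
          rcases hmem x hx with h | h | ⟨u', hu', h⟩
          · exact (hXW x h c (hRC u huR hc) hcx).1
          · exact (Finset.mem_filter.1 h).1
          · exact absurd hxN.1 (hFΩ u' x h)
        obtain ⟨𝓑₂, hsub₂, hb₂⟩ := hFext u _ _ hb₁ hnot hnb hW₁
        refine ⟨𝓑₂, hsub₁.trans hsub₂, ?_⟩
        rw [Finset.biUnion_insert, Finset.union_comm (F u), ← Finset.union_assoc]
        exact hb₂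
    obtain ⟨𝓑', hsub, hb⟩ := hind R subset_rfl
    exact ⟨𝓑', (Set.subset_insert _ _).trans hsub, by rwa [← Finset.union_assoc]⟩

/-- The whole graph is filled starting from the empty solution with one empty bag; a subset of
exactly `l` of the vertices obtained inherits the decomposition. -/
theorem Extends.treewidth_induce_le [DecidableEq V] {t a : ℕ}
    (h : G.Extends t Set.univ ∅ a) {l : ℕ} (hl : l ≤ a) :
    ∃ U : Finset V, U.card = l ∧ (G.induce (U : Set V)).treewidth ≤ t := by
  obtain ⟨F, -, rfl, hF⟩ := h
  obtain ⟨𝓑, -, hb⟩ := hF ∅ {∅} .empty (by simp) (by simp) ⟨∅, rfl, by simp⟩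
  obtain ⟨U, hU, rfl⟩ := Finset.exists_subset_card_eq hl
  exact ⟨U, rfl, hb.treewidth_induce_le (by simpa using hU)⟩

/-- Soundness thus keeps all table values at most `n`, which the machine needs for its word size. -/
theorem Extends.le_card [DecidableEq V] [Fintype V] {t a : ℕ} {C W : Set V}
    (h : G.Extends t C W a) : a ≤ Fintype.card V := by
  obtain ⟨F, -, rfl, -⟩ := h
  exact F.card_le_univ

/-- The table is large enough on the components behind the maximal cliques of `H` that have at most
`r` vertices. -/
def TableComplete (G H : SimpleGraph V) (U : Finset V) (r : ℕ) (tab : Set V → Set V → ℕ) : Prop :=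
  ∀ Ω : Finset V, Maximal H.IsClique (Ω : Set V) → ∀ u, u ∉ Ω → (G.outerComp Ω u).ncard ≤ r →
    (↑U ∩ G.outerComp Ω u).ncard ≤ tab (G.outerComp Ω u) (↑U ∩ G.outerNbrs Ω u)

-- For `W = U ∩ Ω` nothing is lost: the trace of `U` on the block is covered by its part in `Ω` and
-- its traces on the components of `G ∖ Ω` that lie in the block.
open scoped Classical in
theorem ncard_le_stepVal [Fintype V] [LinearOrder V] {U : Finset V} {tab : Set V → Set V → ℕ}
    (v : Option V)
    (h : ∀ u ∈ G.block Ω v, u ∉ Ω →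
      (↑U ∩ G.outerComp Ω u).ncard ≤ tab (G.outerComp Ω u) (↑U ∩ G.outerNbrs Ω u)) :
    (↑U ∩ G.block Ω v).ncard ≤ G.stepVal tab Ω v (U ∩ Ω) := by
  set C := G.block Ω v
  set R := (G.outerReps Ω).filter (· ∈ C) with hR
  have hsub : ↑U ∩ C ⊆ ↑((U ∩ Ω).filter (· ∈ C)) ∪ ⋃ u ∈ R, (↑U ∩ G.outerComp Ω u) := by
    rintro x ⟨hxU, hxC⟩
    by_cases hx : x ∈ Ω
    · exact .inl (by simpa using ⟨⟨hxU, hx⟩, hxC⟩)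
    · obtain ⟨u, hu, hxu⟩ := exists_outerRep (G := G) hx
      refine .inr (Set.mem_biUnion (x := u) ?_ ⟨hxU, hxu⟩)
      have hux : u ∈ G.outerComp Ω x := ⟨(mem_outerReps.1 hu).1, hxu.2.symm⟩
      exact Finset.mem_coe.2 (Finset.mem_filter.2 ⟨hu, outerComp_subset_block hx hxC hux⟩)
  calc (↑U ∩ C).ncard ≤ _ := Set.ncard_le_ncard hsub (Set.toFinite _)
    _ ≤ _ := Set.ncard_union_le _ _
    _ ≤ _ := by
      rw [Set.ncard_coe_finset, stepVal]
      refine Nat.add_le_add_left ?_ _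
      refine (Finset.set_ncard_biUnion_le _ _).trans (Finset.sum_le_sum fun u hu => ?_)
      have hu' := Finset.mem_filter.1 hu
      have hN : (↑(U ∩ Ω) : Set V) ∩ G.outerNbrs Ω u = ↑U ∩ G.outerNbrs Ω u := by
        ext x
        simp only [Finset.coe_inter, Set.mem_inter_iff, Finset.mem_coe]
        exact ⟨fun h => ⟨h.1.1, h.2⟩, fun h => ⟨⟨h.1, h.2.1⟩, h.2⟩⟩
      rw [hN]
      exact h u hu'.2 (mem_outerReps.1 hu'.1).1

/-- One round of the dynamic program. -/
theorem TableComplete.succ [Fintype V] [LinearOrder V] {H : SimpleGraph V} {U : Finset V} {t r : ℕ}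
    (hH : G.IsMinimalTriangulation H)
    (hU : ∀ K : Finset V, H.IsClique (K : Set V) → K ⊆ U → K.card ≤ t + 1)
    {tab tab' : Set V → Set V → ℕ} (htab : TableComplete G H U r tab)
    (hstep : ∀ Ω ∈ G.potentialMaximalCliques, ∀ v, ∀ W ⊆ Ω, W.card ≤ t + 1 →
      G.stepVal tab Ω v W ≤ tab' (G.block Ω v) (↑W ∩ G.gate Ω v)) :
    TableComplete G H U (r + 1) tab' := by
  intro Ω' hΩ' u hu hcard
  -- The component behind `Ω'` reappears as the block of another maximal clique `Ω`, and the
  -- components of `G ∖ Ω` inside it have lost at least one vertex, so the table is complete for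
  -- them.
  obtain ⟨Ω, hΩ, v, hN, hC, hlt⟩ := hH.exists_next hΩ' hu
  have hblock : G.block Ω (some v) = G.outerComp Ω' u := hC
  have hgate : (↑(U ∩ Ω) : Set V) ∩ G.gate Ω (some v) = ↑U ∩ G.outerNbrs Ω' u := by
    rw [gate, ← hN]
    ext x
    simp only [Finset.coe_inter, Set.mem_inter_iff, Finset.mem_coe]
    exact ⟨fun h => ⟨h.1.1, h.2⟩, fun h => ⟨⟨h.1, h.2.1⟩, h.2⟩⟩
  have h1 := hstep Ω ⟨H, hH, hΩ⟩ (some v) (U ∩ Ω) Finset.inter_subset_right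
    (hU _ (hΩ.1.subset (by simp)) Finset.inter_subset_left)
  have h2 := ncard_le_stepVal (G := G) (Ω := Ω) (U := U) (tab := tab) (some v) (by
    intro w hw hwΩ
    rw [hblock] at hw
    refine htab Ω hΩ w hwΩ ?_
    have := Set.ncard_lt_ncard (hlt w hw hwΩ) (Set.toFinite _)
    omega)
  rw [hgate, hblock] at h1
  rw [hblock] at h2
  exact h2.trans h1

/-- At the root there is no previous clique, so any maximal clique of `H` will do, with the whole
graph as block and no gate. -/
theorem TableComplete.card_le [Fintype V] [LinearOrder V] {H : SimpleGraph V} {U : Finset V}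
    {t r : ℕ} (hH : G.IsMinimalTriangulation H)
    (hU : ∀ K : Finset V, H.IsClique (K : Set V) → K ⊆ U → K.card ≤ t + 1)
    {tab tab' : Set V → Set V → ℕ} (htab : TableComplete G H U r tab)
    (hr : ∀ Ω u, u ∉ Ω → (G.outerComp Ω u).ncard ≤ r)
    (hstep : ∀ Ω ∈ G.potentialMaximalCliques, ∀ v, ∀ W ⊆ Ω, W.card ≤ t + 1 →
      G.stepVal tab Ω v W ≤ tab' (G.block Ω v) (↑W ∩ G.gate Ω v)) :
    U.card ≤ tab' Set.univ ∅ := by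
  obtain ⟨Ω, -, hΩ⟩ := exists_maximal_isClique (H := H) (K := ∅) (by simp)
  have h1 := hstep Ω ⟨H, hH, hΩ⟩ none (U ∩ Ω) Finset.inter_subset_right
    (hU _ (hΩ.1.subset (by simp)) Finset.inter_subset_left)
  have h2 := ncard_le_stepVal (G := G) (Ω := Ω) (U := U) (tab := tab) none
    (fun w _ hwΩ => htab Ω hΩ w hwΩ (hr Ω w hwΩ))
  have := h2.trans h1
  simpa [block, gate] using this

/-- A component contains the vertex that names it, so there is no case to check. -/
theorem tableComplete_zero [Finite V] (H : SimpleGraph V) (U : Finset V)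
    (tab : Set V → Set V → ℕ) : TableComplete G H U 0 tab := by
  intro Ω _ u hu h
  have h0 : G.outerComp Ω u = ∅ := (Set.ncard_eq_zero (Set.toFinite _)).1 (by omega)
  exact absurd (show u ∈ G.outerComp Ω u from ⟨hu, .refl u⟩) (by simp [h0])

/-- Every vertex of the component except possibly `u` has a neighbour in `G`, and the vertices of
positive degree number at most the sum of the degrees. This makes the number of rounds linear in
`m`; the extra `1` covers an isolated vertex. -/
theorem ncard_outerComp_le [Fintype V] (u : V) :
    (G.outerComp Ω u).ncard ≤ 2 * G.edgeSet.ncard + 1 := by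
  classical
  have hsub : G.outerComp Ω u ⊆ insert u ↑(Finset.univ.filter fun x => 1 ≤ G.degree x) := by
    have key : ∀ a b, G.Conn {x | x ∉ Ω} a b → b = a ∨ 1 ≤ G.degree b := by
      intro a b h
      induction h with
      | refl x => exact .inl rfl
      | adj h => exact .inr ((G.degree_pos_iff_exists_adj _).2 ⟨_, h.symm⟩)
      | trans _ _ _ ih₁ ih₂ =>
        rcases ih₂ with rfl | h
        · exact ih₁
        · exact .inr h
    intro x hx
    rcases key u x hx.2 with h | h
    · exact .inl h
    · exact .inr (by simpa using h)
  have h1 := Set.ncard_le_ncard hsub (Set.toFinite _)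
  have h2 := Set.ncard_insert_le u ↑(Finset.univ.filter fun x => 1 ≤ G.degree x)
  rw [Set.ncard_coe_finset] at h2
  have h3 : (Finset.univ.filter fun x => 1 ≤ G.degree x).card ≤ ∑ x, G.degree x := by
    rw [Finset.card_eq_sum_ones]
    refine (Finset.sum_le_sum fun x hx => (Finset.mem_filter.1 hx).2).trans ?_
    exact Finset.sum_le_sum_of_subset (Finset.filter_subset _ _)
  rw [G.sum_degrees_eq_twice_card_edges, ← Set.ncard_coe_finset G.edgeFinset, coe_edgeFinset] at h3
  omega

end SimpleGraph

/-! ### A programming language with arrays and its translation to the machine -/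

namespace ArrayLang

open WordRAM

/-! ### Word sizes -/

/-- All values in the state are at most `K`. -/
def RawBounded (K : ℕ) (s : State) : Prop := (∀ r, s.reg r ≤ K) ∧ ∀ a, s.mem a ≤ K

/-- An exponent `d` such that the expression takes values at most `K ^ d` on states bounded
by `K`. -/
def exprDegree : Expr → ℕ
  -- This is enough since `k < K ^ (k + 1)` for `K ≥ 2`.
  | .const k => k + 1
  | .reg _ => 1
  | .load a => exprDegree a + 1
  | .op _ e₁ e₂ => exprDegree e₁ + exprDegree e₂ + 1

/-- The sum of the degrees of the expressions of a program. -/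
def progDegree : Prog → ℕ
  | .skip => 0
  | .assign _ e => exprDegree e
  | .store a e => exprDegree a + exprDegree e
  | .seq p q => progDegree p + progDegree q
  | .ite e p q => exprDegree e + progDegree p + progDegree q
  | .while e p => exprDegree e + progDegree p

/-- Both bounds are at least `1`, so a sum is at most twice their product; the additional exponent
absorbs the factor two, and no other operation gives more. -/
theorem binOp_eval_le {K d₁ d₂ a b : ℕ} (hK : 2 ≤ K) (o : BinOp) (ha : a ≤ K ^ d₁)
    (hb : b ≤ K ^ d₂) : o.eval a b ≤ K ^ (d₁ + d₂ + 1) := by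
  have h1 : 1 ≤ K ^ d₁ := Nat.one_le_pow _ _ (by omega)
  have h2 : 1 ≤ K ^ d₂ := Nat.one_le_pow _ _ (by omega)
  have h3 : K ^ (d₁ + d₂ + 1) = K ^ d₁ * K ^ d₂ * K := by ring
  have h5 : K ^ d₁ * K ^ d₂ * 2 ≤ K ^ d₁ * K ^ d₂ * K := Nat.mul_le_mul_left _ hK
  have h6 : K ^ d₁ ≤ K ^ d₁ * K ^ d₂ := Nat.le_mul_of_pos_right _ h2
  have h7 : K ^ d₂ ≤ K ^ d₁ * K ^ d₂ := Nat.le_mul_of_pos_left _ h1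
  rw [h3]
  cases o with
  | add => simp only [BinOp.eval]; omega
  | sub => simp only [BinOp.eval]; omega
  | mul => simp only [BinOp.eval]; have := Nat.mul_le_mul ha hb; omega
  | div => simp only [BinOp.eval]; have := Nat.div_le_self a b; omega
  | mod => simp only [BinOp.eval]; have := Nat.mod_le a b; omega
  | lt => simp only [BinOp.eval]; split <;> omega
  | eq => simp only [BinOp.eval]; split <;> omega

theorem eval_le_pow {K : ℕ} {s : State} (hK : 2 ≤ K) (hs : RawBounded K s) (e : Expr) :
    e.eval s ≤ K ^ exprDegree e := by
  induction e with
  | const k =>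
    have := Nat.lt_pow_self (n := k + 1) (a := K) (by omega)
    simp only [Expr.eval, exprDegree]; omega
  | reg x => simpa [Expr.eval, exprDegree] using hs.1 x
  | load a _ =>
    refine (hs.2 _).trans ?_
    exact Nat.le_self_pow (by simp [exprDegree]) K
  | op o e₁ e₂ ih₁ ih₂ => exact binOp_eval_le hK o ih₁ ih₂

/-- All subexpressions, addresses included, have smaller degree. The word size therefore depends on
the syntax of the expression and a bound for the state only. -/
theorem fits_of_degree {K M d : ℕ} {s : State} (hK : 2 ≤ K) (hs : RawBounded K s) (e : Expr)
    (hd : exprDegree e ≤ d) (hM : K ^ d < M) : e.Fits M s := by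
  have hval : ∀ e, exprDegree e ≤ d → e.eval s < M := fun e he =>
    ((eval_le_pow hK hs e).trans (Nat.pow_le_pow_right (by omega) he)).trans_lt hM
  induction e with
  | const k => exact hval _ hd
  | reg x => exact hval _ hd
  | load a ih =>
    refine ⟨ih (by simp only [exprDegree] at hd; omega), hval _ hd⟩
  | op o e₁ e₂ ih₁ ih₂ =>
    simp only [exprDegree] at hd
    exact ⟨ih₁ (by omega), ih₂ (by omega), hval (.op o e₁ e₂) (by simp only [exprDegree]; omega)⟩

/-! ### A language with arrays and bounded loops

Every assigned value is reduced modulo a word bound, so that all values stay bounded. -/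

/-- The constant data of a computation: parameters and input words. The parameter `0` is the word
bound, the parameter `1` is the address at which the arrays start. -/
structure Env where
  par : ℕ → ℕ
  inp : ℕ → ℕ

/-- The values of the variables and the contents of eight arrays. -/
structure AState where
  var : ℕ → ℕ
  arr : Fin 8 → ℕ → ℕ

/-- Assign a value to a variable. -/
def AState.setVar (s : AState) (x v : ℕ) : AState := ⟨Function.update s.var x v, s.arr⟩

/-- Assign a value to an array element. -/
def AState.setArr (s : AState) (k : Fin 8) (i v : ℕ) : AState :=
  ⟨s.var, Function.update s.arr k (Function.update (s.arr k) i v)⟩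

/-- The content of the memory. -/
def Env.mem (e : Env) (s : AState) (a : ℕ) : ℕ :=
  if a < e.par 1 then e.inp a
  -- Behind the input, array `k` occupies the addresses with offset congruent to `k` modulo `8`, so
  -- no array needs a length fixed in advance.
  else s.arr ⟨(a - e.par 1) % 8, Nat.mod_lt _ (by norm_num)⟩ ((a - e.par 1) / 8)

/-- The machine state that represents a state. -/
def Env.raw (e : Env) (s : AState) : State where
  reg r := if r % 2 = 0 then e.par (r / 2) else s.var (r / 2)
  mem := e.mem s

/-- Expressions: constants, parameters, variables, input words, array elements, operations. -/
inductive AExpr where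
  | const (k : ℕ)
  | par (i : ℕ)
  | var (x : ℕ)
  | inp (a : AExpr)
  | arr (k : Fin 8) (a : AExpr)
  | op (o : BinOp) (e₁ e₂ : AExpr)

namespace AExpr

/-- The value of an expression. -/
def eval (e : Env) (s : AState) : AExpr → ℕ
  | const k => k
  | par i => e.par i
  | var x => s.var x
  | inp a => e.mem s (a.eval e s)
  | arr k a => s.arr k (a.eval e s)
  | op o e₁ e₂ => o.eval (e₁.eval e s) (e₂.eval e s)

/-- The address of an array element. -/
def address (k : Fin 8) (a : Expr) : Expr :=
  .op .add (.reg 2) (.op .add (.op .mul (.const 8) a) (.const k))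

/-- Translation into machine expressions. -/
def compile : AExpr → Expr
  | const k => .const k
  | par i => .reg (2 * i)
  | var x => .reg (2 * x + 1)
  | inp a => .load a.compile
  | arr k a => .load (address k a.compile)
  | op o e₁ e₂ => .op o e₁.compile e₂.compile

instance (k : ℕ) : OfNat AExpr k := ⟨const k⟩
instance : Add AExpr := ⟨op .add⟩
instance : Sub AExpr := ⟨op .sub⟩
instance : Mul AExpr := ⟨op .mul⟩
instance : Div AExpr := ⟨op .div⟩
instance : Mod AExpr := ⟨op .mod⟩

/-- The comparison `a < b`. -/
def lt (a b : AExpr) : AExpr := op .lt a b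

/-- The comparison `a = b`. -/
def eq (a b : AExpr) : AExpr := op .eq a b

variable (e : Env) (s : AState) (a b : AExpr)

@[simp] theorem eval_zero : eval e s 0 = 0 := rfl
@[simp] theorem eval_one : eval e s 1 = 1 := rfl
@[simp] theorem eval_two : eval e s 2 = 2 := rfl
@[simp] theorem eval_four : eval e s 4 = 4 := rfl
@[simp] theorem eval_five : eval e s 5 = 5 := rfl
@[simp] theorem eval_par (i : ℕ) : eval e s (par i) = e.par i := rfl
@[simp] theorem eval_var (x : ℕ) : eval e s (var x) = s.var x := rfl
@[simp] theorem eval_inp : eval e s (inp a) = e.mem s (eval e s a) := rfl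
@[simp] theorem eval_arr (k : Fin 8) : eval e s (arr k a) = s.arr k (eval e s a) := rfl
@[simp] theorem eval_add : eval e s (a + b) = eval e s a + eval e s b := rfl
@[simp] theorem eval_sub : eval e s (a - b) = eval e s a - eval e s b := rfl
@[simp] theorem eval_mul : eval e s (a * b) = eval e s a * eval e s b := rfl
@[simp] theorem eval_div : eval e s (a / b) = eval e s a / eval e s b := rfl
@[simp] theorem eval_mod : eval e s (a % b) = eval e s a % eval e s b := rfl
@[simp] theorem eval_lt : eval e s (lt a b) = if eval e s a < eval e s b then 1 else 0 := rfl
@[simp] theorem eval_eq : eval e s (eq a b) = if eval e s a = eval e s b then 1 else 0 := rfl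

end AExpr

/-- Statements. In `loop x b p` the variable `x` runs over the numbers below the parameter `b`. -/
inductive Stmt where
  | skip
  | assign (x : ℕ) (a : AExpr)
  | store (k : Fin 8) (i a : AExpr)
  | seq (p q : Stmt)
  | ite (a : AExpr) (p q : Stmt)
  | loop (x b : ℕ) (p : Stmt)

namespace Stmt

/-- The effect of a statement. -/
def exec (e : Env) : Stmt → AState → AState
  | skip, s => s
  | assign x a, s => s.setVar x (a.eval e s % e.par 0)
  | store k i a, s => s.setArr k (i.eval e s) (a.eval e s % e.par 0)
  | seq p q, s => exec e q (exec e p s)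
  | ite a p q, s => if a.eval e s ≠ 0 then exec e p s else exec e q s
  | loop x b p, s =>
    (Nat.rec s (fun j s' => exec e p (s'.setVar x j)) (e.par b) : AState).setVar x (e.par b)

/-- Translation into machine programs. -/
def compile : Stmt → Prog
  | skip => .skip
  | assign x a => .assign (2 * x + 1) (.op .mod a.compile (.reg 0))
  | store k i a => .store (AExpr.address k i.compile) (.op .mod a.compile (.reg 0))
  | seq p q => .seq p.compile q.compile
  | ite a p q => .ite a.compile p.compile q.compile
  | loop x b p => .seq (.assign (2 * x + 1) (.const 0))
      (.while (.op .lt (.reg (2 * x + 1)) (.reg (2 * b)))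
        (.seq p.compile (.assign (2 * x + 1) (.op .add (.reg (2 * x + 1)) (.const 1)))))

/-- A bound for the running time. -/
def cost (e : Env) : Stmt → ℕ
  | skip => 1
  | assign _ a => a.compile.cost + 3
  | store _ i a => i.compile.cost + a.compile.cost + 9
  | seq p q => cost e p + cost e q
  | ite a p q => a.compile.cost + 1 + (cost e p + cost e q)
  -- Each iteration pays `4` for the test and `4` for the increment; `6` is the initialization, of
  -- cost `2`, and the last test.
  | loop _ b p => e.par b * (cost e p + 8) + 6

/-- The variables that are changed by a statement. -/
def vars : Stmt → List ℕ
  | skip => []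
  | assign x _ => [x]
  | store _ _ _ => []
  | seq p q => p.vars ++ q.vars
  | ite _ p q => p.vars ++ q.vars
  | loop x _ p => x :: p.vars

/-- The arrays that are changed by a statement. -/
def arrs : Stmt → List (Fin 8)
  | skip => []
  | assign _ _ => []
  | store k _ _ => [k]
  | seq p q => p.arrs ++ q.arrs
  | ite _ p q => p.arrs ++ q.arrs
  | loop _ _ p => p.arrs

/-- No loop variable is changed in the body of the loop. -/
def wf : Stmt → Bool
  | skip => true
  | assign _ _ => true
  | store _ _ _ => true
  | seq p q => p.wf && q.wf
  | ite _ p q => p.wf && q.wf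
  | loop x _ p => !p.vars.contains x && p.wf

end Stmt

/-- The states `s` and `s'` differ only in the given variables and arrays. -/
def SameExcept (vs : List ℕ) (ks : List (Fin 8)) (s s' : AState) : Prop :=
  (∀ x ∉ vs, s'.var x = s.var x) ∧ ∀ k ∉ ks, s'.arr k = s.arr k

theorem SameExcept.refl (vs : List ℕ) (ks : List (Fin 8)) (s : AState) : SameExcept vs ks s s :=
  ⟨fun _ _ => rfl, fun _ _ => rfl⟩

theorem SameExcept.trans {vs : List ℕ} {ks : List (Fin 8)} {s s' s'' : AState}
    (h : SameExcept vs ks s s') (h' : SameExcept vs ks s' s'') : SameExcept vs ks s s'' :=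
  ⟨fun x hx => (h'.1 x hx).trans (h.1 x hx), fun k hk => (h'.2 k hk).trans (h.2 k hk)⟩

theorem SameExcept.mono {vs vs' : List ℕ} {ks ks' : List (Fin 8)} {s s' : AState}
    (h : SameExcept vs ks s s') (hv : vs ⊆ vs') (hk : ks ⊆ ks') : SameExcept vs' ks' s s' :=
  ⟨fun x hx => h.1 x fun h => hx (hv h), fun k hk' => h.2 k fun h => hk' (hk h)⟩

theorem SameExcept.setVar {vs : List ℕ} {ks : List (Fin 8)} {s s' : AState}
    (h : SameExcept vs ks s s') {x : ℕ} (hx : x ∈ vs) (v : ℕ) : SameExcept vs ks s (s'.setVar x v) :=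
  ⟨fun y hy => by
    rw [← h.1 y hy]
    exact Function.update_of_ne (fun e => hy (by rwa [e])) _ _, h.2⟩

@[simp] theorem AState.setVar_arr (s : AState) (x v : ℕ) : (s.setVar x v).arr = s.arr := rfl
@[simp] theorem AState.setArr_var (s : AState) (k : Fin 8) (i v : ℕ) :
    (s.setArr k i v).var = s.var := rfl
@[simp] theorem AState.setVar_var (s : AState) (x v y : ℕ) :
    (s.setVar x v).var y = if y = x then v else s.var y := Function.update_apply ..
@[simp] theorem AState.setArr_arr (s : AState) (k : Fin 8) (i v : ℕ) (k' : Fin 8) :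
    (s.setArr k i v).arr k' = if k' = k then Function.update (s.arr k) i v else s.arr k' := by
  by_cases h : k' = k
  · subst h; simp [AState.setArr]
  · simp [AState.setArr, h]
theorem AState.setVar_var_self (s : AState) (x v : ℕ) : (s.setVar x v).var x = v :=
  Function.update_self ..
theorem AState.setVar_var_of_ne (s : AState) {x y : ℕ} (v : ℕ) (h : y ≠ x) :
    (s.setVar x v).var y = s.var y := Function.update_of_ne h ..
theorem AState.setArr_arr_self (s : AState) (k : Fin 8) (i v : ℕ) :
    (s.setArr k i v).arr k = Function.update (s.arr k) i v := Function.update_self ..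
theorem AState.setArr_arr_of_ne (s : AState) {k k' : Fin 8} (i v : ℕ) (h : k' ≠ k) :
    (s.setArr k i v).arr k' = s.arr k' := Function.update_of_ne h ..

@[simp] theorem exec_skip (e : Env) (s : AState) : Stmt.skip.exec e s = s := rfl
@[simp] theorem exec_assign (e : Env) (s : AState) (x : ℕ) (a : AExpr) :
    (Stmt.assign x a).exec e s = s.setVar x (a.eval e s % e.par 0) := rfl
@[simp] theorem exec_store (e : Env) (s : AState) (k : Fin 8) (i a : AExpr) :
    (Stmt.store k i a).exec e s = s.setArr k (i.eval e s) (a.eval e s % e.par 0) := rfl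
@[simp] theorem exec_seq (e : Env) (s : AState) (p q : Stmt) :
    (Stmt.seq p q).exec e s = q.exec e (p.exec e s) := rfl
@[simp] theorem exec_ite (e : Env) (s : AState) (a : AExpr) (p q : Stmt) :
    (Stmt.ite a p q).exec e s = if a.eval e s ≠ 0 then p.exec e s else q.exec e s := rfl

/-- The state before the iteration `j` of a loop, up to the value of the loop variable. -/
def iterate (e : Env) (x : ℕ) (p : Stmt) (s : AState) : ℕ → AState
  | 0 => s
  | j + 1 => p.exec e ((iterate e x p s j).setVar x j)

theorem exec_loop (e : Env) (x b : ℕ) (p : Stmt) (s : AState) :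
    (Stmt.loop x b p).exec e s = (iterate e x p s (e.par b)).setVar x (e.par b) := by
  have : ∀ k : ℕ, (Nat.rec s (fun j s' => p.exec e (s'.setVar x j)) k : AState) =
      iterate e x p s k := by
    intro k
    induction k with
    | zero => rfl
    | succ k ih => simp only [iterate, ← ih]
  rw [Stmt.exec, this]

theorem sameExcept_exec (e : Env) (p : Stmt) (s : AState) :
    SameExcept p.vars p.arrs s (p.exec e s) := by
  induction p generalizing s with
  | skip => exact .refl ..
  | assign x a => exact SameExcept.setVar (.refl ..) (by simp [Stmt.vars]) _
  | store k i a =>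
    exact ⟨fun _ _ => rfl, fun k' hk' => AState.setArr_arr_of_ne _ _ _ (by simpa [Stmt.arrs] using hk')⟩
  | seq p q ihp ihq =>
    exact ((ihp s).mono (by simp [Stmt.vars]) (by simp [Stmt.arrs])).trans
      ((ihq _).mono (by simp [Stmt.vars]) (by simp [Stmt.arrs]))
  | ite a p q ihp ihq =>
    rw [Stmt.exec]
    split
    · exact (ihp s).mono (by simp [Stmt.vars]) (by simp [Stmt.arrs])
    · exact (ihq s).mono (by simp [Stmt.vars]) (by simp [Stmt.arrs])
  | loop x b p ih =>
    rw [exec_loop]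
    have : ∀ k, SameExcept (Stmt.loop x b p).vars (Stmt.loop x b p).arrs s
        (iterate e x p s k) := by
      intro k
      induction k with
      | zero => exact .refl ..
      | succ k ihk =>
        exact (ihk.setVar (by simp [Stmt.vars]) k).trans
          ((ih _).mono (by simp [Stmt.vars]) (by simp [Stmt.arrs]))
    exact (this _).setVar (by simp [Stmt.vars]) _

/-- The invariant rule for loops; what the loop does not change is part of every invariant. -/
theorem loop_rule {e : Env} {x b : ℕ} {p q : Stmt} {s : AState} (hq : q = .loop x b p)
    (I : ℕ → AState → Prop)
    (h0 : I 0 s)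
    (hstep : ∀ j < e.par b, ∀ s', SameExcept (x :: p.vars) p.arrs s s' → I j s' →
      I (j + 1) (p.exec e (s'.setVar x j))) :
    ∃ s', q.exec e s = s'.setVar x (e.par b) ∧ I (e.par b) s' ∧
      SameExcept (x :: p.vars) p.arrs s s' := by
  subst hq
  refine ⟨_, exec_loop e x b p s, ?_⟩
  have : ∀ k ≤ e.par b, I k (iterate e x p s k) ∧
      SameExcept (x :: p.vars) p.arrs s (iterate e x p s k) := by
    intro k
    induction k with
    | zero => exact fun _ => ⟨h0, .refl ..⟩
    | succ k ih =>
      intro hk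
      obtain ⟨h1, h2⟩ := ih (by omega)
      exact ⟨hstep k (by omega) _ h2 h1, (h2.setVar (by simp) k).trans
        ((sameExcept_exec e p _).mono (by simp) (by simp))⟩
  exact this _ le_rfl

/-! ### Simulation -/

/-- All values are bounded by the word bound. -/
def Bounded (e : Env) (s : AState) : Prop :=
  (∀ x, s.var x ≤ e.par 0) ∧ ∀ k a, s.arr k a ≤ e.par 0

/-- The parameters and the input are bounded by the word bound. -/
structure Env.Bounded (e : Env) : Prop where
  two_le : 2 ≤ e.par 0
  par_le : ∀ i, e.par i ≤ e.par 0
  inp_le : ∀ a, e.inp a ≤ e.par 0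

theorem Bounded.setVar {e : Env} {s : AState} (h : Bounded e s) (x : ℕ) {v : ℕ}
    (hv : v ≤ e.par 0) : Bounded e (s.setVar x v) := by
  refine ⟨fun y => ?_, h.2⟩
  by_cases hy : y = x
  · rw [hy, AState.setVar_var_self]; exact hv
  · rw [AState.setVar_var_of_ne _ _ hy]; exact h.1 y

theorem Bounded.setArr {e : Env} {s : AState} (h : Bounded e s) (k : Fin 8) (i : ℕ) {v : ℕ}
    (hv : v ≤ e.par 0) : Bounded e (s.setArr k i v) := by
  refine ⟨h.1, fun k' a => ?_⟩
  by_cases hk : k' = k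
  · rw [hk, AState.setArr_arr_self, Function.update_apply]
    split
    · exact hv
    · exact h.2 k a
  · rw [AState.setArr_arr_of_ne _ _ _ hk]; exact h.2 k' a

/-- Assigned values are reduced modulo the word bound and loop counters stop at a parameter. Hence
boundedness holds for every statement, whatever it computes. -/
theorem Bounded.exec {e : Env} (he : e.Bounded) {s : AState} (h : Bounded e s) (p : Stmt) :
    Bounded e (p.exec e s) := by
  have hK : 0 < e.par 0 := by have := he.two_le; omega
  induction p generalizing s with
  | skip => exact h
  | assign x a => exact h.setVar x (Nat.mod_lt _ hK).le
  | store k i a => exact h.setArr k _ (Nat.mod_lt _ hK).le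
  | seq p q ihp ihq => exact ihq (ihp h)
  | ite a p q ihp ihq =>
    rw [Stmt.exec]
    split
    · exact ihp h
    · exact ihq h
  | loop x b p ih =>
    rw [exec_loop]
    have : ∀ k ≤ e.par b, Bounded e (iterate e x p s k) := by
      intro k
      induction k with
      | zero => exact fun _ => h
      | succ k ihk =>
        exact fun hk => ih ((ihk (by omega)).setVar x ((by omega : k ≤ e.par b).trans (he.par_le b)))
    exact (this _ le_rfl).setVar x (he.par_le b)

theorem rawBounded_raw {e : Env} (he : e.Bounded) {s : AState} (h : Bounded e s) :
    RawBounded (e.par 0) (e.raw s) := by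
  refine ⟨fun r => ?_, fun a => ?_⟩
  · simp only [Env.raw]
    split
    · exact he.par_le _
    · exact h.1 _
  · simp only [Env.raw, Env.mem]
    split
    · exact he.inp_le _
    · exact h.2 _ _

@[simp] theorem raw_reg_par (e : Env) (s : AState) (i : ℕ) : (e.raw s).reg (2 * i) = e.par i := by
  simp [Env.raw]

@[simp] theorem raw_reg_var (e : Env) (s : AState) (x : ℕ) :
    (e.raw s).reg (2 * x + 1) = s.var x := by
  have h1 : (2 * x + 1) % 2 = 1 := by omega
  have h2 : (2 * x + 1) / 2 = x := by omega
  simp [Env.raw, h1, h2]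

theorem mem_array (e : Env) (s : AState) (k : Fin 8) (a : ℕ) :
    e.mem s (e.par 1 + (8 * a + k)) = s.arr k a := by
  have hk := k.2
  have h1 : ¬ (e.par 1 + (8 * a + k) < e.par 1) := by omega
  have h2 : e.par 1 + (8 * a + k) - e.par 1 = 8 * a + k := by omega
  have h3 : (8 * a + (k : ℕ)) % 8 = k := by omega
  have h4 : (8 * a + (k : ℕ)) / 8 = a := by omega
  simp only [Env.mem, h1, if_false, h2, h3, h4]

theorem address_eval {e : Env} {s : AState} {k : Fin 8} {a : Expr} :
    (AExpr.address k a).eval (e.raw s) = e.par 1 + (8 * a.eval (e.raw s) + k) := by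
  have : (e.raw s).reg 2 = e.par 1 := raw_reg_par e s 1
  simp [AExpr.address, Expr.eval, BinOp.eval, this]

theorem compile_eval (e : Env) (s : AState) (a : AExpr) :
    a.compile.eval (e.raw s) = a.eval e s := by
  induction a with
  | const k => rfl
  | par i => exact raw_reg_par e s i
  | var x => exact raw_reg_var e s x
  | inp a ih => rw [AExpr.compile, Expr.eval, ih]; rfl
  | arr k a ih =>
    rw [AExpr.compile, Expr.eval, address_eval, ih]
    exact mem_array e s k _
  | op o a b iha ihb => rw [AExpr.compile, Expr.eval, iha, ihb]; rfl

theorem raw_setVar (e : Env) (s : AState) (x v : ℕ) :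
    (⟨Function.update (e.raw s).reg (2 * x + 1) v, (e.raw s).mem⟩ : State) =
      e.raw (s.setVar x v) := by
  have hreg : Function.update (e.raw s).reg (2 * x + 1) v = (e.raw (s.setVar x v)).reg := by
    funext r
    by_cases hr : r = 2 * x + 1
    · rw [hr, Function.update_self, raw_reg_var, AState.setVar_var_self]
    · rw [Function.update_of_ne hr]
      simp only [Env.raw]
      split
      · rfl
      · rw [AState.setVar_var_of_ne _ _ (by omega)]
  rw [hreg]
  rfl

theorem raw_setArr (e : Env) (s : AState) (k : Fin 8) (i v : ℕ) :
    (⟨(e.raw s).reg, Function.update (e.raw s).mem (e.par 1 + (8 * i + k)) v⟩ : State) =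
      e.raw (s.setArr k i v) := by
  have hmem : Function.update (e.raw s).mem (e.par 1 + (8 * i + k)) v =
      (e.raw (s.setArr k i v)).mem := by
    funext a
    have hk := k.2
    by_cases ha : a = e.par 1 + (8 * i + k)
    · rw [ha, Function.update_self]
      exact ((mem_array e _ k i).trans (by simp [AState.setArr])).symm
    · rw [Function.update_of_ne ha]
      simp only [Env.raw, Env.mem]
      split
      · rfl
      · rename_i hlt
        by_cases hk' : (⟨(a - e.par 1) % 8, Nat.mod_lt _ (by norm_num)⟩ : Fin 8) = k
        · have : (a - e.par 1) % 8 = k := congrArg Fin.val hk'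
          rw [hk', AState.setArr_arr_self, Function.update_of_ne (by omega)]
        · rw [AState.setArr_arr_of_ne _ _ _ hk']
  rw [hmem]
  rfl

/-- A statement is executed by its translation within its cost, on words that exceed a fixed power
of the word bound. -/
theorem runs_compile {e : Env} (he : e.Bounded) {M : ℕ} (p : Stmt) (hwf : p.wf = true)
    {s : AState} (hs : Bounded e s) (hM : e.par 0 ^ progDegree p.compile < M) :
    ∃ T ≤ p.cost e, Runs M p.compile (e.raw s) T (e.raw (p.exec e s)) := by
  have hfits : ∀ (s : AState), Bounded e s → ∀ (d : ℕ) (a : Expr), exprDegree a ≤ d →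
      e.par 0 ^ d < M → a.Fits M (e.raw s) := fun s hs d a had hd =>
    fits_of_degree he.two_le (rawBounded_raw he hs) a had hd
  have hpow : ∀ {d d' : ℕ}, d ≤ d' → e.par 0 ^ d' < M → e.par 0 ^ d < M := fun h h' =>
    (Nat.pow_le_pow_right (by have := he.two_le; omega) h).trans_lt h'
  have hmod : ∀ (s : AState) (a : AExpr),
      (Expr.op .mod a.compile (.reg 0)).eval (e.raw s) = a.eval e s % e.par 0 := by
    intro s a
    rw [Expr.eval, compile_eval]
    rfl
  induction p generalizing s with
  | skip => exact ⟨1, le_rfl, .skip _⟩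
  | assign x a =>
    refine ⟨a.compile.cost + 1 + 1 + 1, ?_, ?_⟩
    · simp only [Stmt.cost]; omega
    · have := Runs.assign (M := M) (e.raw s) (2 * x + 1) (.op .mod a.compile (.reg 0))
        (hfits s hs _ _ le_rfl hM)
      rw [hmod, raw_setVar] at this
      exact this
  | store k i a =>
    refine ⟨(AExpr.address k i.compile).cost + (a.compile.cost + 1 + 1) + 1, ?_, ?_⟩
    · simp only [Stmt.cost, AExpr.address, Expr.cost]; omega
    · have := Runs.store (M := M) (e.raw s) (AExpr.address k i.compile)
        (.op .mod a.compile (.reg 0))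
        (hfits s hs _ _ (Nat.le_add_right _ _) hM) (hfits s hs _ _ (Nat.le_add_left _ _) hM)
      rw [hmod, address_eval, compile_eval, raw_setArr] at this
      exact this
  | seq p q ihp ihq =>
    simp only [Stmt.wf, Bool.and_eq_true] at hwf
    obtain ⟨T, hT, hp⟩ := ihp hwf.1 hs (hpow (Nat.le_add_right _ _) hM)
    obtain ⟨T', hT', hq⟩ := ihq hwf.2 (hs.exec he p) (hpow (Nat.le_add_left _ _) hM)
    exact ⟨T + T', by simp only [Stmt.cost]; omega, hp.seq hq⟩
  | ite a p q ihp ihq =>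
    simp only [Stmt.wf, Bool.and_eq_true] at hwf
    have ha : a.compile.Fits M (e.raw s) :=
      hfits s hs _ _ (by simp only [Stmt.compile, progDegree]; omega) hM
    rw [Stmt.exec]
    split
    · obtain ⟨T, hT, hp⟩ := ihp hwf.1 hs
        (hpow (by simp only [Stmt.compile, progDegree]; omega) hM)
      exact ⟨_, by simp only [Stmt.cost]; omega, .ite_true ha (by rwa [compile_eval]) hp⟩
    · obtain ⟨T, hT, hp⟩ := ihq hwf.2 hs
        (hpow (by simp only [Stmt.compile, progDegree]; omega) hM)
      exact ⟨_, by simp only [Stmt.cost]; omega, .ite_false ha (by rw [compile_eval]; omega) hp⟩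
  | loop x b p ih =>
    simp only [Stmt.wf, Bool.and_eq_true, Bool.not_eq_true', List.contains_eq_mem,
      decide_eq_false_iff_not] at hwf
    have hit : ∀ k ≤ e.par b, Bounded e ((iterate e x p s k).setVar x k) := by
      intro k
      induction k with
      | zero => exact fun _ => hs.setVar x (Nat.zero_le _)
      | succ k ihk => exact fun hk => ((ihk (by omega)).exec he p).setVar x (hk.trans (he.par_le b))
    have hcond : ∀ j ≤ e.par b, (Expr.op .lt (.reg (2 * x + 1)) (.reg (2 * b))).Fits M
        (e.raw ((iterate e x p s j).setVar x j)) := fun j hj =>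
      hfits _ (hit j hj) _ _ (by simp only [Stmt.compile, progDegree]; omega) hM
    have hcev : ∀ j, (Expr.op .lt (.reg (2 * x + 1)) (.reg (2 * b))).eval
        (e.raw ((iterate e x p s j).setVar x j)) = if j < e.par b then 1 else 0 := by
      intro j
      simp [Expr.eval, BinOp.eval]
    have hwhile : ∀ r j, j + r = e.par b → ∃ T ≤ r * (p.cost e + 8) + 4,
        Runs M (.while (.op .lt (.reg (2 * x + 1)) (.reg (2 * b))) (.seq p.compile
          (.assign (2 * x + 1) (.op .add (.reg (2 * x + 1)) (.const 1)))))
          (e.raw ((iterate e x p s j).setVar x j)) T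
          (e.raw ((iterate e x p s (e.par b)).setVar x (e.par b))) := by
      intro r
      induction r with
      | zero =>
        intro j hj
        obtain rfl : j = e.par b := by omega
        exact ⟨4, by omega, .while_false (hcond _ le_rfl) (by rw [hcev]; simp)⟩
      | succ r ihr =>
        intro j hj
        obtain ⟨T, hT, hp⟩ := ih hwf.2 (hit j (by omega))
          (hpow (by simp only [Stmt.compile, progDegree]; omega) hM)
        obtain ⟨T', hT', hw⟩ := ihr (j + 1) (by omega)
        have hbd := (hit j (by omega)).exec he p
        -- Well-formedness enters here: the body leaves the loop variable alone, so the increment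
        -- really produces `j + 1`.
        have hx : (p.exec e ((iterate e x p s j).setVar x j)).var x = j := by
          rw [(sameExcept_exec e p _).1 x hwf.1, AState.setVar_var_self]
        have hinc := Runs.assign (M := M) (e.raw (p.exec e ((iterate e x p s j).setVar x j)))
          (2 * x + 1) (.op .add (.reg (2 * x + 1)) (.const 1))
          (hfits _ hbd _ _ (by simp only [Stmt.compile, progDegree]; omega) hM)
        rw [raw_setVar] at hinc
        simp only [Expr.eval, BinOp.eval, raw_reg_var, hx, Expr.cost] at hinc
        refine ⟨_, ?_, .while_true (hcond j (by omega)) (by rw [hcev, if_pos (by omega)]; simp)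
          (hp.seq hinc) hw⟩
        simp only [Expr.cost]
        rw [Nat.succ_mul]
        omega
    obtain ⟨T, hT, hw⟩ := hwhile (e.par b) 0 (by omega)
    have hinit := Runs.assign (M := M) (e.raw s) (2 * x + 1) (.const 0)
      (hfits s hs _ _ (by simp only [Stmt.compile, progDegree]; omega) hM)
    rw [raw_setVar] at hinit
    refine ⟨(1 + 1) + T, ?_, ?_⟩
    · simp only [Stmt.cost]; omega
    · rw [exec_loop]
      exact hinit.seq hw

end ArrayLang

namespace ArrayLang

open WordRAM SimpleGraph

/-! ### Tries -/

/-- The node reached after reading `j` symbols of `f`, starting at the root `0`. The child of the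
node `c` for the symbol `b < 4` is `T (4 * c + b)`. -/
def trieWalk (T f : ℕ → ℕ) : ℕ → ℕ
  | 0 => 0
  | j + 1 => T (4 * trieWalk T f j + f j)

/-- The first `j` symbols of `f` can be read. -/
def TrieHas (T f : ℕ → ℕ) (j : ℕ) : Prop := ∀ i < j, T (4 * trieWalk T f i + f i) ≠ 0

open Classical in
/-- The value stored for the word formed by the first `n` symbols of `f`. -/
noncomputable def trieLookup (T F : ℕ → ℕ) (n : ℕ) (f : ℕ → ℕ) : ℕ :=
  if TrieHas T f n then F (trieWalk T f n) else 0

/-- The nodes of the trie are the numbers up to `c`. -/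
structure TrieOK (T F : ℕ → ℕ) (c : ℕ) : Prop where
  le : ∀ a, T a ≤ c
  inj : ∀ a a', T a = T a' → T a ≠ 0 → a = a'
  empty : ∀ a, 4 * (c + 1) ≤ a → T a = 0
  zero : ∀ d, c < d → F d = 0

theorem trieWalk_congr {T f g : ℕ → ℕ} {j : ℕ} (h : ∀ i < j, f i = g i) :
    trieWalk T f j = trieWalk T g j := by
  induction j with
  | zero => rfl
  | succ j ih => rw [trieWalk, trieWalk, ih fun i hi => h i (by omega), h j (by omega)]

theorem TrieHas.congr {T f g : ℕ → ℕ} {j : ℕ} (h : ∀ i < j, f i = g i) (hf : TrieHas T f j) :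
    TrieHas T g j := fun i hi => by
  rw [← trieWalk_congr fun k hk => h k (by omega), ← h i hi]
  exact hf i hi

theorem trieLookup_congr {T F f g : ℕ → ℕ} {n : ℕ} (h : ∀ i < n, f i = g i) :
    trieLookup T F n f = trieLookup T F n g := by
  unfold trieLookup
  rw [trieWalk_congr h]
  congr 1
  exact propext ⟨fun hf => hf.congr h, fun hg => hg.congr fun i hi => (h i hi).symm⟩

theorem trieWalk_extend {T T' f : ℕ → ℕ} (hT : ∀ a, T a ≠ 0 → T' a = T a) {j : ℕ}
    (h : TrieHas T f j) : trieWalk T' f j = trieWalk T f j := by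
  induction j with
  | zero => rfl
  | succ j ih =>
    rw [trieWalk, trieWalk, ih fun i hi => h i (by omega), hT _ (h j (by omega))]

theorem TrieHas.extend {T T' f : ℕ → ℕ} (hT : ∀ a, T a ≠ 0 → T' a = T a) {j : ℕ}
    (h : TrieHas T f j) : TrieHas T' f j := fun i hi => by
  rw [trieWalk_extend hT fun k hk => h k (by omega), hT _ (h i hi)]
  exact h i hi

theorem TrieHas.mono {T f : ℕ → ℕ} {i j : ℕ} (h : TrieHas T f j) (hij : i ≤ j) : TrieHas T f i :=
  fun k hk => h k (by omega)

theorem TrieOK.insert {T F : ℕ → ℕ} {c a : ℕ} (h : TrieOK T F c)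
    (hac : a < 4 * (c + 1)) : TrieOK (Function.update T a (c + 1)) F (c + 1) where
  le b := by
    rw [Function.update_apply]
    have := h.le b
    split <;> omega
  inj b b' := by
    simp only [Function.update_apply]
    have h1 := h.le b
    have h2 := h.le b'
    split <;> split
    · intro _ _; omega
    · intro _ _; omega
    · intro _ _; omega
    · exact h.inj b b'
  empty b hb := by
    rw [Function.update_of_ne (by omega)]
    exact h.empty b (by omega)
  zero d hd := h.zero d (by omega)

/-- The new node has no children and stores `0`. A word that becomes readable must end with the new
edge, so its value is `0` before and after. -/
theorem TrieOK.lookup_insert {T F : ℕ → ℕ} {c a : ℕ} (h : TrieOK T F c) (ha : T a = 0)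
    (hac : a < 4 * (c + 1)) (n : ℕ) (f : ℕ → ℕ) :
    trieLookup (Function.update T a (c + 1)) F n f = trieLookup T F n f := by
  classical
  set T' := Function.update T a (c + 1) with hT'
  have hext : ∀ b, T b ≠ 0 → T' b = T b := fun b hb =>
    Function.update_of_ne (fun e => hb (by rw [e, ha])) _ _
  by_cases hf : TrieHas T f n
  · rw [trieLookup, trieLookup, if_pos hf, if_pos (hf.extend hext), trieWalk_extend hext hf]
  · rw [trieLookup, trieLookup, if_neg hf]
    split
    · rename_i hf'
      have hex : ∃ i, i < n ∧ T (4 * trieWalk T f i + f i) = 0 := by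
        unfold TrieHas at hf; push Not at hf; exact hf
      obtain ⟨i, hi, hi0, hhas⟩ : ∃ i < n, T (4 * trieWalk T f i + f i) = 0 ∧ TrieHas T f i :=
        ⟨Nat.find hex, (Nat.find_spec hex).1, (Nat.find_spec hex).2, fun k hk h0 =>
          Nat.find_min hex hk ⟨hk.trans (Nat.find_spec hex).1, h0⟩⟩
      have hw : trieWalk T' f i = trieWalk T f i := trieWalk_extend hext hhas
      have hia : 4 * trieWalk T f i + f i = a := by
        by_contra hne
        have := hf' i hi
        rw [hw, hT', Function.update_of_ne hne] at this
        exact this hi0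
      have hw' : trieWalk T' f (i + 1) = c + 1 := by
        rw [trieWalk, hw, hia, hT', Function.update_self]
      rcases Nat.lt_or_ge (i + 1) n with hlt | hge
      · exfalso
        have := hf' (i + 1) hlt
        rw [hw', hT', Function.update_apply] at this
        split at this
        · omega
        · exact this (h.empty _ (by omega))
      · obtain rfl : n = i + 1 := by omega
        rw [hw']
        exact h.zero _ (by omega)
    · rfl

/-- Different edges lead to different nodes. A node therefore determines the edge into it, and as
symbols are below `4`, this edge determines both the previous node and the last symbol. -/
theorem TrieOK.eq_of_walk_eq {T F f g : ℕ → ℕ} {c n : ℕ} (h : TrieOK T F c) (hf : TrieHas T f n)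
    (hg : TrieHas T g n) (hf4 : ∀ i < n, f i < 4) (hg4 : ∀ i < n, g i < 4)
    (hw : trieWalk T f n = trieWalk T g n) : ∀ i < n, f i = g i := by
  induction n with
  | zero => intro i hi; omega
  | succ n ih =>
    have := h.inj _ _ hw (hf n (by omega))
    have h1 := hf4 n (by omega)
    have h2 := hg4 n (by omega)
    intro i hi
    rcases Nat.lt_succ_iff_lt_or_eq.1 hi with hi | rfl
    · exact ih (hf.mono (by omega)) (hg.mono (by omega)) (fun i hi => hf4 i (by omega))
        (fun i hi => hg4 i (by omega)) (by omega) i hi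
    · omega

theorem TrieOK.lookup_update {T F f g : ℕ → ℕ} {c n v : ℕ} (h : TrieOK T F c)
    (hf : TrieHas T f n) (hf4 : ∀ i < n, f i < 4) (hg4 : ∀ i < n, g i < 4)
    [Decidable (∀ i < n, g i = f i)] :
    trieLookup T (Function.update F (trieWalk T f n) v) n g =
      if ∀ i < n, g i = f i then v else trieLookup T F n g := by
  split
  · rename_i hgf
    rw [trieLookup_congr hgf, trieLookup, if_pos hf, Function.update_self]
  · rename_i hgf
    unfold trieLookup
    split
    · rename_i hg
      rw [Function.update_of_ne]
      exact fun e => hgf (h.eq_of_walk_eq hg hf hg4 hf4 e)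
    · rfl

theorem TrieOK.update {T F : ℕ → ℕ} {c d v : ℕ} (h : TrieOK T F c) (hd : d ≤ c) :
    TrieOK T (Function.update F d v) c :=
  ⟨h.le, h.inj, h.empty, fun b hb => by
    rw [Function.update_of_ne (by omega)]; exact h.zero b hb⟩

/-! ### Indicators -/

open Classical in
/-- The number `1` if `p` holds and `0` otherwise. -/
noncomputable def ind (p : Prop) : ℕ := if p then 1 else 0

theorem ite_eq_ind (p : Prop) [Decidable p] : (if p then 1 else 0 : ℕ) = ind p := by
  by_cases h : p <;> simp [ind, h]

theorem ind_mul_ind (p q : Prop) : ind p * ind q = ind (p ∧ q) := by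
  by_cases h : p <;> by_cases h' : q <;> simp [ind, h, h']

theorem one_sub_ind (p : Prop) : 1 - ind p = ind ¬ p := by
  by_cases h : p <;> simp [ind, h]

theorem ind_add_ind {p q : Prop} (hpq : ¬ (p ∧ q)) : ind p + ind q = ind (p ∨ q) := by
  by_cases h : p <;> by_cases h' : q <;> simp_all [ind]

theorem ind_ne_zero {p : Prop} : ind p ≠ 0 ↔ p := by
  by_cases h : p <;> simp [ind, h]

theorem ind_le_one (p : Prop) : ind p ≤ 1 := by
  by_cases h : p <;> simp [ind, h]

theorem ind_congr {p q : Prop} (h : p ↔ q) : ind p = ind q := by rw [propext h]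

theorem ind_true {p : Prop} (h : p) : ind p = 1 := by simp [ind, h]

theorem ind_false {p : Prop} (h : ¬ p) : ind p = 0 := by simp [ind, h]

theorem ind_mod {K : ℕ} (hK : 2 ≤ K) (p : Prop) : ind p % K = ind p :=
  Nat.mod_eq_of_lt (by have := ind_le_one p; omega)

/-- The array `a` is the characteristic vector of `P`. -/
def IsChar {n : ℕ} (a : ℕ → ℕ) (P : Fin n → Prop) : Prop := ∀ u : Fin n, a u = ind (P u)

/-- The array `a` is the matrix of the relation `P`. -/
def IsMat {n : ℕ} (a : ℕ → ℕ) (P : Fin n → Fin n → Prop) : Prop :=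
  ∀ u x : Fin n, a (u * n + x) = ind (P u x)

theorem pair_inj {n u x u' x' : ℕ} (hx : x < n) (hx' : x' < n) (h : u * n + x = u' * n + x') :
    u = u' ∧ x = x' := by
  have h1 : (u * n + x) / n = u := by
    rw [Nat.add_comm, Nat.add_mul_div_right _ _ (by omega), Nat.div_eq_of_lt hx, Nat.zero_add]
  have h2 : (u' * n + x') / n = u' := by
    rw [Nat.add_comm, Nat.add_mul_div_right _ _ (by omega), Nat.div_eq_of_lt hx', Nat.zero_add]
  have : u = u' := by rw [← h1, ← h2, h]
  subst this
  omega

theorem update_pair {n : ℕ} (a : ℕ → ℕ) (u x u' x' : Fin n) (v : ℕ) :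
    Function.update a (u' * n + x' : ℕ) v (u * n + x) =
      if u = u' ∧ x = x' then v else a (u * n + x) := by
  rw [Function.update_apply]
  congr 1
  refine propext ⟨fun h => ?_, fun h => by rw [h.1, h.2]⟩
  have := pair_inj x.2 x'.2 h
  exact ⟨Fin.ext this.1, Fin.ext this.2⟩

end ArrayLang

namespace ArrayLang

open WordRAM SimpleGraph

/-! ### The program

Parameters: `2` number `n` of vertices, `3` number of cliques, `4` number of codes, `5` number of
rounds, `6` the number `n + 1`, `7` the number `t + 1`.
Variables: `0` round, `1` clique, `2` selected vertex, `3` code, `4`, `5`, `6` indices, `7` remaining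
code, `8` value, `9` trie node, `10` number of trie nodes.
Arrays: `0` connection matrix, `1` gate, `2` representatives, `3` block, `4` digits of the code, `5`
word to be looked up, `6` trie, `7` values stored in the trie. -/

namespace Stmt

open AExpr

/-- Membership of the vertex in the variable `x` in the current clique. -/
def inClique (x : ℕ) : AExpr := inp (5 + par 2 * par 2 + var 1 * par 2 + var x)

/-- The connection matrix entry for the vertices in two variables. -/
def connected (x y : ℕ) : AExpr := arr 0 (var x * par 2 + var y)

/-- Set a row of the matrix to the closed neighbourhood. -/
def initRow : Stmt :=
  loop 5 2 (store 0 (var 4 * par 2 + var 5)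
    (inp (5 + var 4 * par 2 + var 5) + eq (var 4) (var 5)))

/-- Set the matrix to the reflexive closure of adjacency. -/
def initMatrix : Stmt := loop 4 2 initRow

/-- Close a row of the matrix under composition at a vertex. -/
def closeRow : Stmt :=
  loop 5 2 (ite (connected 4 6 * connected 6 5) (store 0 (var 4 * par 2 + var 5) 1) skip)

/-- Close the matrix under composition at a vertex. -/
def closeAt : Stmt := loop 4 2 closeRow

/-- Close the matrix under composition at the vertices outside the clique. -/
def closeMatrix : Stmt := loop 6 2 (ite (inClique 6) skip closeAt)

/-- Discard a vertex if its component outside the clique has a smaller vertex. -/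
def checkRep : Stmt :=
  loop 5 2
    (ite (lt (var 5) (var 4) * (1 - inClique 5) * connected 5 4) (store 2 (var 4) 0) skip)

/-- Compute the representatives of the components outside the clique. -/
def computeReps : Stmt :=
  loop 4 2 (seq (store 2 (var 4) (1 - inClique 4)) checkRep)

/-- Compute the gate of the selected block. -/
def computeGate : Stmt :=
  loop 4 2 (store 1 (var 4) (lt (var 2) (par 2) * inClique 4 * connected 2 4))

/-- Add a vertex to the block if it is connected to a vertex of the clique outside the gate. -/
def checkBlock : Stmt :=
  loop 5 2 (ite ((1 - inClique 4) * inClique 5 * (1 - arr 1 (var 5)) * connected 4 5)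
    (store 3 (var 4) 1) skip)

/-- Compute the selected block. -/
def computeBlock : Stmt :=
  loop 4 2 (seq
    (store 3 (var 4) (eq (var 2) (par 2) + lt (var 2) (par 2) * inClique 4 * (1 - arr 1 (var 4))))
    checkBlock)

/-- Clear the set of digits. -/
def clearDigits : Stmt := loop 5 6 (store 4 (var 5) 0)

/-- Mark the digits of a number. -/
def markDigits : Stmt :=
  loop 5 7 (seq (store 4 (var 7 % par 6) 1) (assign 7 (var 7 / par 6)))

/-- Compute the set of the digits of the code. -/
def decode : Stmt := seq clearDigits (seq (assign 7 (var 3)) markDigits)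

/-- Add the number of the chosen vertices of the clique that belong to the block. -/
def countLoop : Stmt :=
  loop 5 2 (assign 8 (var 8 + inClique 5 * arr 4 (var 5 + 1) * arr 3 (var 5)))

/-- Count the chosen vertices of the clique that belong to the block. -/
def countChosen : Stmt := seq (assign 8 0) countLoop

/-- Follow a word in the trie and create missing nodes. -/
def followWord : Stmt :=
  loop 6 2 (seq
    (ite (arr 6 (4 * var 9 + arr 5 (var 6))) skip
      (seq (assign 10 (var 10 + 1)) (store 6 (4 * var 9 + arr 5 (var 6)) (var 10))))
    (assign 9 (arr 6 (4 * var 9 + arr 5 (var 6)))))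

/-- Find or create the node of a word in the trie. -/
def findNode : Stmt := seq (assign 9 0) followWord

/-- Write the word of a component. -/
def componentWord : Stmt :=
  loop 5 2 (store 5 (var 5)
    (connected 4 5 * ((1 - inClique 5) + 2 * (inClique 5 * arr 4 (var 5 + 1)))))

/-- Add the values of the components in the block. -/
def addComponents : Stmt :=
  loop 4 2 (ite (arr 2 (var 4) * arr 3 (var 4))
    (seq componentWord (seq findNode (assign 8 (var 8 + arr 7 (var 9))))) skip)

/-- Write the word of the block. -/
def blockWord : Stmt :=
  loop 5 2 (store 5 (var 5) (arr 3 (var 5) + 2 * (arr 1 (var 5) * arr 4 (var 5 + 1))))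

/-- Enter the value into the table. -/
def recordValue : Stmt :=
  seq blockWord
    (seq findNode (ite (lt (arr 7 (var 9)) (var 8)) (store 7 (var 9) (var 8)) skip))

/-- Treat one code. -/
def codeStep : Stmt := seq decode (seq countChosen (seq addComponents recordValue))

/-- Treat all codes. -/
def codeLoop : Stmt := loop 3 4 codeStep

/-- Treat one selected vertex. -/
def vertexStep : Stmt := seq computeGate (seq computeBlock codeLoop)

/-- Treat all selected vertices. -/
def vertexLoop : Stmt := loop 2 6 vertexStep

/-- Treat one clique. -/
def cliqueStep : Stmt :=
  seq initMatrix (seq closeMatrix (seq computeReps vertexLoop))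

/-- Treat all cliques. -/
def cliqueLoop : Stmt := loop 1 3 cliqueStep

/-- All rounds of the dynamic program. -/
def rounds : Stmt := loop 0 5 cliqueLoop

/-- Write the word of the whole graph. -/
def rootWord : Stmt := loop 5 2 (store 5 (var 5) 1)

/-- The dynamic program, followed by the search for the node of the whole graph. -/
def mainProgram : Stmt := seq rounds (seq rootWord findNode)

end Stmt

variable {n : ℕ}

/-- The environment `e` describes the graph `G` with the list `cliques`. -/
structure Env.Describes (e : Env) (G : SimpleGraph (Fin n)) (cliques : List (Finset (Fin n)))
    (t : ℕ) : Prop where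
  two_le : 2 ≤ e.par 0
  par_two : e.par 2 = n
  par_three : e.par 3 = cliques.length
  par_four : e.par 4 = (n + 1) ^ (t + 1)
  par_six : e.par 6 = n + 1
  par_seven : e.par 7 = t + 1
  adj : ∀ (s : AState) (u x : Fin n), e.mem s (5 + u * n + x) = ind (G.Adj u x)
  clique : ∀ (s : AState) (i : ℕ) (hi : i < cliques.length) (x : Fin n),
    e.mem s (5 + n * n + i * n + x) = ind (x ∈ cliques[i])

/-! ### Correctness of the program: connections, representatives, gates and blocks -/

section Specs

variable {e : Env} {G : SimpleGraph (Fin n)} {cliques : List (Finset (Fin n))} {t : ℕ}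

theorem Env.Describes.inClique (h : e.Describes G cliques t) {s : AState} {x i : ℕ} (hi : s.var 1 = i)
    (hi' : i < cliques.length) {u : Fin n} (hu : s.var x = u) :
    (Stmt.inClique x).eval e s = ind (u ∈ cliques[i]) := by
  have := h.clique s i hi' u
  simpa [Stmt.inClique, h.par_two, hi, hu] using this

theorem eval_connected (h : e.Describes G cliques t) {s : AState} {x y : ℕ} {P : Fin n → Fin n → Prop}
    (hP : IsMat (s.arr 0) P) {u v : Fin n} (hu : s.var x = u) (hv : s.var y = v) :
    (Stmt.connected x y).eval e s = ind (P u v) := by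
  have := hP u v
  simpa [Stmt.connected, h.par_two, hu, hv] using this

theorem initMatrix_spec (h : e.Describes G cliques t) (s : AState) :
    IsMat ((Stmt.initMatrix.exec e s).arr 0) fun u x => G.Adj u x ∨ u = x := by
  obtain ⟨s', hs', hI, -⟩ := loop_rule (e := e) (s := s) (q := .initMatrix) rfl
    (fun j s' => ∀ u x : Fin n, (u : ℕ) < j → s'.arr 0 (u * n + x) = ind (G.Adj u x ∨ u = x))
    (by simp) (by
      intro j hj s₁ _ hI
      rw [h.par_two] at hj
      lift j to Fin n using hj
      obtain ⟨s₂, hs₂, hJ, -⟩ := loop_rule (e := e) (s := s₁.setVar 4 j) (q := .initRow) rfl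
        (fun k s' => ∀ u x : Fin n, ((u : ℕ) < j ∨ (u = j ∧ (x : ℕ) < k)) →
          s'.arr 0 (u * n + x) = ind (G.Adj u x ∨ u = x))
        (by simpa using hI) (by
          intro k hk s₂ hsame hJ u x hux
          rw [h.par_two] at hk
          lift k to Fin n using hk
          have h4 : s₂.var 4 = j := by rw [hsame.1 4 (by decide)]; simp
          simp only [exec_store, AState.setArr_arr, AExpr.eval_add, AExpr.eval_mul, AExpr.eval_var,
            AExpr.eval_par, AExpr.eval_inp, AExpr.eval_eq, AExpr.eval_five, AState.setVar_var, h4,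
            h.par_two, AState.setVar_arr, if_true, Nat.reduceEqDiff, if_false]
          rw [update_pair]
          split
          · rename_i heq
            rw [heq.1, heq.2, h.adj, ite_eq_ind, ind_add_ind, ind_mod h.two_le]
            · exact ind_congr (by rw [Fin.ext_iff])
            · rintro ⟨h1, h2⟩
              exact h1.ne (Fin.ext h2)
          · rename_i hne
            refine hJ u x ?_
            rcases hux with h1 | ⟨h1, h2⟩
            · exact .inl h1
            · refine .inr ⟨h1, ?_⟩
              have : (x : ℕ) ≠ k := fun e => hne ⟨h1, Fin.ext e⟩
              omega)
      rw [hs₂]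
      intro u x hu
      refine hJ u x ?_
      rw [h.par_two]
      rcases Nat.lt_succ_iff_lt_or_eq.1 hu with h1 | h1
      · exact .inl h1
      · exact .inr ⟨Fin.ext h1, x.2⟩)
  intro u x
  rw [hs']
  exact hI u x (by rw [h.par_two]; exact u.2)

end Specs

end ArrayLang

namespace ArrayLang

open WordRAM SimpleGraph

section Specs

variable {n : ℕ} {e : Env} {G : SimpleGraph (Fin n)} {cliques : List (Finset (Fin n))} {t : ℕ}

/-- The matrix is overwritten while it is being read, so the result is only enclosed: from below by
`P` with its compositions at `k` in this row, from above by every relation that contains `P` and is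
closed under composition at `k`. -/
theorem closeRow_spec (h : e.Describes G cliques t) {s : AState} {P : Fin n → Fin n → Prop}
    (hP : IsMat (s.arr 0) P) {k u : Fin n} (hk : s.var 6 = k) (hu : s.var 4 = u) :
    ∃ P', IsMat ((Stmt.closeRow.exec e s).arr 0) P' ∧
      (∀ a b, P a b → P' a b) ∧ (∀ b, P u k → P k b → P' u b) ∧
      ∀ Q : Fin n → Fin n → Prop, (∀ a b, P a b → Q a b) → (∀ a b, Q a k → Q k b → Q a b) →
        ∀ a b, P' a b → Q a b := by
  obtain ⟨s', hs', ⟨P', h1, h2, h3, h4⟩, -⟩ := loop_rule (e := e) (s := s) (q := .closeRow) rfl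
    (fun j s' => ∃ P', IsMat (s'.arr 0) P' ∧ (∀ a b, P a b → P' a b) ∧
      (∀ b : Fin n, (b : ℕ) < j → P u k → P k b → P' u b) ∧
      ∀ Q : Fin n → Fin n → Prop, (∀ a b, P a b → Q a b) → (∀ a b, Q a k → Q k b → Q a b) →
        ∀ a b, P' a b → Q a b)
    ⟨P, hP, fun _ _ h => h, by simp, fun Q h _ => h⟩ (by
      rintro j hj s₁ hsame ⟨P', h1, h2, h3, h4⟩
      rw [h.par_two] at hj
      lift j to Fin n using hj
      have e4 : (s₁.setVar 5 j).var 4 = u := by simp [hsame.1 4 (by decide), hu]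
      have e6 : (s₁.setVar 5 j).var 6 = k := by simp [hsame.1 6 (by decide), hk]
      have e5 : (s₁.setVar 5 j).var 5 = j := by simp
      have hc1 := eval_connected h (s := s₁.setVar 5 j) h1 e4 e6
      have hc2 := eval_connected h (s := s₁.setVar 5 j) h1 e6 e5
      refine ⟨fun a b => P' a b ∨ (a = u ∧ b = j ∧ P' u k ∧ P' k j), ?_, ?_, ?_, ?_⟩
      · rw [exec_ite, AExpr.eval_mul, hc1, hc2, ind_mul_ind]
        by_cases hj' : P' u k ∧ P' k j
        · rw [if_pos (ind_ne_zero.2 hj')]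
          intro a b
          simp only [exec_store, AState.setArr_arr, if_true, AExpr.eval_add, AExpr.eval_mul,
            AExpr.eval_var, AExpr.eval_par, AExpr.eval_one, e4, e5, h.par_two, AState.setVar_arr]
          rw [update_pair]
          split
          · rename_i heq
            rw [Nat.mod_eq_of_lt (by have := h.two_le; omega), ind_true]
            exact .inr ⟨heq.1, heq.2, hj'⟩
          · rename_i hne
            rw [h1 a b]
            refine ind_congr ⟨.inl, fun hh => hh.resolve_right fun h => hne ⟨h.1, h.2.1⟩⟩
        · rw [if_neg (fun hh => hj' (ind_ne_zero.1 hh))]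
          intro a b
          rw [exec_skip, AState.setVar_arr, h1 a b]
          exact ind_congr ⟨.inl, fun hh => hh.resolve_right fun h => hj' h.2.2⟩
      · exact fun a b hab => .inl (h2 a b hab)
      · intro b hb hPu hPb
        rcases Nat.lt_succ_iff_lt_or_eq.1 hb with hb | hb
        · exact .inl (h3 b hb hPu hPb)
        · obtain rfl : b = j := Fin.ext hb
          exact .inr ⟨rfl, rfl, h2 _ _ hPu, h2 _ _ hPb⟩
      · rintro Q hPQ hQ a b (hab | ⟨rfl, rfl, hh⟩)
        · exact h4 Q hPQ hQ a b hab
        · exact hQ _ _ (h4 Q hPQ hQ _ _ hh.1) (h4 Q hPQ hQ _ _ hh.2))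
  rw [hs']
  exact ⟨P', h1, h2, fun b => h3 b (by rw [h.par_two]; exact b.2), h4⟩

theorem closeAt_spec (h : e.Describes G cliques t) {s : AState} {P : Fin n → Fin n → Prop}
    (hP : IsMat (s.arr 0) P) {k : Fin n} (hk : s.var 6 = k) :
    ∃ P', IsMat ((Stmt.closeAt.exec e s).arr 0) P' ∧
      (∀ a b, P a b → P' a b) ∧ (∀ a b, P a k → P k b → P' a b) ∧
      ∀ Q : Fin n → Fin n → Prop, (∀ a b, P a b → Q a b) → (∀ a b, Q a k → Q k b → Q a b) →
        ∀ a b, P' a b → Q a b := by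
  obtain ⟨s', hs', ⟨P', h1, h2, h3, h4⟩, -⟩ := loop_rule (e := e) (s := s) (q := .closeAt) rfl
    (fun j s' => ∃ P', IsMat (s'.arr 0) P' ∧ (∀ a b, P a b → P' a b) ∧
      (∀ a b : Fin n, (a : ℕ) < j → P a k → P k b → P' a b) ∧
      ∀ Q : Fin n → Fin n → Prop, (∀ a b, P a b → Q a b) → (∀ a b, Q a k → Q k b → Q a b) →
        ∀ a b, P' a b → Q a b)
    ⟨P, hP, fun _ _ h => h, by simp, fun Q h _ => h⟩ (by
      rintro j hj s₁ hsame ⟨P', h1, h2, h3, h4⟩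
      rw [h.par_two] at hj
      lift j to Fin n using hj
      obtain ⟨P'', g1, g2, g3, g4⟩ := closeRow_spec h (s := s₁.setVar 4 j) h1 (k := k) (u := j)
        (by simp [hsame.1 6 (by decide), hk]) (by simp)
      refine ⟨P'', g1, fun a b hab => g2 a b (h2 a b hab), ?_,
        fun Q hPQ hQ => g4 Q (h4 Q hPQ hQ) hQ⟩
      intro a b ha hPa hPb
      rcases Nat.lt_succ_iff_lt_or_eq.1 ha with ha | ha
      · exact g2 a b (h3 a b ha hPa hPb)
      · obtain rfl : a = j := Fin.ext ha
        exact g3 b (h2 _ _ hPa) (h2 _ _ hPb))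
  rw [hs']
  exact ⟨P', h1, h2, fun a b => h3 a b (by rw [h.par_two]; exact a.2), h4⟩

/-- This is Warshall's algorithm. After the vertices below `j` have been treated, the matrix
contains all connections whose interior consists of such vertices outside the clique, and only
connections with interior outside the clique. `Conn.insert_iff` accounts for one more interior
vertex. -/
theorem closeMatrix_spec (h : e.Describes G cliques t) {s : AState} {i : ℕ} (hi : s.var 1 = i)
    (hi' : i < cliques.length) (hA : IsMat (s.arr 0) fun u x => G.Adj u x ∨ u = x) :
    IsMat ((Stmt.closeMatrix.exec e s).arr 0) (G.Conn {x | x ∉ cliques[i]}) := by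
  set Ω := cliques[i] with hΩ
  obtain ⟨s', hs', ⟨P, h1, h2, h3⟩, -⟩ := loop_rule (e := e) (s := s) (q := .closeMatrix) rfl
    (fun j s' => ∃ P, IsMat (s'.arr 0) P ∧ (∀ a b, P a b → G.Conn {x | x ∉ Ω} a b) ∧
      ∀ a b, G.Conn {x | x ∉ Ω ∧ (x : ℕ) < j} a b → P a b)
    ⟨_, hA, by
      rintro a b (hab | rfl)
      · exact .adj hab
      · exact .refl a, by
      intro a b hab
      cases hab with
      | refl => exact .inr rfl
      | adj h => exact .inl h
      | trans _ hy _ => exact absurd hy.2 (by omega)⟩ (by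
      rintro j hj s₁ hsame ⟨P, h1, h2, h3⟩
      rw [h.par_two] at hj
      lift j to Fin n using hj
      have hin := h.inClique (s := s₁.setVar 6 j) (x := 6) (i := i) (u := j)
        (by simp [hsame.1 1 (by decide), hi]) hi' (by simp)
      rw [exec_ite, hin]
      by_cases hj' : j ∈ Ω
      · rw [if_pos (ind_ne_zero.2 hj')]
        refine ⟨P, h1, h2, fun a b hab => h3 a b (hab.mono le_rfl ?_)⟩
        rintro x ⟨hx, hx'⟩
        have : (x : ℕ) ≠ j := fun e => hx (by rwa [Fin.ext e])
        exact ⟨hx, by omega⟩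
      · rw [if_neg (fun hh => hj' (ind_ne_zero.1 hh))]
        obtain ⟨P', g1, g2, g3, g4⟩ := closeAt_spec h (s := s₁.setVar 6 j) h1 (k := j) (by simp)
        refine ⟨P', g1, g4 _ h2 fun a b ha hb => ha.trans hj' hb, fun a b hab => ?_⟩
        have hset : {x : Fin n | x ∉ Ω ∧ (x : ℕ) < j + 1} =
            insert j {x | x ∉ Ω ∧ (x : ℕ) < j} := by
          ext x
          simp only [Set.mem_ofPred_eq, Set.mem_insert_iff, Nat.lt_succ_iff_lt_or_eq]
          constructor
          · rintro ⟨hx, hx' | hx'⟩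
            · exact .inr ⟨hx, hx'⟩
            · exact .inl (Fin.ext hx')
          · rintro (rfl | hx)
            · exact ⟨hj', .inr rfl⟩
            · exact ⟨hx.1, .inl hx.2⟩
        rw [hset, Conn.insert_iff] at hab
        rcases hab with hab | ⟨ha, hb⟩
        · exact g2 a b (h3 a b hab)
        · exact g3 a b (h3 _ _ ha) (h3 _ _ hb))
  rw [hs']
  intro a b
  rw [AState.setVar_arr, h1 a b]
  refine ind_congr ⟨h2 a b, fun hab => h3 a b (hab.mono le_rfl fun x hx => ⟨hx, ?_⟩)⟩
  rw [h.par_two]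
  exact x.2

/-- Updating a characteristic vector up to the index `j`. -/
theorem update_char {a : ℕ → ℕ} {P : Fin n → Prop} {j : Fin n} {v : ℕ}
    (ha : ∀ u : Fin n, (u : ℕ) < j → a u = ind (P u)) (hv : v = ind (P j)) (u : Fin n)
    (hu : (u : ℕ) < j + 1) : Function.update a j v u = ind (P u) := by
  rw [Function.update_apply]
  split
  · rename_i heq
    rw [hv, Fin.ext heq]
  · exact ha u (by omega)

theorem checkRep_spec (h : e.Describes G cliques t) {s : AState} {i : ℕ} (hi : s.var 1 = i)
    (hi' : i < cliques.length) {P : Fin n → Fin n → Prop} (hP : IsMat (s.arr 0) P) {u : Fin n}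
    (hu : s.var 4 = u) {p : Prop} (hp : s.arr 2 u = ind p) :
    (Stmt.checkRep.exec e s).arr 2 = Function.update (s.arr 2) u
      (ind (p ∧ ∀ x < u, x ∉ cliques[i] → ¬ P x u)) := by
  obtain ⟨s', hs', h1, -⟩ := loop_rule (e := e) (s := s) (q := .checkRep) rfl
    (fun j s' => s'.arr 2 = Function.update (s.arr 2) u
      (ind (p ∧ ∀ x : Fin n, (x : ℕ) < j → x < u → x ∉ cliques[i] → ¬ P x u)))
    (by rw [ind_congr (q := p) (by simp), ← hp, Function.update_eq_self]) (by
      intro j hj s₁ hsame h1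
      rw [h.par_two] at hj
      lift j to Fin n using hj
      have e4 : (s₁.setVar 5 j).var 4 = u := by simp [hsame.1 4 (by decide), hu]
      have e5 : (s₁.setVar 5 j).var 5 = j := by simp
      have hin := h.inClique (s := s₁.setVar 5 j) (x := 5) (i := i) (u := j)
        (by simp [hsame.1 1 (by decide), hi]) hi' e5
      have hc := eval_connected h (s := s₁.setVar 5 j) (P := P)
        (by rw [AState.setVar_arr, hsame.2 0 (by decide)]; exact hP) e5 e4
      rw [exec_ite, AExpr.eval_mul, AExpr.eval_mul, AExpr.eval_sub, AExpr.eval_lt, hin, hc,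
        AExpr.eval_var, AExpr.eval_var, e4, e5, ite_eq_ind, AExpr.eval_one, one_sub_ind,
        ind_mul_ind, ind_mul_ind]
      by_cases hcond : ((j : ℕ) < u ∧ j ∉ cliques[i]) ∧ P j u
      · rw [if_pos (ind_ne_zero.2 hcond), exec_store, AState.setArr_arr, if_pos rfl,
          AExpr.eval_var, e4, AExpr.eval_zero, Nat.zero_mod, AState.setVar_arr, h1,
          Function.update_idem]
        congr 1
        exact (ind_false fun hh => hh.2 j (by omega) hcond.1.1 hcond.1.2 hcond.2).symm
      · rw [if_neg (fun hh => hcond (ind_ne_zero.1 hh)), exec_skip, AState.setVar_arr, h1]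
        congr 1
        refine ind_congr (and_congr_right fun _ => ⟨fun hh x hx hxu hxi hxP => ?_,
          fun hh x hx => hh x (by omega)⟩)
        rcases Nat.lt_succ_iff_lt_or_eq.1 hx with hx | hx
        · exact hh x hx hxu hxi hxP
        · obtain rfl : x = j := Fin.ext hx
          exact hcond ⟨⟨hxu, hxi⟩, hxP⟩)
  rw [hs', AState.setVar_arr, h1]
  congr 1
  refine ind_congr (and_congr_right fun _ => ⟨fun hh x => hh x ?_, fun hh x _ => hh x⟩)
  rw [h.par_two]
  exact x.2

theorem computeReps_spec (h : e.Describes G cliques t) {s : AState} {i : ℕ} (hi : s.var 1 = i)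
    (hi' : i < cliques.length) (hP : IsMat (s.arr 0) (G.Conn {x | x ∉ cliques[i]})) :
    IsChar ((Stmt.computeReps.exec e s).arr 2) (· ∈ G.outerReps cliques[i]) := by
  obtain ⟨s', hs', h1, -⟩ := loop_rule (e := e) (s := s) (q := .computeReps) rfl
    (fun j s' => ∀ u : Fin n, (u : ℕ) < j → s'.arr 2 u = ind (u ∈ G.outerReps cliques[i]))
    (by simp) (by
      intro j hj s₁ hsame h1
      rw [h.par_two] at hj
      lift j to Fin n using hj
      have e4 : (s₁.setVar 4 j).var 4 = j := by simp
      have e1 : (s₁.setVar 4 j).var 1 = i := by simp [hsame.1 1 (by decide), hi]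
      have hin := h.inClique (s := s₁.setVar 4 j) (x := 4) (i := i) (u := j) e1 hi' e4
      rw [exec_seq, exec_store, AExpr.eval_sub, hin, AExpr.eval_one, one_sub_ind,
        ind_mod h.two_le, AExpr.eval_var, e4]
      rw [checkRep_spec h (i := i) (u := j) (p := j ∉ cliques[i]) (by simpa using e1) hi'
        (P := G.Conn {x | x ∉ cliques[i]})
        (by rw [AState.setArr_arr, if_neg (by decide), AState.setVar_arr, hsame.2 0 (by decide)]
            exact hP) (by simp) (by simp)]
      rw [AState.setArr_arr, if_pos rfl, Function.update_idem, AState.setVar_arr]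
      exact update_char h1 (ind_congr mem_outerReps.symm))
  rw [hs']
  exact fun u => h1 u (by rw [h.par_two]; exact u.2)

/-- The vertex with the number `v`, or `none` if `v` is too large. -/
def vertexOf (n v : ℕ) : Option (Fin n) := if h : v < n then some ⟨v, h⟩ else none

theorem computeGate_spec (h : e.Describes G cliques t) {s : AState} {i v : ℕ} (hi : s.var 1 = i)
    (hi' : i < cliques.length) (hv : s.var 2 = v)
    (hP : IsMat (s.arr 0) (G.Conn {x | x ∉ cliques[i]})) :
    IsChar ((Stmt.computeGate.exec e s).arr 1) (· ∈ G.gate cliques[i] (vertexOf n v)) := by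
  obtain ⟨s', hs', h1, -⟩ := loop_rule (e := e) (s := s) (q := .computeGate) rfl
    (fun j s' => ∀ u : Fin n, (u : ℕ) < j →
      s'.arr 1 u = ind (u ∈ G.gate cliques[i] (vertexOf n v)))
    (by simp) (by
      intro j hj s₁ hsame h1
      rw [h.par_two] at hj
      lift j to Fin n using hj
      have e4 : (s₁.setVar 4 j).var 4 = j := by simp
      have e2 : (s₁.setVar 4 j).var 2 = v := by simp [hsame.1 2 (by decide), hv]
      have e1 : (s₁.setVar 4 j).var 1 = i := by simp [hsame.1 1 (by decide), hi]
      have hin := h.inClique (s := s₁.setVar 4 j) (x := 4) (i := i) (u := j) e1 hi' e4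
      rw [exec_store, AState.setArr_arr, if_pos rfl, AExpr.eval_mul, AExpr.eval_mul, AExpr.eval_lt,
        AExpr.eval_var, AExpr.eval_var, AExpr.eval_par, e4, e2, hin, ite_eq_ind, h.par_two,
        AState.setVar_arr]
      refine update_char h1 ?_
      by_cases hvn : v < n
      · have hc := eval_connected h (s := s₁.setVar 4 j) (P := G.Conn {x | x ∉ cliques[i]})
          (u := ⟨v, hvn⟩) (v := j)
          (by rw [AState.setVar_arr, hsame.2 0 (by decide)]; exact hP) e2 e4
        rw [hc, ind_mul_ind, ind_mul_ind, ind_mod h.two_le]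
        refine ind_congr ?_
        simp only [vertexOf, hvn, dif_pos, gate, outerNbrs, Set.mem_ofPred_eq, true_and]
      · rw [ind_false hvn, Nat.zero_mul, Nat.zero_mul, Nat.zero_mod, ind_false]
        simp [vertexOf, hvn, gate])
  rw [hs']
  exact fun u => h1 u (by rw [h.par_two]; exact u.2)

theorem checkBlock_spec (h : e.Describes G cliques t) {s : AState} {i : ℕ} (hi : s.var 1 = i)
    (hi' : i < cliques.length) {P : Fin n → Fin n → Prop} (hP : IsMat (s.arr 0) P)
    {S : Fin n → Prop} (hS : IsChar (s.arr 1) S) {u : Fin n} (hu : s.var 4 = u) {p : Prop}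
    (hp : s.arr 3 u = ind p) :
    (Stmt.checkBlock.exec e s).arr 3 = Function.update (s.arr 3) u
      (ind (p ∨ (u ∉ cliques[i] ∧ ∃ x ∈ cliques[i], ¬ S x ∧ P u x))) := by
  obtain ⟨s', hs', h1, -⟩ := loop_rule (e := e) (s := s) (q := .checkBlock) rfl
    (fun j s' => s'.arr 3 = Function.update (s.arr 3) u
      (ind (p ∨ (u ∉ cliques[i] ∧ ∃ x ∈ cliques[i], (x : ℕ) < j ∧ ¬ S x ∧ P u x))))
    (by rw [ind_congr (q := p) (by simp), ← hp, Function.update_eq_self]) (by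
      intro j hj s₁ hsame h1
      rw [h.par_two] at hj
      lift j to Fin n using hj
      have e4 : (s₁.setVar 5 j).var 4 = u := by simp [hsame.1 4 (by decide), hu]
      have e5 : (s₁.setVar 5 j).var 5 = j := by simp
      have e1 : (s₁.setVar 5 j).var 1 = i := by simp [hsame.1 1 (by decide), hi]
      have hin := h.inClique (s := s₁.setVar 5 j) (x := 5) (i := i) (u := j) e1 hi' e5
      have hin' := h.inClique (s := s₁.setVar 5 j) (x := 4) (i := i) (u := u) e1 hi' e4
      have hc := eval_connected h (s := s₁.setVar 5 j) (P := P)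
        (by rw [AState.setVar_arr, hsame.2 0 (by decide)]; exact hP) e4 e5
      have hSj : (s₁.setVar 5 j).arr 1 j = ind (S j) := by
        rw [AState.setVar_arr, hsame.2 1 (by decide)]; exact hS j
      rw [exec_ite, AExpr.eval_mul, AExpr.eval_mul, AExpr.eval_mul, AExpr.eval_sub, AExpr.eval_sub,
        AExpr.eval_arr, hin, hin', hc, AExpr.eval_var, e5, hSj, AExpr.eval_one, one_sub_ind,
        one_sub_ind, ind_mul_ind, ind_mul_ind, ind_mul_ind]
      by_cases hcond : ((u ∉ cliques[i] ∧ j ∈ cliques[i]) ∧ ¬ S j) ∧ P u j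
      · rw [if_pos (ind_ne_zero.2 hcond), exec_store, AState.setArr_arr, if_pos rfl,
          AExpr.eval_var, e4, AExpr.eval_one, Nat.mod_eq_of_lt (by have := h.two_le; omega),
          AState.setVar_arr, h1, Function.update_idem]
        congr 1
        exact (ind_true (.inr ⟨hcond.1.1.1, j, hcond.1.1.2, by omega, hcond.1.2, hcond.2⟩)).symm
      · rw [if_neg (fun hh => hcond (ind_ne_zero.1 hh)), exec_skip, AState.setVar_arr, h1]
        congr 1
        refine ind_congr (or_congr_right (and_congr_right fun hu' => ⟨?_, ?_⟩))
        · rintro ⟨x, hx, hxj, hh⟩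
          exact ⟨x, hx, by omega, hh⟩
        · rintro ⟨x, hx, hxj, hh⟩
          refine ⟨x, hx, ?_, hh⟩
          rcases Nat.lt_succ_iff_lt_or_eq.1 hxj with hxj | hxj
          · exact hxj
          · obtain rfl : x = j := Fin.ext hxj
            exact absurd ⟨⟨⟨hu', hx⟩, hh.1⟩, hh.2⟩ hcond)
  rw [hs', AState.setVar_arr, h1]
  congr 1
  refine ind_congr (or_congr_right (and_congr_right fun hu' => ⟨?_, ?_⟩))
  · rintro ⟨x, hx, hxj, hh⟩
    exact ⟨x, hx, hh⟩
  · rintro ⟨x, hx, hh⟩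
    exact ⟨x, hx, by rw [h.par_two]; exact x.2, hh⟩

theorem computeBlock_spec (h : e.Describes G cliques t) {s : AState} {i v : ℕ} (hi : s.var 1 = i)
    (hi' : i < cliques.length) (hv : s.var 2 = v) (hvn : v ≤ n)
    (hP : IsMat (s.arr 0) (G.Conn {x | x ∉ cliques[i]}))
    (hS : IsChar (s.arr 1) (· ∈ G.gate cliques[i] (vertexOf n v))) :
    IsChar ((Stmt.computeBlock.exec e s).arr 3) (· ∈ G.block cliques[i] (vertexOf n v)) := by
  obtain ⟨s', hs', h1, -⟩ := loop_rule (e := e) (s := s) (q := .computeBlock) rfl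
    (fun j s' => ∀ u : Fin n, (u : ℕ) < j →
      s'.arr 3 u = ind (u ∈ G.block cliques[i] (vertexOf n v)))
    (by simp) (by
      intro j hj s₁ hsame h1
      rw [h.par_two] at hj
      lift j to Fin n using hj
      have e4 : (s₁.setVar 4 j).var 4 = j := by simp
      have e2 : (s₁.setVar 4 j).var 2 = v := by simp [hsame.1 2 (by decide), hv]
      have e1 : (s₁.setVar 4 j).var 1 = i := by simp [hsame.1 1 (by decide), hi]
      have hin := h.inClique (s := s₁.setVar 4 j) (x := 4) (i := i) (u := j) e1 hi' e4
      have hSj : (s₁.setVar 4 j).arr 1 j = ind (j ∈ G.gate cliques[i] (vertexOf n v)) := by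
        rw [AState.setVar_arr, hsame.2 1 (by decide)]; exact hS j
      rw [exec_seq, exec_store, AExpr.eval_add, AExpr.eval_mul, AExpr.eval_mul, AExpr.eval_lt,
        AExpr.eval_eq, AExpr.eval_sub, AExpr.eval_arr, AExpr.eval_var, AExpr.eval_var,
        AExpr.eval_par, e4, e2, hin, hSj, AExpr.eval_one, one_sub_ind, ite_eq_ind, ite_eq_ind,
        h.par_two, ind_mul_ind, ind_mul_ind, ind_add_ind (fun hh => by omega), ind_mod h.two_le]
      rw [checkBlock_spec h (i := i) (u := j) (by simpa using e1) hi'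
        (P := G.Conn {x | x ∉ cliques[i]}) (S := (· ∈ G.gate cliques[i] (vertexOf n v)))
        (by rw [AState.setArr_arr, if_neg (by decide), AState.setVar_arr, hsame.2 0 (by decide)]
            exact hP)
        (by rw [AState.setArr_arr, if_neg (by decide), AState.setVar_arr, hsame.2 1 (by decide)]
            exact hS) (by simp)
        (by rw [AState.setArr_arr, if_pos rfl, Function.update_self])]
      rw [AState.setArr_arr, if_pos rfl, Function.update_idem, AState.setVar_arr]
      refine update_char h1 (ind_congr ?_)
      by_cases hlt : v < n
      · simp only [vertexOf, hlt, dif_pos, gate, block, innerSide, Set.mem_ofPred_eq, true_and,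
          hlt.ne, false_or]
      · simp [vertexOf, block, (by omega : v = n)])
  rw [hs']
  exact fun u => h1 u (by rw [h.par_two]; exact u.2)

end Specs

end ArrayLang

/-! ### Correctness of the program: codes for small vertex sets -/

namespace ArrayLang

open WordRAM SimpleGraph

section Specs

variable {n : ℕ} {e : Env} {G : SimpleGraph (Fin n)} {cliques : List (Finset (Fin n))} {t : ℕ}

/-- The vertices of `Ω` that are named by the digits of `w` in base `n + 1`. -/
def chosen (t : ℕ) (Ω : Finset (Fin n)) (w : ℕ) : Finset (Fin n) :=
  Ω.filter fun x => ∃ j < t + 1, w / (n + 1) ^ j % (n + 1) = x + 1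

theorem chosen_subset (Ω : Finset (Fin n)) (w : ℕ) : chosen t Ω w ⊆ Ω := Finset.filter_subset _ _

theorem card_chosen_le (Ω : Finset (Fin n)) (w : ℕ) : (chosen t Ω w).card ≤ t + 1 := by
  have hinj : Function.Injective fun x : Fin n => (x : ℕ) + 1 := fun a b h => Fin.ext (by simpa using h)
  rw [← Finset.card_image_of_injective _ hinj]
  have hsub : (chosen t Ω w).image (fun x : Fin n => (x : ℕ) + 1) ⊆
      (Finset.range (t + 1)).image fun j => w / (n + 1) ^ j % (n + 1) := by
    intro d hd
    obtain ⟨x, hx, rfl⟩ := Finset.mem_image.1 hd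
    obtain ⟨j, hj, hjx⟩ := (Finset.mem_filter.1 hx).2
    exact Finset.mem_image.2 ⟨j, Finset.mem_range.2 hj, hjx⟩
  exact (Finset.card_le_card hsub).trans (Finset.card_image_le.trans (by simp))

/-- The digit `x + 1` names the vertex `x` and the digit `0` names nothing, so sets with fewer than
`k` elements have codes too. One element of `W` supplies the lowest digit, the others are coded by
induction. -/
theorem exists_digits (k : ℕ) (W : Finset (Fin n)) (hW : W.card ≤ k) :
    ∃ w < (n + 1) ^ k, ∀ x : Fin n, (∃ j < k, w / (n + 1) ^ j % (n + 1) = x + 1) ↔ x ∈ W := by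
  induction k generalizing W with
  | zero =>
    obtain rfl : W = ∅ := Finset.card_eq_zero.1 (by omega)
    exact ⟨0, by simp, by simp⟩
  | succ k ih =>
    rcases W.eq_empty_or_nonempty with rfl | ⟨x₀, hx₀⟩
    · exact ⟨0, by positivity, by simp⟩
    · obtain ⟨w, hw, hdig⟩ := ih (W.erase x₀) (by rw [Finset.card_erase_of_mem hx₀]; omega)
      have hlt : (x₀ : ℕ) + 1 < n + 1 := by omega
      have hdiv : ((x₀ : ℕ) + 1 + (n + 1) * w) / (n + 1) = w := by
        rw [Nat.add_mul_div_left _ _ (by omega), Nat.div_eq_of_lt hlt, Nat.zero_add]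
      have hmod : ((x₀ : ℕ) + 1 + (n + 1) * w) % (n + 1) = x₀ + 1 := by
        rw [Nat.add_mul_mod_self_left, Nat.mod_eq_of_lt hlt]
      refine ⟨x₀ + 1 + (n + 1) * w, ?_, fun x => ?_⟩
      · calc (x₀ : ℕ) + 1 + (n + 1) * w < (n + 1) * (w + 1) := by rw [Nat.mul_succ]; omega
          _ ≤ (n + 1) * (n + 1) ^ k := Nat.mul_le_mul_left _ hw
          _ = (n + 1) ^ (k + 1) := by ring
      · have hsucc : ∀ j, ((x₀ : ℕ) + 1 + (n + 1) * w) / (n + 1) ^ (j + 1) = w / (n + 1) ^ j := by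
          intro j
          rw [pow_succ', ← Nat.div_div_eq_div_mul, hdiv]
        constructor
        · rintro ⟨j, hj, hx⟩
          cases j with
          | zero =>
            rw [pow_zero, Nat.div_one, hmod] at hx
            obtain rfl : x₀ = x := Fin.ext (by omega)
            exact hx₀
          | succ j =>
            rw [hsucc] at hx
            exact Finset.mem_of_mem_erase ((hdig x).1 ⟨j, by omega, hx⟩)
        · intro hx
          by_cases hxx : x = x₀
          · exact ⟨0, by omega, by rw [pow_zero, Nat.div_one, hmod, hxx]⟩
          · obtain ⟨j, hj, hjx⟩ := (hdig x).2 (Finset.mem_erase.2 ⟨hxx, hx⟩)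
            exact ⟨j + 1, by omega, by rw [hsucc, hjx]⟩

theorem exists_chosen_eq {Ω W : Finset (Fin n)} (hW : W ⊆ Ω) (hcard : W.card ≤ t + 1) :
    ∃ w < (n + 1) ^ (t + 1), chosen t Ω w = W := by
  obtain ⟨w, hw, hdig⟩ := exists_digits (t + 1) W hcard
  refine ⟨w, hw, ?_⟩
  ext x
  rw [chosen, Finset.mem_filter, hdig]
  exact ⟨fun h => h.2, fun h => ⟨hW h, h⟩⟩

theorem decode_spec (h : e.Describes G cliques t) {s : AState} {w : ℕ} (hw : s.var 3 = w)
    (hwK : w < e.par 0) (x : Fin n) :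
    (Stmt.decode.exec e s).arr 4 (x + 1) =
      ind (∃ j < t + 1, w / (n + 1) ^ j % (n + 1) = x + 1) := by
  obtain ⟨s₁, hs₁, h1, hsame₁⟩ := loop_rule (e := e) (s := s) (q := .clearDigits) rfl
    (fun j s' => ∀ d < j, s'.arr 4 d = 0) (by simp) (by
      intro j hj s₁ _ h1 d hd
      rw [exec_store, AState.setArr_arr, if_pos rfl, Function.update_apply]
      split
      · simp
      · rename_i hne
        simp only [AExpr.eval_var, AState.setVar_var, if_true] at hne
        exact h1 d (by omega))
  rw [h.par_six] at h1
  have hdec : Stmt.decode.exec e s =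
      Stmt.markDigits.exec e ((s₁.setVar 5 (e.par 6)).setVar 7 w) := by
    rw [Stmt.decode, exec_seq, exec_seq, hs₁, exec_assign, AExpr.eval_var]
    rw [show (s₁.setVar 5 (e.par 6)).var 3 = w by simp [hsame₁.1 3 (by decide), hw],
      Nat.mod_eq_of_lt hwK]
  obtain ⟨s₂, hs₂, ⟨-, h2⟩, -⟩ := loop_rule (e := e)
    (s := (s₁.setVar 5 (e.par 6)).setVar 7 w) (q := .markDigits) rfl
    (fun j s' => s'.var 7 = w / (n + 1) ^ j ∧
      ∀ d < n + 1, s'.arr 4 d = ind (∃ i < j, w / (n + 1) ^ i % (n + 1) = d))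
    ⟨by simp, fun d hd => by simpa [ind] using h1 d hd⟩ (by
      rintro j hj s₂ hsame ⟨h2, h3⟩
      rw [exec_seq, exec_store, exec_assign]
      refine ⟨?_, fun d hd => ?_⟩
      · simp only [AState.setVar_var, if_true, AExpr.eval_div, AExpr.eval_var, AExpr.eval_par,
          AState.setArr_var, h2, h.par_six, Nat.reduceEqDiff, if_false, Nat.div_div_eq_div_mul,
          ← pow_succ]
        exact Nat.mod_eq_of_lt ((Nat.div_le_self _ _).trans_lt hwK)
      · simp only [AState.setVar_arr, AState.setArr_arr, if_true, AExpr.eval_mod, AExpr.eval_var,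
          AExpr.eval_par, AState.setVar_var, h2, h.par_six, Nat.reduceEqDiff, if_false,
          AExpr.eval_one]
        rw [Function.update_apply]
        split
        · rename_i heq
          rw [Nat.mod_eq_of_lt (by have := h.two_le; omega)]
          exact (ind_true ⟨j, by omega, heq.symm⟩).symm
        · rename_i hne
          rw [h3 d hd]
          refine ind_congr ⟨fun ⟨i, hi, hh⟩ => ⟨i, by omega, hh⟩, fun ⟨i, hi, hh⟩ => ?_⟩
          rcases Nat.lt_succ_iff_lt_or_eq.1 hi with hi | rfl
          · exact ⟨i, hi, hh⟩
          · exact absurd hh.symm hne)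
  rw [hdec, hs₂, AState.setVar_arr, h2 _ (by omega), h.par_seven]

theorem sum_filter_succ (R : Finset (Fin n)) (f : Fin n → ℕ) (j : Fin n) :
    ∑ u ∈ R.filter (fun u : Fin n => (u : ℕ) < j + 1), f u =
      ∑ u ∈ R.filter (fun u : Fin n => (u : ℕ) < j), f u + if j ∈ R then f j else 0 := by
  rw [Finset.sum_filter, Finset.sum_filter]
  have hj : (if j ∈ R then f j else 0) = ∑ u ∈ R, if u = j then f u else 0 := by
    rw [Finset.sum_ite_eq' R j f]
  rw [hj, ← Finset.sum_add_distrib]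
  refine Finset.sum_congr rfl fun u _ => ?_
  by_cases h1 : u = j
  · subst h1; simp
  · have : (u : ℕ) ≠ j := fun e => h1 (Fin.ext e)
    by_cases h2 : (u : ℕ) < j
    · simp [h1, h2, (by omega : (u : ℕ) < j + 1)]
    · rw [if_neg (by omega : ¬ (u : ℕ) < j + 1), if_neg h2, if_neg h1, Nat.add_zero]

theorem sum_filter_all (R : Finset (Fin n)) (f : Fin n → ℕ) :
    ∑ u ∈ R.filter (fun u : Fin n => (u : ℕ) < n), f u = ∑ u ∈ R, f u := by
  rw [Finset.filter_true_of_mem fun u _ => u.2]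

theorem sum_filter_zero (R : Finset (Fin n)) (f : Fin n → ℕ) :
    ∑ u ∈ R.filter (fun u : Fin n => (u : ℕ) < 0), f u = 0 := by
  simp

open Classical in
theorem countChosen_spec (h : e.Describes G cliques t) {s : AState} {i w : ℕ} (hi : s.var 1 = i)
    (hi' : i < cliques.length)
    (hW : ∀ x : Fin n, s.arr 4 (x + 1) = ind (∃ j < t + 1, w / (n + 1) ^ j % (n + 1) = x + 1))
    {C : Set (Fin n)} (hC : IsChar (s.arr 3) (· ∈ C)) (hK : n < e.par 0) :
    (Stmt.countChosen.exec e s).var 8 = ((chosen t cliques[i] w).filter (· ∈ C)).card := by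
  set R := (chosen t cliques[i] w).filter (· ∈ C) with hR
  rw [Stmt.countChosen, exec_seq, exec_assign, AExpr.eval_zero, Nat.zero_mod]
  obtain ⟨s₁, hs₁, h1, -⟩ := loop_rule (e := e) (s := s.setVar 8 0) (q := .countLoop) rfl
    (fun j s' => s'.var 8 = ∑ u ∈ R.filter (fun u : Fin n => (u : ℕ) < j), 1)
    (by rw [sum_filter_zero]; simp) (by
      intro j hj s₁ hsame h1
      rw [h.par_two] at hj
      lift j to Fin n using hj
      have e1 : (s₁.setVar 5 j).var 1 = i := by simp [hsame.1 1 (by decide), hi]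
      have hin := h.inClique (s := s₁.setVar 5 j) (x := 5) (i := i) (u := j) e1 hi' (by simp)
      have h4 := hW j
      rw [← AState.setVar_arr s 8 0, ← hsame.2 4 (by decide)] at h4
      have h3 := hC j
      rw [← AState.setVar_arr s 8 0, ← hsame.2 3 (by decide)] at h3
      rw [exec_assign, AState.setVar_var, if_pos rfl, sum_filter_succ, AExpr.eval_add,
        AExpr.eval_mul, AExpr.eval_mul, hin, AExpr.eval_arr, AExpr.eval_arr, AExpr.eval_add,
        AExpr.eval_one, AExpr.eval_var, AExpr.eval_var, AState.setVar_var, if_neg (by decide),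
        AState.setVar_var, if_pos rfl, AState.setVar_arr, h4, h3, h1, ind_mul_ind, ind_mul_ind,
        ite_eq_ind]
      have hind : ind (((j ∈ cliques[i]) ∧ ∃ k < t + 1, w / (n + 1) ^ k % (n + 1) = (j : ℕ) + 1) ∧
          j ∈ C) = ind (j ∈ R) := ind_congr (by rw [hR, Finset.mem_filter, chosen, Finset.mem_filter])
      rw [hind]
      refine Nat.mod_eq_of_lt (lt_of_le_of_lt ?_ hK)
      rw [← ite_eq_ind, ← sum_filter_succ R (fun _ => 1) j, Finset.sum_const, smul_eq_mul, mul_one]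
      exact (Finset.card_le_univ _).trans (by simp))
  rw [hs₁, AState.setVar_var, if_neg (by decide), h1, h.par_two, sum_filter_all]
  simp

/-! ### The table -/

/-- The word under which the value for the block `C` and the boundary set `W` is stored. -/
noncomputable def word (C W : Set (Fin n)) (x : ℕ) : ℕ :=
  if h : x < n then ind (⟨x, h⟩ ∈ C) + 2 * ind (⟨x, h⟩ ∈ W) else 0

/-- The table that is represented by a state. -/
noncomputable def table (s : AState) (C W : Set (Fin n)) : ℕ :=
  trieLookup (s.arr 6) (s.arr 7) n (word C W)

theorem word_lt (C W : Set (Fin n)) (x : ℕ) : word C W x < 4 := by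
  unfold word
  split
  · rename_i h
    have h1 := ind_le_one (⟨x, h⟩ ∈ C)
    have h2 := ind_le_one (⟨x, h⟩ ∈ W)
    omega
  · omega

theorem word_coe (C W : Set (Fin n)) (x : Fin n) :
    word C W x = ind (x ∈ C) + 2 * ind (x ∈ W) := by
  simp [word]

theorem word_inj {C W C' W' : Set (Fin n)} (h : ∀ x < n, word C W x = word C' W' x) :
    C = C' ∧ W = W' := by
  have key : ∀ x : Fin n, ind (x ∈ C) = ind (x ∈ C') ∧ ind (x ∈ W) = ind (x ∈ W') := by
    intro x
    have hx := h x x.2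
    rw [word_coe, word_coe] at hx
    have h1 := ind_le_one (x ∈ C)
    have h2 := ind_le_one (x ∈ C')
    omega
  have himp : ∀ {p q : Prop}, ind p = ind q → (p ↔ q) := fun {p q} hpq => by
    rw [← ind_ne_zero (p := p), ← ind_ne_zero (p := q), hpq]
  exact ⟨Set.ext fun x => himp (key x).1, Set.ext fun x => himp (key x).2⟩

theorem trieWalk_le {T F f : ℕ → ℕ} {c : ℕ} (h : TrieOK T F c) (j : ℕ) : trieWalk T f j ≤ c := by
  cases j with
  | zero => exact Nat.zero_le _
  | succ j => exact h.le _

/-- Each symbol creates at most one node, and new nodes carry the value `0`, so no lookup changes.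
Node numbers are words as well; hence their count has to stay below the word bound. -/
theorem findNode_spec (h : e.Describes G cliques t) {s : AState}
    (hok : TrieOK (s.arr 6) (s.arr 7) (s.var 10)) (h4 : ∀ i < n, s.arr 5 i < 4)
    (hK : s.var 10 + n < e.par 0) {s' : AState} (hs' : Stmt.findNode.exec e s = s') :
    TrieOK (s'.arr 6) (s'.arr 7) (s'.var 10) ∧ s'.var 10 ≤ s.var 10 + n ∧
      (∀ f, trieLookup (s'.arr 6) (s'.arr 7) n f = trieLookup (s.arr 6) (s.arr 7) n f) ∧
      TrieHas (s'.arr 6) (s.arr 5) n ∧ s'.var 9 = trieWalk (s'.arr 6) (s.arr 5) n := by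
  have hsame' := sameExcept_exec e Stmt.findNode s
  rw [hs'] at hsame'
  rw [hsame'.2 7 (by decide)]
  rw [Stmt.findNode, exec_seq, exec_assign, AExpr.eval_zero, Nat.zero_mod] at hs'
  obtain ⟨s₁, hs₁, ⟨h1, h2, h3, h5, h6⟩, -⟩ := loop_rule (e := e) (s := s.setVar 9 0)
    (q := .followWord) rfl
    (fun j s' => TrieOK (s'.arr 6) (s.arr 7) (s'.var 10) ∧ s'.var 10 ≤ s.var 10 + j ∧
      (∀ f, trieLookup (s'.arr 6) (s.arr 7) n f = trieLookup (s.arr 6) (s.arr 7) n f) ∧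
      TrieHas (s'.arr 6) (s.arr 5) j ∧ s'.var 9 = trieWalk (s'.arr 6) (s.arr 5) j)
    ⟨by simpa using hok, by simp, fun f => rfl, fun i hi => absurd hi (by omega), by
      simp [trieWalk]⟩ (by
      rintro j hj s₁ hsame ⟨h1, h2, h3, h5, h6⟩
      rw [h.par_two] at hj
      have hg : s₁.arr 5 = s.arr 5 := by rw [hsame.2 5 (by decide)]; rfl
      have hg4 := h4 j hj
      have hle := trieWalk_le (f := s.arr 5) h1 j
      set a := 4 * trieWalk (s₁.arr 6) (s.arr 5) j + s.arr 5 j with ha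
      have hea : ∀ s₂ : AState, s₂.var 9 = s₁.var 9 → s₂.var 6 = j → s₂.arr 5 = s₁.arr 5 →
          (4 * AExpr.var 9 + AExpr.arr 5 (.var 6)).eval e s₂ = a := by
        intro s₂ e9 e6 e5
        rw [AExpr.eval_add, AExpr.eval_mul, AExpr.eval_arr, AExpr.eval_var, AExpr.eval_var,
          AExpr.eval_four, e9, e6, e5, hg, h6]
      have hea₁ := hea (s₁.setVar 6 j) (by simp) (by simp) rfl
      rw [exec_seq, exec_ite, AExpr.eval_arr, hea₁, AState.setVar_arr]
      -- The entry `0` marks a missing child; the root `0` is never a child.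
      by_cases h0 : s₁.arr 6 a = 0
      · have hin : (Stmt.seq (.assign 10 (.var 10 + 1))
            (.store 6 (4 * .var 9 + .arr 5 (.var 6)) (.var 10))).exec e (s₁.setVar 6 j) =
            ((s₁.setVar 6 j).setVar 10 (s₁.var 10 + 1)).setArr 6 a (s₁.var 10 + 1) := by
          rw [exec_seq, exec_assign, AExpr.eval_add, AExpr.eval_var,
            AExpr.eval_one, AState.setVar_var, if_neg (by decide),
            Nat.mod_eq_of_lt (by omega), exec_store, AExpr.eval_var,
            hea ((s₁.setVar 6 j).setVar 10 (s₁.var 10 + 1)) (by simp) (by simp) rfl,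
            AState.setVar_var, if_pos rfl, Nat.mod_eq_of_lt (by omega)]
        rw [if_neg (by simpa using h0), hin, exec_assign, AExpr.eval_arr,
          hea _ (by simp) (by simp) (by rw [AState.setArr_arr, if_neg (by decide)]; rfl)]
        have hT : ((((s₁.setVar 6 j).setVar 10 (s₁.var 10 + 1)).setArr 6 a (s₁.var 10 + 1)).arr 6) =
            Function.update (s₁.arr 6) a (s₁.var 10 + 1) := by
          rw [AState.setArr_arr, if_pos rfl]; rfl
        have hac : a < 4 * (s₁.var 10 + 1) := by omega
        have hext : ∀ b, s₁.arr 6 b ≠ 0 →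
            Function.update (s₁.arr 6) a (s₁.var 10 + 1) b = s₁.arr 6 b := fun b hb =>
          Function.update_of_ne (fun e => hb (by rw [e, h0])) _ _
        have hwj := trieWalk_extend hext h5
        have hv10 : (((((s₁.setVar 6 j).setVar 10 (s₁.var 10 + 1)).setArr 6 a
            (s₁.var 10 + 1)).setVar 9 ((Function.update (s₁.arr 6) a (s₁.var 10 + 1) a) %
              e.par 0)).var 10) = s₁.var 10 + 1 := by simp
        rw [hT, hv10, AState.setVar_arr, hT]
        refine ⟨h1.insert hac, by omega, fun f => ?_, fun i hi => ?_, ?_⟩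
        · rw [h1.lookup_insert h0 hac, h3]
        · rcases Nat.lt_succ_iff_lt_or_eq.1 hi with hi | rfl
          · exact (h5.extend hext) i hi
          · rw [hwj, ← ha, Function.update_self]
            omega
        · rw [AState.setVar_var, if_pos rfl, trieWalk, hwj, ← ha, Function.update_self,
            Nat.mod_eq_of_lt (by omega)]
      · rw [if_pos h0, exec_skip, exec_assign, AExpr.eval_arr, hea₁]
        refine ⟨by simpa using h1, ?_, h3, fun i hi => ?_, ?_⟩
        · have : ((s₁.setVar 6 j).setVar 9 ((s₁.setVar 6 j).arr 6 a % e.par 0)).var 10 =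
            s₁.var 10 := by simp
          rw [this]; omega
        · rcases Nat.lt_succ_iff_lt_or_eq.1 hi with hi | rfl
          · exact h5 i hi
          · exact h0
        · rw [AState.setVar_var, if_pos rfl, AState.setVar_arr]
          have := h1.le a
          rw [Nat.mod_eq_of_lt (by omega)]
          rfl)
  rw [h.par_two] at h2 h5 h6
  rw [← hs', hs₁]
  exact ⟨by simpa using h1, by simpa using h2, h3, h5, by simpa using h6⟩

/-- The state of the computation is consistent: the trie has at most `c` nodes besides the root, and
the entries of the table are realized by vertex sets. -/
structure Valid (G : SimpleGraph (Fin n)) (t c : ℕ) (s : AState) : Prop where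
  trie : TrieOK (s.arr 6) (s.arr 7) (s.var 10)
  nodes : s.var 10 ≤ c
  sound : ∀ C W, G.Extends t C W (table s C W)

theorem Valid.congr {c c' : ℕ} {s s' : AState} (h : Valid G t c s) (h6 : s'.arr 6 = s.arr 6)
    (h7 : s'.arr 7 = s.arr 7) (h10 : s'.var 10 = s.var 10) (hc : c ≤ c') : Valid G t c' s' where
  trie := by rw [h6, h7, h10]; exact h.trie
  nodes := by rw [h10]; exact h.nodes.trans hc
  sound C W := by unfold table; rw [h6, h7]; exact h.sound C W

theorem table_congr {s s' : AState} (h6 : s'.arr 6 = s.arr 6) (h7 : s'.arr 7 = s.arr 7) :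
    (table s' : Set (Fin n) → Set (Fin n) → ℕ) = table s := by
  unfold table; rw [h6, h7]

/-- The search for the node of a word leaves the table unchanged. -/
theorem findNode_valid (h : e.Describes G cliques t) {c : ℕ} {s : AState} (hv : Valid G t c s)
    {C W : Set (Fin n)} (hw : ∀ x : Fin n, s.arr 5 x = ind (x ∈ C) + 2 * ind (x ∈ W))
    (hK : c + n < e.par 0) {s' : AState} (hs' : Stmt.findNode.exec e s = s') :
    Valid G t (c + n) s' ∧ (table s' : Set (Fin n) → Set (Fin n) → ℕ) = table s ∧
      TrieHas (s'.arr 6) (word C W) n ∧ s'.var 9 = trieWalk (s'.arr 6) (word C W) n := by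
  have hw' : ∀ i < n, s.arr 5 i = word C W i := fun i hi => by
    have := hw ⟨i, hi⟩
    rw [← word_coe] at this
    exact this
  have hn := hv.nodes
  obtain ⟨h1, h2, h3, h4, h5⟩ := findNode_spec h hv.trie
    (fun i hi => by rw [hw' i hi]; exact word_lt C W i) (by omega) hs'
  have htab : (table s' : Set (Fin n) → Set (Fin n) → ℕ) = table s := by
    funext C W
    exact h3 _
  refine ⟨⟨h1, by omega, fun C W => by rw [htab]; exact hv.sound C W⟩, htab, h4.congr hw', ?_⟩
  rw [h5, trieWalk_congr hw']

end Specs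

end ArrayLang

/-! ### Correctness of the program: the treatment of one code -/

namespace ArrayLang

open WordRAM SimpleGraph

section Specs

variable {n : ℕ} {e : Env} {G : SimpleGraph (Fin n)} {cliques : List (Finset (Fin n))} {t : ℕ}

/-- The arrays hold the data for the clique `i` and the block selected by `v`. -/
structure Ready (G : SimpleGraph (Fin n)) (Ω : Finset (Fin n)) (i v : ℕ) (s : AState) : Prop where
  var_one : s.var 1 = i
  conn : IsMat (s.arr 0) (G.Conn {x | x ∉ Ω})
  gate : IsChar (s.arr 1) (· ∈ G.gate Ω (vertexOf n v))
  reps : IsChar (s.arr 2) (· ∈ G.outerReps Ω)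
  block : IsChar (s.arr 3) (· ∈ G.block Ω (vertexOf n v))

theorem Ready.same {Ω : Finset (Fin n)} {i v : ℕ} {s s' : AState} (h : Ready G Ω i v s)
    {vs : List ℕ} {ks : List (Fin 8)} (hs : SameExcept vs ks s s') (h1 : 1 ∉ vs) (k0 : 0 ∉ ks)
    (k1 : 1 ∉ ks) (k2 : 2 ∉ ks) (k3 : 3 ∉ ks) : Ready G Ω i v s' where
  var_one := by rw [hs.1 1 h1]; exact h.var_one
  conn := by rw [hs.2 0 k0]; exact h.conn
  gate := by rw [hs.2 1 k1]; exact h.gate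
  reps := by rw [hs.2 2 k2]; exact h.reps
  block := by rw [hs.2 3 k3]; exact h.block

/-- The array marks the digits of `w`. -/
def IsDigits (n t w : ℕ) (a : ℕ → ℕ) : Prop :=
  ∀ x : Fin n, a (x + 1) = ind (∃ j < t + 1, w / (n + 1) ^ j % (n + 1) = x + 1)

theorem mem_chosen {Ω : Finset (Fin n)} {w : ℕ} {x : Fin n} :
    x ∈ chosen t Ω w ↔ x ∈ Ω ∧ ∃ j < t + 1, w / (n + 1) ^ j % (n + 1) = x + 1 :=
  Finset.mem_filter

theorem componentWord_spec (h : e.Describes G cliques t) {s : AState} {i v w : ℕ}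
    (hi' : i < cliques.length) (hr : Ready G cliques[i] i v s) (hW : IsDigits n t w (s.arr 4))
    {u : Fin n} (hu : s.var 4 = u) (hK : 2 < e.par 0) (x : Fin n) :
    (Stmt.componentWord.exec e s).arr 5 x = ind (x ∈ G.outerComp cliques[i] u) +
      2 * ind (x ∈ (↑(chosen t cliques[i] w) ∩ G.outerNbrs cliques[i] u : Set (Fin n))) := by
  obtain ⟨s₁, hs₁, h1, -⟩ := loop_rule (e := e) (s := s) (q := .componentWord) rfl
    (fun j s' => ∀ x : Fin n, (x : ℕ) < j → s'.arr 5 x = ind (x ∈ G.outerComp cliques[i] u) +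
      2 * ind (x ∈ (↑(chosen t cliques[i] w) ∩ G.outerNbrs cliques[i] u : Set (Fin n))))
    (by simp) (by
      intro j hj s₁ hsame h1 x hx
      rw [h.par_two] at hj
      lift j to Fin n using hj
      have e1 : (s₁.setVar 5 j).var 1 = i := by simp [hsame.1 1 (by decide), hr.var_one]
      have e4 : (s₁.setVar 5 j).var 4 = u := by simp [hsame.1 4 (by decide), hu]
      have hin := h.inClique (s := s₁.setVar 5 j) (x := 5) (i := i) (u := j) e1 hi' (by simp)
      have hm : IsMat ((s₁.setVar 5 j).arr 0) (G.Conn {x | x ∉ cliques[i]}) := by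
        rw [AState.setVar_arr, hsame.2 0 (by decide)]; exact hr.conn
      have hcon := eval_connected h hm e4 (y := 5) (v := j) (by simp)
      have h4 := hW j
      rw [← hsame.2 4 (by decide)] at h4
      rw [exec_store, AState.setArr_arr, if_pos rfl, AExpr.eval_var, AState.setVar_var, if_pos rfl,
        Function.update_apply]
      split
      · rename_i heq
        obtain rfl : x = j := Fin.ext heq
        rw [AExpr.eval_mul, hcon, AExpr.eval_add, AExpr.eval_sub, AExpr.eval_mul, AExpr.eval_mul,
          hin, AExpr.eval_arr, AExpr.eval_add, AExpr.eval_var, AExpr.eval_one, AExpr.eval_two,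
          AState.setVar_var, if_pos rfl, AState.setVar_arr, h4, one_sub_ind, ind_mul_ind, mul_add,
          mul_left_comm, ind_mul_ind, ind_mul_ind,
          ind_congr (q := x ∈ G.outerComp cliques[i] u) ⟨fun h => ⟨h.2, h.1⟩, fun h => ⟨h.2, h.1⟩⟩,
          ind_congr (p := G.Conn {x | x ∉ cliques[i]} u x ∧ x ∈ cliques[i] ∧ _)
            (q := x ∈ (↑(chosen t cliques[i] w) ∩ G.outerNbrs cliques[i] u : Set (Fin n)))]
        -- The component avoids the clique while its boundary lies inside, so at most one summand is
        -- nonzero and the symbol is at most `2`.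
        · refine Nat.mod_eq_of_lt ?_
          by_cases hx : x ∈ cliques[i]
          · rw [ind_false fun h => h.1 hx]
            have := ind_le_one
              (x ∈ (↑(chosen t cliques[i] w) ∩ G.outerNbrs cliques[i] u : Set (Fin n)))
            omega
          · rw [ind_false fun h : x ∈ (↑(chosen t cliques[i] w) ∩ G.outerNbrs cliques[i] u :
              Set (Fin n)) => hx h.2.1]
            have := ind_le_one (x ∈ G.outerComp cliques[i] u)
            omega
        · rw [Set.mem_inter_iff, Finset.mem_coe, mem_chosen]
          exact ⟨fun h => ⟨h.2, h.2.1, h.1⟩, fun h => ⟨h.2.2, h.1⟩⟩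
      · exact h1 x (by omega))
  rw [hs₁, AState.setVar_arr]
  exact h1 x (by rw [h.par_two]; exact x.2)

theorem arr_seven_node {s : AState} {C W : Set (Fin n)} (h1 : TrieHas (s.arr 6) (word C W) n)
    (h2 : s.var 9 = trieWalk (s.arr 6) (word C W) n) : s.arr 7 (s.var 9) = table s C W := by
  rw [table, trieLookup, if_pos h1, h2]

theorem sum_filter_lt_le (R : Finset (Fin n)) (f : Fin n → ℕ) (j : ℕ) :
    ∑ u ∈ R.filter (fun u : Fin n => (u : ℕ) < j), f u ≤ ∑ u ∈ R, f u :=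
  Finset.sum_le_sum_of_subset (Finset.filter_subset _ _)

-- A lookup may create trie nodes, at most `n` for each component, but the represented table stays
-- the same, so all summands refer to one and the same table.
open Classical in
theorem addComponents_spec (h : e.Describes G cliques t) {s : AState} {c i v w a : ℕ}
    (hi' : i < cliques.length) (hr : Ready G cliques[i] i v s) (hW : IsDigits n t w (s.arr 4))
    (hv : Valid G t c s) (ha : s.var 8 = a) (hK : 2 < e.par 0) (hc : c + n * n < e.par 0)
    (hb : a + ∑ u ∈ (G.outerReps cliques[i]).filter (· ∈ G.block cliques[i] (vertexOf n v)),
      table s (G.outerComp cliques[i] u) (↑(chosen t cliques[i] w) ∩ G.outerNbrs cliques[i] u) <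
        e.par 0) {s' : AState} (hs' : Stmt.addComponents.exec e s = s') :
    Valid G t (c + n * n) s' ∧ (table s' : Set (Fin n) → Set (Fin n) → ℕ) = table s ∧
      s'.var 8 = a +
        ∑ u ∈ (G.outerReps cliques[i]).filter (· ∈ G.block cliques[i] (vertexOf n v)),
          table s (G.outerComp cliques[i] u)
            (↑(chosen t cliques[i] w) ∩ G.outerNbrs cliques[i] u) := by
  set R := (G.outerReps cliques[i]).filter (· ∈ G.block cliques[i] (vertexOf n v)) with hR
  set f : Fin n → ℕ := fun u => table s (G.outerComp cliques[i] u)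
    (↑(chosen t cliques[i] w) ∩ G.outerNbrs cliques[i] u) with hf
  obtain ⟨s₁, hs₁, ⟨h1, h2, h3⟩, -⟩ := loop_rule (e := e) (s := s) (q := .addComponents) rfl
    (fun j s' => Valid G t (c + j * n) s' ∧
      (table s' : Set (Fin n) → Set (Fin n) → ℕ) = table s ∧
      s'.var 8 = a + ∑ u ∈ R.filter (fun u : Fin n => (u : ℕ) < j), f u)
    ⟨by simpa using hv, rfl, by rw [sum_filter_zero]; simpa using ha⟩ (by
      rintro j hj s₁ hsame ⟨h1, h2, h3⟩
      rw [h.par_two] at hj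
      lift j to Fin n using hj
      have hr₁ : Ready G cliques[i] i v (s₁.setVar 4 j) :=
        hr.same (hsame.setVar (by simp) j) (by decide) (by decide) (by decide) (by decide)
          (by decide)
      have hcond : (AExpr.arr 2 (.var 4) * AExpr.arr 3 (.var 4)).eval e (s₁.setVar 4 j) =
          ind (j ∈ R) := by
        rw [AExpr.eval_mul, AExpr.eval_arr, AExpr.eval_arr, AExpr.eval_var, AState.setVar_var,
          if_pos rfl, hr₁.reps j, hr₁.block j, ind_mul_ind]
        exact ind_congr Finset.mem_filter.symm
      have hj1 : ((j : ℕ) + 1) * n ≤ n * n := Nat.mul_le_mul_right n j.2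
      rw [exec_ite, hcond, sum_filter_succ]
      by_cases hjR : j ∈ R
      · rw [if_pos (ind_ne_zero.2 hjR), exec_seq, exec_seq, if_pos hjR]
        have hw := componentWord_spec h hi' hr₁ (w := w) (by
          rw [AState.setVar_arr, hsame.2 4 (by decide)]; exact hW) (u := j) (by simp) hK
        have hsame₂ := sameExcept_exec e Stmt.componentWord (s₁.setVar 4 j)
        generalize hs₂ : Stmt.componentWord.exec e (s₁.setVar 4 j) = s₂ at hw hsame₂
        have h2v : Valid G t (c + j * n) s₂ := h1.congr (hsame₂.2 6 (by decide))
          (hsame₂.2 7 (by decide)) (hsame₂.1 10 (by decide)) le_rfl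
        have hsame₃ := sameExcept_exec e Stmt.findNode s₂
        obtain ⟨h4, h5, h6, h7⟩ := findNode_valid h h2v hw (by
          rw [Nat.succ_mul] at hj1; omega) rfl
        generalize hs₃ : Stmt.findNode.exec e s₂ = s₃ at h4 h5 h6 h7 hsame₃
        have ht₃ : (table s₃ : Set (Fin n) → Set (Fin n) → ℕ) = table s := by
          rw [h5, table_congr (hsame₂.2 6 (by decide)) (hsame₂.2 7 (by decide)), ← h2]
          rfl
        have hval : (AExpr.var 8 + AExpr.arr 7 (.var 9)).eval e s₃ =
            a + (∑ u ∈ R.filter (fun u : Fin n => (u : ℕ) < j), f u + f j) := by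
          rw [AExpr.eval_add, AExpr.eval_arr, AExpr.eval_var, AExpr.eval_var,
            arr_seven_node h6 h7, ht₃, hsame₃.1 8 (by decide), hsame₂.1 8 (by decide),
            AState.setVar_var, if_neg (by decide), h3, Nat.add_assoc]
        have hlt : a + (∑ u ∈ R.filter (fun u : Fin n => (u : ℕ) < j), f u + f j) < e.par 0 := by
          refine lt_of_le_of_lt (Nat.add_le_add_left ?_ a) hb
          have := sum_filter_succ R f j
          rw [if_pos hjR] at this
          rw [← this]
          exact sum_filter_lt_le R f _
        rw [exec_assign, hval, Nat.mod_eq_of_lt hlt]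
        exact ⟨h4.congr rfl rfl (by simp) (by rw [Nat.succ_mul]; omega), ht₃, by simp⟩
      · rw [if_neg (by rw [ind_ne_zero]; exact hjR), exec_skip, if_neg hjR, Nat.add_zero]
        exact ⟨h1.congr rfl rfl (by simp) (by rw [Nat.succ_mul]; omega), h2, by simpa using h3⟩)
  rw [h.par_two] at h1 h3
  rw [sum_filter_all] at h3
  rw [← hs', hs₁]
  exact ⟨h1.congr rfl rfl (by simp) le_rfl, h2, by simpa using h3⟩

theorem gate_subset {Ω : Finset (Fin n)} {v : Option (Fin n)} {x : Fin n} (hx : x ∈ G.gate Ω v) :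
    x ∈ Ω := by
  cases v with
  | none => exact absurd hx (by simp [gate])
  | some v => exact hx.1

theorem blockWord_spec (h : e.Describes G cliques t) {s : AState} {i v w : ℕ}
    (hi' : i < cliques.length) (hr : Ready G cliques[i] i v s) (hW : IsDigits n t w (s.arr 4))
    (hK : 3 < e.par 0) (x : Fin n) :
    (Stmt.blockWord.exec e s).arr 5 x = ind (x ∈ G.block cliques[i] (vertexOf n v)) +
      2 * ind (x ∈ (↑(chosen t cliques[i] w) ∩ G.gate cliques[i] (vertexOf n v) :
        Set (Fin n))) := by
  obtain ⟨s₁, hs₁, h1, -⟩ := loop_rule (e := e) (s := s) (q := .blockWord) rfl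
    (fun j s' => ∀ x : Fin n, (x : ℕ) < j → s'.arr 5 x =
      ind (x ∈ G.block cliques[i] (vertexOf n v)) +
      2 * ind (x ∈ (↑(chosen t cliques[i] w) ∩ G.gate cliques[i] (vertexOf n v) : Set (Fin n))))
    (by simp) (by
      intro j hj s₁ hsame h1 x hx
      rw [h.par_two] at hj
      lift j to Fin n using hj
      have h4 := hW j
      rw [← hsame.2 4 (by decide)] at h4
      have h3 := hr.block j
      rw [← hsame.2 3 (by decide)] at h3
      have h5 := hr.gate j
      rw [← hsame.2 1 (by decide)] at h5
      rw [exec_store, AState.setArr_arr, if_pos rfl, AExpr.eval_var, AState.setVar_var, if_pos rfl,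
        Function.update_apply]
      split
      · rename_i heq
        obtain rfl : x = j := Fin.ext heq
        rw [AExpr.eval_add, AExpr.eval_mul, AExpr.eval_mul, AExpr.eval_arr, AExpr.eval_arr,
          AExpr.eval_arr, AExpr.eval_add, AExpr.eval_var, AExpr.eval_one, AExpr.eval_two,
          AState.setVar_var, if_pos rfl, AState.setVar_arr, h4, h3, h5, ind_mul_ind,
          ind_congr (p := x ∈ G.gate cliques[i] (vertexOf n v) ∧ _)
            (q := x ∈ (↑(chosen t cliques[i] w) ∩ G.gate cliques[i] (vertexOf n v) :
              Set (Fin n)))]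
        · refine Nat.mod_eq_of_lt ?_
          have h6 := ind_le_one (x ∈ (↑(chosen t cliques[i] w) ∩
            G.gate cliques[i] (vertexOf n v) : Set (Fin n)))
          have h7 := ind_le_one (x ∈ G.block cliques[i] (vertexOf n v))
          dsimp only
          omega
        · rw [Set.mem_inter_iff, Finset.mem_coe, mem_chosen]
          exact ⟨fun h => ⟨⟨gate_subset h.1, h.2⟩, h.1⟩, fun h => ⟨h.2, h.1.2⟩⟩
      · exact h1 x (by omega))
  rw [hs₁, AState.setVar_arr]
  exact h1 x (by rw [h.par_two]; exact x.2)

/-- An entry is changed only to be raised, and only to a value that is realized by an extension.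
Soundness is kept and the table grows monotonically. -/
theorem recordValue_spec (h : e.Describes G cliques t) {s : AState} {c i v w a : ℕ}
    (hi' : i < cliques.length) (hr : Ready G cliques[i] i v s) (hW : IsDigits n t w (s.arr 4))
    (hv : Valid G t c s) (ha : s.var 8 = a) (hK : 3 < e.par 0) (hc : c + n < e.par 0)
    (haK : a < e.par 0) (hext : G.Extends t (G.block cliques[i] (vertexOf n v))
      (↑(chosen t cliques[i] w) ∩ G.gate cliques[i] (vertexOf n v)) a)
    {s' : AState} (hs' : Stmt.recordValue.exec e s = s') :
    Valid G t (c + n) s' ∧ (table s : Set (Fin n) → Set (Fin n) → ℕ) ≤ table s' ∧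
      a ≤ table s' (G.block cliques[i] (vertexOf n v))
        (↑(chosen t cliques[i] w) ∩ G.gate cliques[i] (vertexOf n v)) := by
  classical
  set C := G.block cliques[i] (vertexOf n v) with hC
  set W : Set (Fin n) := ↑(chosen t cliques[i] w) ∩ G.gate cliques[i] (vertexOf n v) with hWdef
  rw [Stmt.recordValue, exec_seq, exec_seq] at hs'
  have hw := blockWord_spec h hi' hr hW hK
  have hsame₂ := sameExcept_exec e Stmt.blockWord s
  generalize hs₂ : Stmt.blockWord.exec e s = s₂ at hw hsame₂ hs'
  have h2v : Valid G t c s₂ := hv.congr (hsame₂.2 6 (by decide))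
    (hsame₂.2 7 (by decide)) (hsame₂.1 10 (by decide)) le_rfl
  have hsame₃ := sameExcept_exec e Stmt.findNode s₂
  obtain ⟨h4, h5, h6, h7⟩ := findNode_valid h h2v hw hc rfl
  generalize hs₃ : Stmt.findNode.exec e s₂ = s₃ at h4 h5 h6 h7 hsame₃ hs'
  have ht₃ : (table s₃ : Set (Fin n) → Set (Fin n) → ℕ) = table s := by
    rw [h5, table_congr (hsame₂.2 6 (by decide)) (hsame₂.2 7 (by decide))]
  have h8 : s₃.var 8 = a := by rw [hsame₃.1 8 (by decide), hsame₂.1 8 (by decide), ha]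
  have hnode := arr_seven_node h6 h7
  rw [exec_ite, AExpr.eval_lt, AExpr.eval_arr, AExpr.eval_var, AExpr.eval_var, hnode, h8] at hs'
  by_cases hlt : table s₃ C W < a
  · rw [if_pos hlt, if_pos one_ne_zero, exec_store, AExpr.eval_var, AExpr.eval_var, h8,
      Nat.mod_eq_of_lt haK] at hs'
    have hT6 : s'.arr 6 = s₃.arr 6 := by rw [← hs', AState.setArr_arr, if_neg (by decide)]
    have hT7 : s'.arr 7 = Function.update (s₃.arr 7) (trieWalk (s₃.arr 6) (word C W) n) a := by
      rw [← hs', AState.setArr_arr, if_pos rfl, h7]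
    have h10 : s'.var 10 = s₃.var 10 := by rw [← hs']; rfl
    have htab : ∀ C' W' : Set (Fin n), table s' C' W' =
        if C' = C ∧ W' = W then a else table s₃ C' W' := by
      intro C' W'
      rw [table, hT6, hT7, h4.trie.lookup_update h6 (fun i _ => word_lt C W i)
        (fun i _ => word_lt C' W' i)]
      by_cases hcw : C' = C ∧ W' = W
      · rw [if_pos hcw, if_pos]
        intro i _
        rw [hcw.1, hcw.2]
      · rw [if_neg hcw, if_neg fun hh => hcw (word_inj hh)]
        rfl
    refine ⟨⟨?_, by rw [h10]; exact h4.nodes, fun C' W' => ?_⟩, fun C' W' => ?_, ?_⟩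
    · rw [hT6, hT7, h10]
      exact h4.trie.update (trieWalk_le h4.trie n)
    · rw [htab]
      split
      · rename_i hcw
        rw [hcw.1, hcw.2]
        exact hext
      · exact h4.sound C' W'
    · rw [htab, ← ht₃]
      split
      · rename_i hcw
        rw [hcw.1, hcw.2]
        exact hlt.le
      · exact le_rfl
    · rw [htab, if_pos ⟨rfl, rfl⟩]
  · rw [if_neg hlt, if_neg (by simp), exec_skip] at hs'
    subst hs'
    exact ⟨h4, by rw [ht₃], by omega⟩

open Classical in
theorem stepVal_mono {tab tab' : Set (Fin n) → Set (Fin n) → ℕ} (h : tab ≤ tab')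
    (Ω : Finset (Fin n)) (v : Option (Fin n)) (W : Finset (Fin n)) :
    G.stepVal tab Ω v W ≤ G.stepVal tab' Ω v W :=
  Nat.add_le_add_left (Finset.sum_le_sum fun _ _ => h _ _) _

/-- The computed value is realized by a vertex set, hence at most `n`, and no sum is affected by the
reduction modulo the word bound. The components account for `n * n` new trie nodes at most, the
block for `n` more. -/
theorem codeStep_spec (h : e.Describes G cliques t) {s : AState} {c i v w : ℕ}
    (hi' : i < cliques.length) (hr : Ready G cliques[i] i v s) (hw : s.var 3 = w)
    (hv : Valid G t c s) (hwK : w < e.par 0) (hK : 3 < e.par 0) (hn : n < e.par 0)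
    (hc : c + (n * n + n) < e.par 0) {s' : AState} (hs' : Stmt.codeStep.exec e s = s') :
    Valid G t (c + (n * n + n)) s' ∧ (table s : Set (Fin n) → Set (Fin n) → ℕ) ≤ table s' ∧
      G.stepVal (table s) cliques[i] (vertexOf n v) (chosen t cliques[i] w) ≤
        table s' (G.block cliques[i] (vertexOf n v))
          (↑(chosen t cliques[i] w) ∩ G.gate cliques[i] (vertexOf n v)) := by
  classical
  have hext := extends_stepVal (Ω := cliques[i]) hv.sound (vertexOf n v)
    (chosen_subset (t := t) cliques[i] w) (card_chosen_le cliques[i] w)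
  have hle : G.stepVal (table s) cliques[i] (vertexOf n v) (chosen t cliques[i] w) ≤ n := by
    simpa using hext.le_card
  rw [Stmt.codeStep, exec_seq, exec_seq, exec_seq] at hs'
  have hd : IsDigits n t w _ := fun x => decode_spec h hw hwK x
  have hsame₁ := sameExcept_exec e Stmt.decode s
  generalize hs₁ : Stmt.decode.exec e s = s₁ at hd hsame₁ hs'
  have hr₁ := hr.same hsame₁ (by decide) (by decide) (by decide) (by decide) (by decide)
  have hcnt := countChosen_spec h hr₁.var_one hi' hd hr₁.block hn
  have hsame₂ := sameExcept_exec e Stmt.countChosen s₁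
  generalize hs₂ : Stmt.countChosen.exec e s₁ = s₂ at hcnt hsame₂ hs'
  have hr₂ := hr₁.same hsame₂ (by decide) (by decide) (by decide) (by decide) (by decide)
  have hd₂ : IsDigits n t w (s₂.arr 4) := by rw [hsame₂.2 4 (by decide)]; exact hd
  have h6 : s₂.arr 6 = s.arr 6 := by rw [hsame₂.2 6 (by decide), hsame₁.2 6 (by decide)]
  have h7 : s₂.arr 7 = s.arr 7 := by rw [hsame₂.2 7 (by decide), hsame₁.2 7 (by decide)]
  have h10 : s₂.var 10 = s.var 10 := by rw [hsame₂.1 10 (by decide), hsame₁.1 10 (by decide)]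
  have hv₂ : Valid G t c s₂ := hv.congr h6 h7 h10 le_rfl
  have ht₂ : (table s₂ : Set (Fin n) → Set (Fin n) → ℕ) = table s := table_congr h6 h7
  obtain ⟨hv₃, ht₃, h8⟩ := addComponents_spec h hi' hr₂ hd₂ hv₂ hcnt (by omega) (by omega)
    (by rw [ht₂]; exact hle.trans_lt hn) rfl
  have hsame₃ := sameExcept_exec e Stmt.addComponents s₂
  generalize hs₃ : Stmt.addComponents.exec e s₂ = s₃ at hv₃ ht₃ h8 hsame₃ hs'
  have hr₃ := hr₂.same hsame₃ (by decide) (by decide) (by decide) (by decide) (by decide)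
  have hd₃ : IsDigits n t w (s₃.arr 4) := by rw [hsame₃.2 4 (by decide)]; exact hd₂
  rw [ht₂] at h8 ht₃
  have h8' : s₃.var 8 = G.stepVal (table s) cliques[i] (vertexOf n v) (chosen t cliques[i] w) := h8
  obtain ⟨hv₄, ht₄, h9⟩ := recordValue_spec h hi' hr₃ hd₃ hv₃ h8' hK (by omega)
    (hle.trans_lt hn) hext hs'
  exact ⟨hv₄.congr rfl rfl rfl (by omega), ht₃ ▸ ht₄, h9⟩

end Specs

end ArrayLang

/-! ### Correctness of the program: the nested loops and the final answer -/

namespace ArrayLang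

open WordRAM SimpleGraph

section Specs

variable {n : ℕ} {e : Env} {G : SimpleGraph (Fin n)} {cliques : List (Finset (Fin n))} {t : ℕ}

/-- The table `tab'` has taken into account the solutions obtained from `tab` for the clique `Ω` and
the block selected by `v`. -/
def Treated (G : SimpleGraph (Fin n)) (t : ℕ) (tab : Set (Fin n) → Set (Fin n) → ℕ)
    (Ω : Finset (Fin n)) (v : Option (Fin n)) (tab' : Set (Fin n) → Set (Fin n) → ℕ) : Prop :=
  ∀ W ⊆ Ω, W.card ≤ t + 1 → G.stepVal tab Ω v W ≤ tab' (G.block Ω v) (↑W ∩ G.gate Ω v)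

theorem Treated.mono {tab₁ tab₂ tab₃ tab₄ : Set (Fin n) → Set (Fin n) → ℕ} {Ω : Finset (Fin n)}
    {v : Option (Fin n)} (h : Treated G t tab₂ Ω v tab₃) (h₁ : tab₁ ≤ tab₂) (h₂ : tab₃ ≤ tab₄) :
    Treated G t tab₁ Ω v tab₄ := fun W hW hcard =>
  (stepVal_mono h₁ Ω v W).trans ((h W hW hcard).trans (h₂ _ _))

/-- The word bound is large enough for the dynamic program. -/
structure Env.Large (e : Env) (n t : ℕ) : Prop where
  three_lt : 3 < e.par 0
  lt : n < e.par 0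
  codes : (n + 1) ^ (t + 1) ≤ e.par 0

/-- The table is updated in place, so later codes see larger entries than those at the start. As
`stepVal` is monotone in the table, the comparison with the initial table still holds for every
code, and every admissible `W` has a code. -/
theorem codeLoop_spec (h : e.Describes G cliques t) (hl : e.Large n t) {s : AState} {c i v : ℕ}
    (hi' : i < cliques.length) (hr : Ready G cliques[i] i v s) (hv : Valid G t c s)
    (hc : c + (n + 1) ^ (t + 1) * (n * n + n) < e.par 0)
    {s' : AState} (hs' : Stmt.codeLoop.exec e s = s') :
    Valid G t (c + (n + 1) ^ (t + 1) * (n * n + n)) s' ∧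
      (table s : Set (Fin n) → Set (Fin n) → ℕ) ≤ table s' ∧
      Treated G t (table s) cliques[i] (vertexOf n v) (table s') := by
  obtain ⟨s₁, hs₁, ⟨h1, h2, h3⟩, -⟩ := loop_rule (e := e) (s := s) (q := .codeLoop) rfl
    (fun j s' => Valid G t (c + j * (n * n + n)) s' ∧
      (table s : Set (Fin n) → Set (Fin n) → ℕ) ≤ table s' ∧
      ∀ w < j, G.stepVal (table s) cliques[i] (vertexOf n v) (chosen t cliques[i] w) ≤
        table s' (G.block cliques[i] (vertexOf n v))
          (↑(chosen t cliques[i] w) ∩ G.gate cliques[i] (vertexOf n v)))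
    ⟨by simpa using hv, le_rfl, by simp⟩ (by
      rintro j hj s₁ hsame ⟨h1, h2, h3⟩
      rw [h.par_four] at hj
      have hj1 := Nat.mul_le_mul_right (n * n + n) (Nat.succ_le_of_lt hj)
      rw [Nat.succ_mul] at hj1
      obtain ⟨h4, h5, h6⟩ := codeStep_spec h hi' (s := s₁.setVar 3 j) (w := j) (v := v)
        (c := c + j * (n * n + n))
        (hr.same (hsame.setVar (by simp) j) (by decide) (by decide) (by decide) (by decide)
          (by decide)) (by simp) (h1.congr rfl rfl (by simp) le_rfl)
        (hj.trans_le hl.codes) hl.three_lt hl.lt (by omega) rfl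
      refine ⟨h4.congr rfl rfl rfl (by rw [Nat.succ_mul]; omega), h2.trans h5, fun w hw => ?_⟩
      rcases Nat.lt_succ_iff_lt_or_eq.1 hw with hw | rfl
      · exact (h3 w hw).trans (h5 _ _)
      · exact (stepVal_mono h2 _ _ _).trans h6)
  rw [h.par_four] at h1 h3
  rw [← hs', hs₁]
  refine ⟨h1.congr rfl rfl (by simp) le_rfl, h2, fun W hW hcard => ?_⟩
  obtain ⟨w, hw, rfl⟩ := exists_chosen_eq hW hcard
  exact h3 w hw

theorem vertexLoop_spec (h : e.Describes G cliques t) (hl : e.Large n t) {s : AState} {c i : ℕ}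
    (hi : s.var 1 = i) (hi' : i < cliques.length)
    (hP : IsMat (s.arr 0) (G.Conn {x | x ∉ cliques[i]}))
    (hR : IsChar (s.arr 2) (· ∈ G.outerReps cliques[i])) (hv : Valid G t c s)
    (hc : c + (n + 1) * ((n + 1) ^ (t + 1) * (n * n + n)) < e.par 0)
    {s' : AState} (hs' : Stmt.vertexLoop.exec e s = s') :
    Valid G t (c + (n + 1) * ((n + 1) ^ (t + 1) * (n * n + n))) s' ∧
      (table s : Set (Fin n) → Set (Fin n) → ℕ) ≤ table s' ∧
      ∀ v, Treated G t (table s) cliques[i] v (table s') := by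
  set D := (n + 1) ^ (t + 1) * (n * n + n) with hD
  obtain ⟨s₁, hs₁, ⟨h1, h2, h3⟩, -⟩ := loop_rule (e := e) (s := s) (q := .vertexLoop) rfl
    (fun j s' => Valid G t (c + j * D) s' ∧
      (table s : Set (Fin n) → Set (Fin n) → ℕ) ≤ table s' ∧
      ∀ v < j, Treated G t (table s) cliques[i] (vertexOf n v) (table s'))
    ⟨by simpa using hv, le_rfl, by simp⟩ (by
      rintro j hj s₁ hsame ⟨h1, h2, h3⟩
      rw [h.par_six] at hj
      have hj1 := Nat.mul_le_mul_right D (Nat.succ_le_of_lt hj)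
      rw [Nat.succ_mul] at hj1
      rw [Stmt.vertexStep, exec_seq, exec_seq]
      have hP₁ : IsMat ((s₁.setVar 2 j).arr 0) (G.Conn {x | x ∉ cliques[i]}) := by
        rw [AState.setVar_arr, hsame.2 0 (by decide)]; exact hP
      have hR₁ : IsChar ((s₁.setVar 2 j).arr 2) (· ∈ G.outerReps cliques[i]) := by
        rw [AState.setVar_arr, hsame.2 2 (by decide)]; exact hR
      have e1 : (s₁.setVar 2 j).var 1 = i := by simp [hsame.1 1 (by decide), hi]
      have e2 : (s₁.setVar 2 j).var 2 = j := by simp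
      have hv₁ : Valid G t (c + j * D) (s₁.setVar 2 j) := h1.congr rfl rfl (by simp) le_rfl
      have h2' : (table s : Set (Fin n) → Set (Fin n) → ℕ) ≤ table (s₁.setVar 2 j) := h2
      have h3' : ∀ v < j, Treated G t (table s) cliques[i] (vertexOf n v)
        (table (s₁.setVar 2 j)) := h3
      generalize s₁.setVar 2 j = s₂ at hP₁ hR₁ e1 e2 hv₁ h2' h3'
      have hg := computeGate_spec h e1 hi' e2 hP₁
      have hsame₃ := sameExcept_exec e Stmt.computeGate s₂
      generalize Stmt.computeGate.exec e s₂ = s₃ at hg hsame₃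
      rw [← hsame₃.2 0 (by decide)] at hP₁
      rw [← hsame₃.2 2 (by decide)] at hR₁
      rw [← hsame₃.1 1 (by decide)] at e1
      rw [← hsame₃.1 2 (by decide)] at e2
      have hb := computeBlock_spec h e1 hi' e2 (by omega) hP₁ hg
      have hsame₄ := sameExcept_exec e Stmt.computeBlock s₃
      generalize Stmt.computeBlock.exec e s₃ = s₄ at hb hsame₄
      rw [← hsame₄.2 0 (by decide)] at hP₁
      rw [← hsame₄.2 1 (by decide)] at hg
      rw [← hsame₄.2 2 (by decide)] at hR₁
      rw [← hsame₄.1 1 (by decide)] at e1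
      have h6 : s₄.arr 6 = s₂.arr 6 := by rw [hsame₄.2 6 (by decide), hsame₃.2 6 (by decide)]
      have h7 : s₄.arr 7 = s₂.arr 7 := by rw [hsame₄.2 7 (by decide), hsame₃.2 7 (by decide)]
      have h10 : s₄.var 10 = s₂.var 10 := by rw [hsame₄.1 10 (by decide), hsame₃.1 10 (by decide)]
      have ht : (table s₄ : Set (Fin n) → Set (Fin n) → ℕ) = table s₂ := table_congr h6 h7
      obtain ⟨h8, h9, h11⟩ := codeLoop_spec h hl hi' (v := j) ⟨e1, hP₁, hg, hR₁, hb⟩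
        (hv₁.congr h6 h7 h10 le_rfl) (by omega) rfl
      rw [ht] at h9 h11
      refine ⟨h8.congr rfl rfl rfl (by rw [Nat.succ_mul]; omega), h2'.trans h9, fun v hv => ?_⟩
      rcases Nat.lt_succ_iff_lt_or_eq.1 hv with hv | rfl
      · exact (h3' v hv).mono le_rfl h9
      · exact h11.mono h2' le_rfl)
  rw [h.par_six] at h1 h3
  rw [← hs', hs₁]
  refine ⟨h1.congr rfl rfl (by simp) le_rfl, h2, fun v => ?_⟩
  cases v with
  | none =>
    have := h3 n (by omega)
    rwa [show vertexOf n n = none by simp [vertexOf]] at this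
  | some v =>
    have := h3 v (by omega)
    rwa [show vertexOf n v = some v by simp [vertexOf]] at this

theorem cliqueLoop_spec (h : e.Describes G cliques t) (hl : e.Large n t) {s : AState} {c : ℕ}
    (hv : Valid G t c s)
    (hc : c + cliques.length * ((n + 1) * ((n + 1) ^ (t + 1) * (n * n + n))) < e.par 0)
    {s' : AState} (hs' : Stmt.cliqueLoop.exec e s = s') :
    Valid G t (c + cliques.length * ((n + 1) * ((n + 1) ^ (t + 1) * (n * n + n)))) s' ∧
      (table s : Set (Fin n) → Set (Fin n) → ℕ) ≤ table s' ∧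
      ∀ Ω ∈ cliques, ∀ v, Treated G t (table s) Ω v (table s') := by
  set D := (n + 1) * ((n + 1) ^ (t + 1) * (n * n + n)) with hD
  obtain ⟨s₁, hs₁, ⟨h1, h2, h3⟩, -⟩ := loop_rule (e := e) (s := s) (q := .cliqueLoop) rfl
    (fun j s' => Valid G t (c + j * D) s' ∧
      (table s : Set (Fin n) → Set (Fin n) → ℕ) ≤ table s' ∧
      ∀ i (hi : i < cliques.length), i < j → ∀ v, Treated G t (table s) cliques[i] v (table s'))
    ⟨by simpa using hv, le_rfl, by simp⟩ (by
      rintro j hj s₁ hsame ⟨h1, h2, h3⟩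
      rw [h.par_three] at hj
      have hj1 := Nat.mul_le_mul_right D (Nat.succ_le_of_lt hj)
      rw [Nat.succ_mul] at hj1
      rw [Stmt.cliqueStep, exec_seq, exec_seq, exec_seq]
      have e1 : (s₁.setVar 1 j).var 1 = j := by simp
      have hv₁ : Valid G t (c + j * D) (s₁.setVar 1 j) := h1.congr rfl rfl (by simp) le_rfl
      have h2' : (table s : Set (Fin n) → Set (Fin n) → ℕ) ≤ table (s₁.setVar 1 j) := h2
      have h3' : ∀ i (hi : i < cliques.length), i < j → ∀ v, Treated G t (table s) cliques[i] v
        (table (s₁.setVar 1 j)) := h3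
      generalize s₁.setVar 1 j = s₂ at e1 hv₁ h2' h3'
      have hA := initMatrix_spec h s₂
      have hsame₃ := sameExcept_exec e Stmt.initMatrix s₂
      generalize Stmt.initMatrix.exec e s₂ = s₃ at hA hsame₃
      rw [← hsame₃.1 1 (by decide)] at e1
      have hP := closeMatrix_spec h e1 hj hA
      have hsame₄ := sameExcept_exec e Stmt.closeMatrix s₃
      generalize Stmt.closeMatrix.exec e s₃ = s₄ at hP hsame₄
      rw [← hsame₄.1 1 (by decide)] at e1
      have hR := computeReps_spec h e1 hj hP
      have hsame₅ := sameExcept_exec e Stmt.computeReps s₄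
      generalize Stmt.computeReps.exec e s₄ = s₅ at hR hsame₅
      rw [← hsame₅.1 1 (by decide)] at e1
      rw [← hsame₅.2 0 (by decide)] at hP
      have h6 : s₅.arr 6 = s₂.arr 6 := by
        rw [hsame₅.2 6 (by decide), hsame₄.2 6 (by decide), hsame₃.2 6 (by decide)]
      have h7 : s₅.arr 7 = s₂.arr 7 := by
        rw [hsame₅.2 7 (by decide), hsame₄.2 7 (by decide), hsame₃.2 7 (by decide)]
      have h10 : s₅.var 10 = s₂.var 10 := by
        rw [hsame₅.1 10 (by decide), hsame₄.1 10 (by decide), hsame₃.1 10 (by decide)]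
      have ht : (table s₅ : Set (Fin n) → Set (Fin n) → ℕ) = table s₂ := table_congr h6 h7
      obtain ⟨h8, h9, h11⟩ := vertexLoop_spec h hl e1 hj hP hR
        (hv₁.congr h6 h7 h10 le_rfl) (by omega) rfl
      rw [ht] at h9 h11
      refine ⟨h8.congr rfl rfl rfl (by rw [Nat.succ_mul j, ← hD]; omega), h2'.trans h9,
        fun i hi hij v => ?_⟩
      rcases Nat.lt_succ_iff_lt_or_eq.1 hij with hij | rfl
      · exact (h3' i hi hij v).mono le_rfl h9
      · exact (h11 v).mono h2' le_rfl)
  rw [h.par_three] at h1 h3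
  rw [← hs', hs₁]
  refine ⟨h1.congr rfl rfl (by simp) le_rfl, h2, fun Ω hΩ v => ?_⟩
  obtain ⟨i, hi, rfl⟩ := List.getElem_of_mem hΩ
  exact h3 i hi hi v

/-- Each round raises by one the size up to which the table is complete. The invariant also
remembers the table before the latest round, because the entry for the whole graph comes from one
round applied to a table complete up to `r`. -/
theorem rounds_spec (h : e.Describes G cliques t) (hl : e.Large n t)
    (hcl : ∀ Ω ∈ G.potentialMaximalCliques, Ω ∈ cliques) {s : AState} {r : ℕ}
    (hv : Valid G t 0 s) (hr : e.par 5 = r + 1)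
    (hc : (r + 1) * (cliques.length * ((n + 1) * ((n + 1) ^ (t + 1) * (n * n + n)))) < e.par 0)
    {s' : AState} (hs' : Stmt.rounds.exec e s = s') :
    Valid G t ((r + 1) * (cliques.length * ((n + 1) * ((n + 1) ^ (t + 1) * (n * n + n))))) s' ∧
      ∃ tab : Set (Fin n) → Set (Fin n) → ℕ,
        (∀ (H : SimpleGraph (Fin n)) (U : Finset (Fin n)), G.IsMinimalTriangulation H →
          (∀ K : Finset (Fin n), H.IsClique (K : Set (Fin n)) → K ⊆ U → K.card ≤ t + 1) →
          TableComplete G H U r tab) ∧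
        ∀ Ω ∈ G.potentialMaximalCliques, ∀ v, Treated G t tab Ω v (table s') := by
  set D := cliques.length * ((n + 1) * ((n + 1) ^ (t + 1) * (n * n + n))) with hD
  obtain ⟨s₁, hs₁, ⟨h1, -, h3⟩, -⟩ := loop_rule (e := e) (s := s) (q := .rounds) rfl
    (fun j s' => Valid G t (j * D) s' ∧
      (∀ (H : SimpleGraph (Fin n)) (U : Finset (Fin n)), G.IsMinimalTriangulation H →
        (∀ K : Finset (Fin n), H.IsClique (K : Set (Fin n)) → K ⊆ U → K.card ≤ t + 1) →
        TableComplete G H U j (table s')) ∧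
      ∀ i, j = i + 1 → ∃ tab : Set (Fin n) → Set (Fin n) → ℕ,
        (∀ (H : SimpleGraph (Fin n)) (U : Finset (Fin n)), G.IsMinimalTriangulation H →
          (∀ K : Finset (Fin n), H.IsClique (K : Set (Fin n)) → K ⊆ U → K.card ≤ t + 1) →
          TableComplete G H U i tab) ∧
        ∀ Ω ∈ G.potentialMaximalCliques, ∀ v, Treated G t tab Ω v (table s'))
    ⟨by simpa using hv, fun H U _ _ => tableComplete_zero H U _, by simp⟩ (by
      rintro j hj s₁ hsame ⟨h1, h2, -⟩
      rw [hr] at hj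
      have hj1 := Nat.mul_le_mul_right D (Nat.succ_le_of_lt hj)
      rw [Nat.succ_mul] at hj1
      obtain ⟨h4, -, h6⟩ := cliqueLoop_spec h hl (s := s₁.setVar 0 j) (c := j * D)
        (h1.congr rfl rfl (by simp) le_rfl) (by omega) rfl
      refine ⟨h4.congr rfl rfl rfl (by rw [Nat.succ_mul j]), fun H U hH hU => ?_, fun i hi => ?_⟩
      · exact (h2 H U hH hU).succ hH hU fun Ω hΩ v W hW hcard => h6 Ω (hcl Ω hΩ) v W hW hcard
      · obtain rfl : j = i := by omega
        exact ⟨table s₁, h2, fun Ω hΩ v => h6 Ω (hcl Ω hΩ) v⟩)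
  rw [hr] at h1
  rw [← hs', hs₁]
  exact ⟨h1.congr rfl rfl (by simp) le_rfl, h3 r hr⟩

/-- The dynamic program computes the maximum number of vertices of an induced subgraph of treewidth
at most `t`. -/
theorem mainProgram_spec (h : e.Describes G cliques t) (hl : e.Large n t)
    (hcl : ∀ Ω ∈ G.potentialMaximalCliques, Ω ∈ cliques) {s : AState}
    (h6 : s.arr 6 = 0) (h7 : s.arr 7 = 0) (h10 : s.var 10 = 0)
    (hr : e.par 5 = 2 * G.edgeSet.ncard + 1 + 1)
    (hc : e.par 5 * (cliques.length * ((n + 1) * ((n + 1) ^ (t + 1) * (n * n + n)))) + n < e.par 0)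
    {s' : AState} (hs' : Stmt.mainProgram.exec e s = s') (l : ℕ) :
    l ≤ s'.arr 7 (s'.var 9) ↔
      ∃ U : Finset (Fin n), U.card = l ∧ (G.induce (U : Set (Fin n))).treewidth ≤ t := by
  have hz : ∀ C W : Set (Fin n), table s C W = 0 := by
    intro C W
    rw [table, trieLookup, h7]
    simp
  have hv : Valid G t 0 s := by
    refine ⟨?_, h10.le, fun C W => by rw [hz]; exact extends_zero t C W⟩
    rw [h6, h7, h10]
    exact ⟨fun _ => le_rfl, fun _ _ _ h => absurd rfl h, fun _ _ => rfl, fun _ _ => rfl⟩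
  rw [hr] at hc
  rw [Stmt.mainProgram, exec_seq, exec_seq] at hs'
  obtain ⟨hv₁, tab, htab, hstep⟩ := rounds_spec h hl hcl hv hr (by omega) rfl
  generalize Stmt.rounds.exec e s = s₁ at hv₁ hstep hs'
  have hw : ∀ x : Fin n, (Stmt.rootWord.exec e s₁).arr 5 x =
      ind (x ∈ (Set.univ : Set (Fin n))) + 2 * ind (x ∈ (∅ : Set (Fin n))) := by
    obtain ⟨s₂, hs₂, h2, -⟩ := loop_rule (e := e) (s := s₁) (q := .rootWord) rfl
      (fun j s' => ∀ x : Fin n, (x : ℕ) < j → s'.arr 5 x = 1) (by simp) (by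
        intro j hj s₂ _ h2 x hx
        rw [exec_store, AState.setArr_arr, if_pos rfl, AExpr.eval_var, AState.setVar_var,
          if_pos rfl, Function.update_apply, AExpr.eval_one,
          Nat.mod_eq_of_lt (by have := h.two_le; omega)]
        split
        · rfl
        · exact h2 x (by omega))
    intro x
    rw [hs₂, AState.setVar_arr, h2 x (by rw [h.par_two]; exact x.2), ind_true (Set.mem_univ x),
      ind_false (Set.notMem_empty x)]
  have hsame₂ := sameExcept_exec e Stmt.rootWord s₁
  generalize Stmt.rootWord.exec e s₁ = s₂ at hw hsame₂ hs'
  have e6 := hsame₂.2 6 (by decide)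
  have e7 := hsame₂.2 7 (by decide)
  obtain ⟨hv₃, ht, h8, h9⟩ := findNode_valid h
    (hv₁.congr e6 e7 (hsame₂.1 10 (by decide)) le_rfl) hw hc hs'
  rw [arr_seven_node h8 h9]
  constructor
  · exact fun hl => (hv₃.sound Set.univ ∅).treewidth_induce_le hl
  · rintro ⟨U, rfl, hU⟩
    obtain ⟨H, hH, hHU⟩ := exists_isMinimalTriangulation_card_le G U t hU
    rw [ht, table_congr e6 e7]
    -- Before the last round the table is complete up to size `2m + 1`, which covers all components.
    exact (htab H U hH hHU).card_le hH hHU (fun Ω u _ => ncard_outerComp_le u) hstep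

end Specs

end ArrayLang

namespace ArrayLang

open WordRAM SimpleGraph

/-! ### Running time -/

/-- The order of magnitude of the running time. -/
def Stmt.weight (e : Env) : Stmt → ℕ
  | .skip => 1
  | .assign _ _ => 1
  | .store _ _ _ => 1
  | .seq p q => p.weight e + q.weight e
  | .ite _ p q => p.weight e + q.weight e
  -- The additional `1` accounts for the initialization and the last test, also when the loop is
  -- never entered.
  | .loop _ b p => (e.par b + 1) * p.weight e

theorem one_le_weight (e : Env) (p : Stmt) : 1 ≤ p.weight e := by
  induction p with
  | skip | assign | store => exact le_rfl
  | seq p q ihp _ => exact ihp.trans (Nat.le_add_right _ _)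
  | ite a p q ihp _ => exact ihp.trans (Nat.le_add_right _ _)
  | loop x b p ih => exact Nat.mul_pos (Nat.succ_pos _) ih

/-- The factor depends on the statement alone, through the sizes of its expressions; one constant
therefore serves all instances. -/
theorem exists_cost_le_weight (p : Stmt) : ∃ a, ∀ e, p.cost e ≤ a * p.weight e := by
  induction p with
  | skip => exact ⟨1, fun e => le_rfl⟩
  | assign x a => exact ⟨a.compile.cost + 3, fun e => by simp [Stmt.cost, Stmt.weight]⟩
  | store k i a =>
    exact ⟨i.compile.cost + a.compile.cost + 9, fun e => by simp [Stmt.cost, Stmt.weight]⟩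
  | seq p q ihp ihq =>
    obtain ⟨a, ha⟩ := ihp
    obtain ⟨b, hb⟩ := ihq
    refine ⟨a + b, fun e => ?_⟩
    simp only [Stmt.cost, Stmt.weight]
    nlinarith [ha e, hb e, Nat.zero_le (a * q.weight e), Nat.zero_le (b * p.weight e)]
  | ite c p q ihp ihq =>
    obtain ⟨a, ha⟩ := ihp
    obtain ⟨b, hb⟩ := ihq
    refine ⟨c.compile.cost + 1 + (a + b), fun e => ?_⟩
    simp only [Stmt.cost, Stmt.weight]
    have h1 := one_le_weight e p
    have h2 : c.compile.cost + 1 ≤ (c.compile.cost + 1) * (p.weight e + q.weight e) :=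
      Nat.le_mul_of_pos_right _ (by omega)
    nlinarith [ha e, hb e, Nat.zero_le (a * q.weight e), Nat.zero_le (b * p.weight e)]
  | loop x b p ih =>
    obtain ⟨a, ha⟩ := ih
    refine ⟨a + 8, fun e => ?_⟩
    simp only [Stmt.cost, Stmt.weight]
    have h1 := one_le_weight e p
    calc e.par b * (p.cost e + 8) + 6
        ≤ e.par b * (a * p.weight e + 8 * p.weight e) + 8 * p.weight e := by
          gcongr
          · exact ha e
          · omega
          · omega
      _ ≤ (a + 8) * ((e.par b + 1) * p.weight e) := by
          nlinarith [Nat.zero_le (a * p.weight e)]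

section Weights

open Stmt

variable {e : Env} {N : ℕ}

/-- The quadratic term comes from the loop over the components, with linear time for the word and
the trie; reading the digits is linear because the number `t + 1` of digits is at most `n + 1`. -/
theorem weight_codeStep_le (hN : 1 ≤ N) (h2 : e.par 2 + 1 = N) (h6 : e.par 6 = N)
    (h7 : e.par 7 ≤ N) : codeStep.weight e ≤ 26 * N ^ 2 := by
  simp only [codeStep, decode, clearDigits, markDigits, countChosen, countLoop, addComponents,
    componentWord, findNode, followWord, recordValue, blockWord, weight, h2, h6]
  nlinarith [Nat.mul_le_mul hN hN]

theorem weight_vertexStep_le {Q : ℕ} (hN : 1 ≤ N) (hQ : 1 ≤ Q) (h2 : e.par 2 + 1 = N)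
    (h6 : e.par 6 = N) (h7 : e.par 7 ≤ N) (h4 : e.par 4 = Q) :
    vertexStep.weight e ≤ 56 * (Q * N ^ 2) := by
  have h := weight_codeStep_le hN h2 h6 h7
  simp only [vertexStep, computeGate, computeBlock, checkBlock, codeLoop, weight, h2, h4]
  have h1 : (Q + 1) * codeStep.weight e ≤ (2 * Q) * (26 * N ^ 2) := Nat.mul_le_mul (by omega) h
  have h3 : N ≤ Q * N ^ 2 := by nlinarith [Nat.mul_le_mul hQ (Nat.mul_le_mul hN (le_refl N))]
  have h5 : N ^ 2 ≤ Q * N ^ 2 := Nat.le_mul_of_pos_left _ hQ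
  nlinarith

/-- Closing the connection matrix takes cubic time, but only once per clique, so the loop over
selections and codes dominates it. -/
theorem weight_cliqueStep_le {Q : ℕ} (hN : 1 ≤ N) (hQ : 1 ≤ Q) (h2 : e.par 2 + 1 = N)
    (h6 : e.par 6 = N) (h7 : e.par 7 ≤ N) (h4 : e.par 4 = Q) :
    cliqueStep.weight e ≤ 120 * (Q * N ^ 3) := by
  have h := weight_vertexStep_le hN hQ h2 h6 h7 h4
  simp only [cliqueStep, initMatrix, initRow, closeMatrix, closeAt, closeRow, computeReps, checkRep,
    vertexLoop, weight, h2, h6]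
  have h1 : (N + 1) * vertexStep.weight e ≤ (2 * N) * (56 * (Q * N ^ 2)) :=
    Nat.mul_le_mul (by omega) h
  have h3 : N ^ 3 ≤ Q * N ^ 3 := Nat.le_mul_of_pos_left _ hQ
  have h5 : N ^ 2 ≤ N ^ 3 := Nat.pow_le_pow_right hN (by norm_num)
  have h8 : N ≤ N ^ 3 := Nat.le_self_pow (by norm_num) N
  have h9 : (2 * N) * (56 * (Q * N ^ 2)) = 112 * (Q * N ^ 3) := by ring
  have h10 : N * (N * 1) + (N * (1 + N * (N * (1 + 1))) + (N * (1 + N * (1 + 1)) +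
      (N + 1) * vertexStep.weight e)) =
      2 * N + 3 * N ^ 2 + 2 * N ^ 3 + (N + 1) * vertexStep.weight e := by ring
  rw [h10]
  omega

theorem weight_mainProgram_le {Q p R : ℕ} (hN : 1 ≤ N) (hQ : 1 ≤ Q) (hp : 1 ≤ p) (hR : 1 ≤ R)
    (h2 : e.par 2 + 1 = N) (h6 : e.par 6 = N) (h7 : e.par 7 ≤ N) (h4 : e.par 4 = Q)
    (h3 : e.par 3 = p) (h5 : e.par 5 = R) :
    mainProgram.weight e ≤ 500 * (R * p * Q * N ^ 3) := by
  have h := weight_cliqueStep_le hN hQ h2 h6 h7 h4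
  simp only [mainProgram, rounds, cliqueLoop, rootWord, findNode, followWord, weight, h2, h3, h5]
  have h1 : (R + 1) * ((p + 1) * cliqueStep.weight e) ≤ (2 * R) * ((2 * p) * (120 * (Q * N ^ 3))) :=
    Nat.mul_le_mul (by omega) (Nat.mul_le_mul (by omega) h)
  have h8 : N ≤ N ^ 3 := Nat.le_self_pow (by norm_num) N
  have h9 : N ^ 3 ≤ R * p * Q * N ^ 3 :=
    Nat.le_mul_of_pos_left _ (Nat.mul_pos (Nat.mul_pos hR hp) hQ)
  have h10 : (2 * R) * ((2 * p) * (120 * (Q * N ^ 3))) = 480 * (R * p * Q * N ^ 3) := by ring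
  omega

end Weights

/-- For `t ≤ n` the ratio `(1 + 1/n) ^ t` is at most `e < 4`; the four remaining factors contribute
at most `2 ^ 4`. -/
theorem succ_pow_le {n t : ℕ} (hn : 0 < n) (ht : t ≤ n) : (n + 1) ^ (t + 4) ≤ 64 * n ^ (t + 4) := by
  have h1 : (n + 1) ^ n ≤ 4 * n ^ n := by
    have hn' : (0 : ℝ) < n := by exact_mod_cast hn
    have h2 : ((n : ℝ) + 1) ≤ n * Real.exp (1 / n) := by
      have := Real.add_one_le_exp (1 / (n : ℝ))
      calc (n : ℝ) + 1 = n * (1 / n + 1) := by field_simp; ring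
        _ ≤ _ := mul_le_mul_of_nonneg_left this hn'.le
    have h3 : ((n : ℝ) + 1) ^ n ≤ 4 * n ^ n := by
      calc ((n : ℝ) + 1) ^ n ≤ (n * Real.exp (1 / n)) ^ n := by gcongr
        _ = n ^ n * Real.exp 1 := by
          rw [mul_pow, ← Real.exp_nat_mul, mul_one_div_cancel hn'.ne']
        _ ≤ n ^ n * 4 := by
          gcongr
          have := Real.exp_one_lt_d9
          linarith
        _ = _ := by ring
    exact_mod_cast h3
  have h2 : (n + 1) ^ t ≤ 4 * n ^ t := by
    refine Nat.le_of_mul_le_mul_right ?_ (Nat.pow_pos hn : 0 < n ^ (n - t))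
    calc (n + 1) ^ t * n ^ (n - t) ≤ (n + 1) ^ t * (n + 1) ^ (n - t) := by gcongr; omega
      _ = (n + 1) ^ n := by rw [← pow_add]; congr 1; omega
      _ ≤ 4 * n ^ n := h1
      _ = 4 * n ^ t * n ^ (n - t) := by rw [mul_assoc, ← pow_add]; congr 2; omega
  have h3 : (n + 1) ^ 4 ≤ 16 * n ^ 4 := by
    calc (n + 1) ^ 4 ≤ (2 * n) ^ 4 := by gcongr; omega
      _ = _ := by ring
  calc (n + 1) ^ (t + 4) = (n + 1) ^ t * (n + 1) ^ 4 := pow_add ..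
    _ ≤ (4 * n ^ t) * (16 * n ^ 4) := Nat.mul_le_mul h2 h3
    _ = _ := by ring

end ArrayLang

namespace ArrayLang

open WordRAM SimpleGraph

/-! ### The input -/

theorem length_flatMap_const {α : Type} {f : α → List ℕ} {n : ℕ} (hf : ∀ a, (f a).length = n)
    (L : List α) : (L.flatMap f).length = L.length * n := by
  induction L with
  | nil => simp
  | cons a L ih => rw [List.flatMap_cons, List.length_append, hf, ih, List.length_cons]; ring

theorem getD_flatMap {α : Type} {f : α → List ℕ} {n : ℕ} (hf : ∀ a, (f a).length = n)
    (L : List α) {i x : ℕ} (hi : i < L.length) (hx : x < n) :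
    (L.flatMap f).getD (i * n + x) 0 = (f L[i]).getD x 0 := by
  induction L generalizing i with
  | nil => simp at hi
  | cons a L ih =>
    rw [List.flatMap_cons]
    cases i with
    | zero =>
      rw [Nat.zero_mul, Nat.zero_add, List.getD_append _ _ _ _ (by rw [hf]; exact hx)]
      rfl
    | succ i =>
      rw [List.getD_append_right _ _ _ _ (by rw [hf, Nat.succ_mul]; omega), hf,
        show (i + 1) * n + x - n = i * n + x by rw [Nat.succ_mul]; omega,
        ih (by simpa using hi)]
      rfl

section Instance

variable {n : ℕ}

theorem length_vertexSetWords (K : Finset (Fin n)) : (vertexSetWords K).length = n := by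
  simp [vertexSetWords]

theorem getD_vertexSetWords (K : Finset (Fin n)) (x : Fin n) :
    (vertexSetWords K).getD x 0 = ind (x ∈ K) := by
  simp [vertexSetWords, ← ite_eq_ind]

theorem length_graphWords (G : SimpleGraph (Fin n)) : (graphWords G).length = n * n := by
  rw [graphWords, length_flatMap_const (n := n) (by simp), List.length_finRange]

theorem getD_graphWords (G : SimpleGraph (Fin n)) (u x : Fin n) :
    (graphWords G).getD (u * n + x) 0 = ind (G.Adj u x) := by
  rw [graphWords, getD_flatMap (n := n) (by simp) _ (by simp) x.2]
  simp [ite_eq_ind]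

variable (G : SimpleGraph (Fin n)) (cliques seps : List (Finset (Fin n))) (t l : ℕ)

theorem length_instanceWords : (instanceWords G cliques seps t l).length =
    5 + n * n + (cliques.length + seps.length) * n := by
  simp only [instanceWords, List.length_append, length_graphWords, List.length_cons,
    List.length_nil, length_flatMap_const length_vertexSetWords]
  ring

theorem getD_instanceWords_adj (u x : Fin n) :
    (instanceWords G cliques seps t l).getD (5 + u * n + x) 0 = ind (G.Adj u x) := by
  have hux : (u : ℕ) * n + x < n * n := by
    have : ((u : ℕ) + 1) * n ≤ n * n := Nat.mul_le_mul_right n u.2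
    rw [Nat.succ_mul] at this
    omega
  rw [instanceWords, List.getD_append, List.getD_append, List.getD_append_right, Nat.add_assoc]
  · exact (congrArg (fun a => (graphWords G).getD a 0) (Nat.add_sub_cancel_left 5 _)).trans
      (getD_graphWords G u x)
  · simp only [List.length_cons, List.length_nil]; omega
  · simp only [List.length_append, length_graphWords, List.length_cons, List.length_nil]; omega
  · simp only [List.length_append, length_graphWords, List.length_cons, List.length_nil]; omega

theorem getD_instanceWords_clique {i : ℕ} (hi : i < cliques.length) (x : Fin n) :
    (instanceWords G cliques seps t l).getD (5 + n * n + i * n + x) 0 =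
      ind (x ∈ cliques[i]) := by
  have hix : i * n + x < cliques.length * n := by
    have : (i + 1) * n ≤ cliques.length * n := Nat.mul_le_mul_right n hi
    rw [Nat.succ_mul] at this
    omega
  have hlen : ([n, t, l, cliques.length, seps.length] ++ graphWords G).length = 5 + n * n := by
    simp only [List.length_append, length_graphWords, List.length_cons, List.length_nil]
  rw [instanceWords, List.getD_append, List.getD_append_right, hlen, Nat.add_assoc,
    Nat.add_sub_cancel_left, getD_flatMap length_vertexSetWords _ hi x.2, getD_vertexSetWords]
  · rw [hlen]; omega
  · rw [List.length_append, hlen, length_flatMap_const length_vertexSetWords]; omega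

theorem mem_instanceWords {a : ℕ} (ha : a ∈ instanceWords G cliques seps t l) :
    a ≤ 1 ∨ a = n ∨ a = t ∨ a = l ∨ a = cliques.length ∨ a = seps.length := by
  have hset : ∀ K : Finset (Fin n), ∀ b ∈ vertexSetWords K, b ≤ 1 := by
    intro K b hb
    obtain ⟨x, -, rfl⟩ := List.mem_map.1 hb
    split <;> omega
  simp only [instanceWords, List.mem_append, List.mem_cons, List.not_mem_nil, or_false] at ha
  rcases ha with ((h | h) | h) | h
  · tauto
  · obtain ⟨u, -, h⟩ := List.mem_flatMap.1 h
    obtain ⟨x, -, rfl⟩ := List.mem_map.1 h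
    left
    split <;> omega
  · obtain ⟨K, -, h⟩ := List.mem_flatMap.1 h
    exact .inl (hset K a h)
  · obtain ⟨K, -, h⟩ := List.mem_flatMap.1 h
    exact .inl (hset K a h)

theorem getD_instanceWords_le {K : ℕ} (h1 : 1 ≤ K) (hn : n ≤ K) (ht : t ≤ K) (hl : l ≤ K)
    (hp : cliques.length ≤ K) (hq : seps.length ≤ K) (a : ℕ) :
    (instanceWords G cliques seps t l).getD a 0 ≤ K := by
  rcases Nat.lt_or_ge a (instanceWords G cliques seps t l).length with ha | ha
  · rw [List.getD_eq_getElem _ _ ha]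
    have := mem_instanceWords G cliques seps t l (List.getElem_mem ha)
    omega
  · rw [List.getD_eq_default _ _ ha]
    exact Nat.zero_le _

theorem sum_range_mul (f : ℕ → ℕ) (k n : ℕ) :
    ∑ j ∈ Finset.range (k * n), f j =
      ∑ u ∈ Finset.range k, ∑ x ∈ Finset.range n, f (u * n + x) := by
  induction k with
  | zero => simp
  | succ k ih => rw [Nat.succ_mul, Finset.sum_range_add, ih, Finset.sum_range_succ]

/-- By the handshake identity, the machine learns the number of edges by adding up the adjacency
matrix. -/
theorem sum_instanceWords_adj :
    ∑ j ∈ Finset.range (n * n), (instanceWords G cliques seps t l).getD (5 + j) 0 =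
      2 * G.edgeSet.ncard := by
  classical
  rw [sum_range_mul, Finset.sum_range]
  calc _ = ∑ u : Fin n, G.degree u := by
        refine Finset.sum_congr rfl fun u _ => ?_
        rw [Finset.sum_range, ← G.card_neighborFinset_eq_degree, Finset.card_eq_sum_ones,
          neighborFinset_eq_filter, Finset.sum_filter]
        refine Finset.sum_congr rfl fun x _ => ?_
        rw [← Nat.add_assoc, getD_instanceWords_adj, ite_eq_ind]
    _ = _ := by
        rw [G.sum_degrees_eq_twice_card_edges, ← Set.ncard_coe_finset G.edgeFinset,
          coe_edgeFinset]

end Instance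

/-! ### Initialization -/

/-- The registers with the given contents. -/
def regs (l : List ℕ) (i : ℕ) : ℕ := l.getD i 0

theorem update_regs {l : List ℕ} {x : ℕ} (hx : x < l.length) (v : ℕ) :
    Function.update (regs l) x v = regs (l.set x v) := by
  funext i
  rw [Function.update_apply, regs, regs]
  split
  · rename_i h
    subst h
    simp [hx]
  · rename_i h
    simp [List.getD_eq_getElem?_getD, Ne.symm h]

theorem rawBounded_regs {K : ℕ} {l : List ℕ} {m : ℕ → ℕ} (hl : ∀ v ∈ l, v ≤ K)
    (hm : ∀ a, m a ≤ K) : RawBounded K ⟨regs l, m⟩ := by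
  refine ⟨fun r => ?_, hm⟩
  simp only [regs]
  rcases Nat.lt_or_ge r l.length with hr | hr
  · rw [List.getD_eq_getElem _ _ hr]
    exact hl _ (List.getElem_mem hr)
  · rw [List.getD_eq_default _ _ hr]
    exact Nat.zero_le _

theorem runs_assign {M K d : ℕ} {l : List ℕ} {m : ℕ → ℕ} (hK : 2 ≤ K) (hl : ∀ v ∈ l, v ≤ K)
    (hm : ∀ a, m a ≤ K) (hM : K ^ d < M) {x v : ℕ} {a : Expr} (ha : exprDegree a ≤ d)
    (hx : x < l.length) (hv : a.eval ⟨regs l, m⟩ = v) :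
    Runs M (.assign x a) ⟨regs l, m⟩ (a.cost + 1) ⟨regs (l.set x v), m⟩ := by
  have hb := rawBounded_regs hl hm
  have := Runs.assign (M := M) ⟨regs l, m⟩ x a (fits_of_degree hK hb a ha hM)
  rw [hv] at this
  simp only [update_regs hx] at this
  exact this

theorem runs_while {M : ℕ} {a : Expr} {p : Prog} (st : ℕ → State) (B C : ℕ)
    (hfit : ∀ j ≤ B, a.Fits M (st j)) (hlt : ∀ j < B, a.eval (st j) ≠ 0) (hB : a.eval (st B) = 0)
    (hstep : ∀ j < B, Runs M p (st j) C (st (j + 1))) :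
    ∃ T ≤ B * (a.cost + 1 + C) + (a.cost + 1), Runs M (.while a p) (st 0) T (st B) := by
  have key : ∀ r j, j + r = B →
      ∃ T ≤ r * (a.cost + 1 + C) + (a.cost + 1), Runs M (.while a p) (st j) T (st B) := by
    intro r
    induction r with
    | zero =>
      intro j hj
      obtain rfl : j = B := by omega
      exact ⟨_, by omega, .while_false (hfit _ le_rfl) hB⟩
    | succ r ih =>
      intro j hj
      obtain ⟨T, hT, hw⟩ := ih (j + 1) (by omega)
      refine ⟨_, ?_, .while_true (hfit j (by omega)) (hlt j (by omega)) (hstep j (by omega)) hw⟩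
      rw [Nat.succ_mul]
      omega
  exact key B 0 (by omega)

end ArrayLang

namespace ArrayLang

open WordRAM SimpleGraph

/-- Compute a power in register `8`. -/
def powerLoop : Prog :=
  .while (.op .lt (.reg 1) (.reg 14))
    (.seq (.assign 8 (.op .mul (.reg 8) (.reg 12))) (.assign 1 (.op .add (.reg 1) (.const 1))))

/-- Add the entries of the adjacency matrix to register `10`. -/
def sumLoop : Prog :=
  .while (.op .lt (.reg 1) (.op .mul (.reg 4) (.reg 4)))
    (.seq (.assign 10 (.op .add (.reg 10) (.load (.op .add (.const 5) (.reg 1)))))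
      (.assign 1 (.op .add (.reg 1) (.const 1))))

/-- Compute the parameters that are found in the input. -/
def readInput : Prog :=
  .seq (.assign 4 (.load (.const 0)))
  (.seq (.assign 6 (.load (.const 3)))
  (.seq (.assign 12 (.op .add (.reg 4) (.const 1)))
  (.seq (.assign 14 (.op .add (.load (.const 1)) (.const 1)))
  (.seq (.assign 16 (.load (.const 2)))
  (.seq (.assign 2 (.op .add (.op .add (.const 5) (.op .mul (.reg 4) (.reg 4)))
    (.op .mul (.op .add (.reg 6) (.load (.const 4))) (.reg 4))))
  (.assign 8 (.const 1)))))))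

/-- Compute all parameters. -/
def setup : Prog :=
  .seq readInput (.seq powerLoop
  (.seq (.assign 1 (.const 0)) (.seq (.assign 10 (.const 2)) (.seq sumLoop
  (.seq (.assign 1 (.const 0))
  (.assign 0 (.op .mul (.const 8) (.op .mul (.reg 10) (.op .mul
    (.op .add (.reg 6) (.load (.const 4))) (.op .mul (.reg 8)
      (.op .mul (.reg 12) (.op .mul (.reg 12) (.reg 12)))))))))))))

section Setup

variable {M K d n t l p q L Q R : ℕ} {m : ℕ → ℕ}

theorem runs_readInput (hK : 2 ≤ K) (hm : ∀ a, m a ≤ K) (hM : K ^ progDegree setup < M)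
    (h0 : m 0 = n) (h1 : m 1 = t) (h2 : m 2 = l) (h3 : m 3 = p) (h4 : m 4 = q)
    (hn : n + 1 ≤ K) (ht : t + 1 ≤ K) (hL : 5 + n * n + (p + q) * n ≤ K) :
    ∃ T ≤ 100, Runs M readInput ⟨regs [0, 0, 0, 0, 0, 0, 0, 0, 0, 0, 0, 0, 0, 0, 0, 0, 0], m⟩ T
      ⟨regs [0, 0, 5 + n * n + (p + q) * n, 0, n, 0, p, 0, 1, 0, 0, 0, n + 1, 0, t + 1, 0, l], m⟩ := by
  have hl := hm 2
  have hp := hm 3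
  rw [h2] at hl
  rw [h3] at hp
  refine ⟨_, ?_, (runs_assign hK (by simp) hm hM (v := n) (by decide) (by simp) (by exact h0)).seq
    ((runs_assign hK (by simp; omega) hm hM (v := p) (by decide) (by simp) (by exact h3)).seq
    ((runs_assign hK (by simp; omega) hm hM (v := n + 1) (by decide) (by simp) rfl).seq
    ((runs_assign hK (by simp; omega) hm hM (v := t + 1) (by decide) (by simp)
      (by rw [← h1]; rfl)).seq
    ((runs_assign hK (by simp; omega) hm hM (v := l) (by decide) (by simp) (by exact h2)).seq
    ((runs_assign hK (by simp; omega) hm hM (v := 5 + n * n + (p + q) * n) (by decide) (by simp)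
      (by rw [← h4]; rfl)).seq
    (runs_assign hK (by simp; omega) hm hM (v := 1) (by decide) (by simp) rfl))))))⟩
  simp [Expr.cost]

theorem runs_powerLoop (hK : 2 ≤ K) (hm : ∀ a, m a ≤ K) (hM : K ^ progDegree setup < M)
    (hn : n + 1 ≤ K) (ht : t + 1 ≤ K) (hL : L ≤ K) (hl : l ≤ K) (hp : p ≤ K)
    (hQ : (n + 1) ^ (t + 1) ≤ K) :
    ∃ T ≤ (t + 1) * 12 + 4,
      Runs M powerLoop ⟨regs [0, 0, L, 0, n, 0, p, 0, 1, 0, 0, 0, n + 1, 0, t + 1, 0, l], m⟩ T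
        ⟨regs [0, t + 1, L, 0, n, 0, p, 0, (n + 1) ^ (t + 1), 0, 0, 0, n + 1, 0, t + 1, 0, l], m⟩ := by
  have hpow : ∀ j ≤ t + 1, (n + 1) ^ j ≤ K := fun j hj =>
    (Nat.pow_le_pow_right (by omega) hj).trans hQ
  have := runs_while (M := M) (a := .op .lt (.reg 1) (.reg 14))
    (p := .seq (.assign 8 (.op .mul (.reg 8) (.reg 12))) (.assign 1 (.op .add (.reg 1) (.const 1))))
    (fun j => ⟨regs [0, j, L, 0, n, 0, p, 0, (n + 1) ^ j, 0, 0, 0, n + 1, 0, t + 1, 0, l], m⟩)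
    (t + 1) 8 (fun j hj => ?_) (fun j hj => ?_) ?_ (fun j hj => ?_)
  · simpa only [Expr.cost, powerLoop, pow_zero] using this
  · have := hpow j hj
    exact fits_of_degree hK (rawBounded_regs (by simp; omega) hm) _ (by decide) hM
  · simp [Expr.eval, BinOp.eval, regs, hj]
  · simp [Expr.eval, BinOp.eval, regs]
  · have h1 := hpow j hj.le
    have h2 := hpow (j + 1) hj
    exact (runs_assign hK (by simp; omega) hm hM (v := (n + 1) ^ (j + 1)) (by decide) (by simp)
      (pow_succ _ _).symm).seq
      (runs_assign hK (by simp; omega) hm hM (v := j + 1) (by decide) (by simp) rfl)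

theorem runs_sumLoop (hK : 2 ≤ K) (hm : ∀ a, m a ≤ K) (hM : K ^ progDegree setup < M)
    (hn : n + 1 ≤ K) (ht : t + 1 ≤ K) (hL : L ≤ K) (hl : l ≤ K) (hp : p ≤ K) (hQ : Q ≤ K)
    (hnn : n * n ≤ K) (hR : 2 + ∑ j ∈ Finset.range (n * n), m (5 + j) ≤ K) :
    ∃ T ≤ (n * n) * 17 + 6,
      Runs M sumLoop ⟨regs [0, 0, L, 0, n, 0, p, 0, Q, 0, 2, 0, n + 1, 0, t + 1, 0, l], m⟩ T
        ⟨regs [0, n * n, L, 0, n, 0, p, 0, Q, 0, 2 + ∑ j ∈ Finset.range (n * n), m (5 + j), 0, n + 1,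
          0, t + 1, 0, l], m⟩ := by
  have hsum : ∀ j ≤ n * n, 2 + ∑ i ∈ Finset.range j, m (5 + i) ≤ K := fun j hj =>
    (Nat.add_le_add_left (Finset.sum_le_sum_of_subset
      (Finset.range_subset_range.2 hj)) 2).trans hR
  have := runs_while (M := M) (a := .op .lt (.reg 1) (.op .mul (.reg 4) (.reg 4)))
    (p := .seq (.assign 10 (.op .add (.reg 10) (.load (.op .add (.const 5) (.reg 1)))))
      (.assign 1 (.op .add (.reg 1) (.const 1))))
    (fun j => ⟨regs [0, j, L, 0, n, 0, p, 0, Q, 0, 2 + ∑ i ∈ Finset.range j, m (5 + i), 0, n + 1,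
      0, t + 1, 0, l], m⟩) (n * n) 11 (fun j hj => ?_) (fun j hj => ?_) ?_ (fun j hj => ?_)
  · simpa [Expr.cost, sumLoop] using this
  · have := hsum j hj
    exact fits_of_degree hK (rawBounded_regs (by simp; omega) hm) _ (by decide) hM
  · simp [Expr.eval, BinOp.eval, regs, hj]
  · simp [Expr.eval, BinOp.eval, regs]
  · have h1 := hsum j hj.le
    have h2 := hsum (j + 1) hj
    exact (runs_assign hK (by simp; omega) hm hM
      (v := 2 + ∑ i ∈ Finset.range (j + 1), m (5 + i)) (by decide) (by simp)
      (by rw [Finset.sum_range_succ, ← Nat.add_assoc]; rfl)).seq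
      (runs_assign hK (by simp; omega) hm hM (v := j + 1) (by decide) (by simp) rfl)

/-- Register `2 * i` receives the parameter `i`. Register `1` is only a counter and is cleared at
the end. The summation of the matrix starts at `2`, so it yields the number `2m + 2` of rounds. -/
theorem runs_setup (hK : 2 ≤ K) (hm : ∀ a, m a ≤ K) (hM : K ^ progDegree setup < M)
    (h0 : m 0 = n) (h1 : m 1 = t) (h2 : m 2 = l) (h3 : m 3 = p) (h4 : m 4 = q)
    (hn : n + 1 ≤ K) (ht : t + 1 ≤ K) (hL : 5 + n * n + (p + q) * n = L) (hLK : L ≤ K)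
    (hQ : (n + 1) ^ (t + 1) = Q) (hQK : Q ≤ K)
    (hR : 2 + ∑ j ∈ Finset.range (n * n), m (5 + j) = R) (hRK : R ≤ K)
    (hdef : 8 * (R * ((p + q) * (Q * ((n + 1) * ((n + 1) * (n + 1)))))) = K) :
    ∃ T ≤ (t + 1) * 12 + (n * n) * 17 + 200,
      Runs M setup ⟨regs [0, 0, 0, 0, 0, 0, 0, 0, 0, 0, 0, 0, 0, 0, 0, 0, 0], m⟩ T
        ⟨regs [K, 0, L, 0, n, 0, p, 0, Q, 0, R, 0, n + 1, 0, t + 1, 0, l], m⟩ := by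
  have hl := hm 2
  have hp := hm 3
  rw [h2] at hl
  rw [h3] at hp
  have hnn : n * n ≤ K := by omega
  obtain ⟨T₁, hT₁, r₁⟩ := runs_readInput hK hm hM h0 h1 h2 h3 h4 hn ht (by omega)
  rw [hL] at r₁
  obtain ⟨T₂, hT₂, r₂⟩ := runs_powerLoop (m := m) hK hm hM hn ht hLK hl hp (by omega)
  rw [hQ] at r₂
  obtain ⟨T₃, hT₃, r₃⟩ := runs_sumLoop hK hm hM hn ht hLK hl hp hQK hnn (by omega)
  rw [hR] at r₃
  refine ⟨_, ?_, r₁.seq (r₂.seq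
    ((runs_assign hK (by simp; omega) hm hM (v := 0) (by decide) (by simp) rfl).seq
    ((runs_assign hK (by simp; omega) hm hM (v := 2) (by decide) (by simp) rfl).seq
    (r₃.seq
    ((runs_assign hK (by simp; omega) hm hM (v := 0) (by decide) (by simp) rfl).seq
    (runs_assign hK (by simp; omega) hm hM (v := K) (by decide) (by simp)
      (by rw [← hdef, ← h4]; rfl)))))))⟩
  simp only [Expr.cost]
  omega

end Setup

end ArrayLang

/-! ### The complete program, its word bound and its running time -/

namespace ArrayLang

open WordRAM SimpleGraph

/-- Every machine state represents a state. -/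
theorem raw_eq (s : State) :
    (⟨fun i => s.reg (2 * i), s.mem⟩ : Env).raw
      ⟨fun x => s.reg (2 * x + 1), fun k a => s.mem (s.reg 2 + (8 * a + k))⟩ = s := by
  have hreg : (fun r => if r % 2 = 0 then s.reg (2 * (r / 2)) else s.reg (2 * (r / 2) + 1)) =
      s.reg := by
    funext r
    split
    · congr 1; omega
    · congr 1; omega
  have hmem : (fun a => if a < s.reg 2 then s.mem a
      else s.mem (s.reg 2 + (8 * ((a - s.reg 2) / 8) + (a - s.reg 2) % 8))) = s.mem := by
    funext a
    split
    · rfl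
    · congr 1; omega
  cases s
  exact congrArg₂ State.mk hreg hmem

theorem _root_.Enumerates.ncard_eq {α : Type} {L : List α} {A : Set α} (h : Enumerates L A) :
    A.ncard = L.length := by
  classical
  have : A = ↑L.toFinset := by
    ext a
    simp [h.2 a]
  rw [this, Set.ncard_coe_finset, List.toFinset_card_of_nodup h.1]

/-- The time bound is therefore positive also for complete graphs, which have no minimal separators.
-/
theorem potentialMaximalCliques_nonempty {n : ℕ} (G : SimpleGraph (Fin n)) :
    G.potentialMaximalCliques.Nonempty := by
  obtain ⟨H, hH, -⟩ := exists_isMinimalTriangulation_card_le G ∅ _ le_rfl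
  obtain ⟨Ω, -, hΩ⟩ := exists_maximal_isClique (H := H) (K := ∅) (by simp)
  exact ⟨Ω, H, hH, hΩ⟩

/-- Compare the computed maximum with the required number of vertices. -/
def output : Prog :=
  .assign 0 (.op .sub (.const 1) (.op .lt (.load (AExpr.address 7 (.reg 19))) (.reg 16)))

/-- The whole program. -/
def fullProgram : Prog := .seq setup (.seq Stmt.mainProgram.compile output)

/-- The word bound of the computation. -/
def wordBound (n t p q R : ℕ) : ℕ :=
  8 * (R * ((p + q) * ((n + 1) ^ (t + 1) * ((n + 1) * ((n + 1) * (n + 1))))))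

/-- The factor `16` uses `2 ≤ R`, and a fourth factor `n + 1` is taken from the codes. The first
estimate is large enough for the length of the input, the other two cover the numbers of rounds and
of codes. -/
theorem wordBound_large {n t p q R : ℕ} (hP : 1 ≤ p + q) (hR : 2 ≤ R) :
    16 * ((p + q) * ((n + 1) * ((n + 1) * ((n + 1) * (n + 1))))) ≤ wordBound n t p q R ∧
      8 * R ≤ wordBound n t p q R ∧ 8 * (n + 1) ^ (t + 1) ≤ wordBound n t p q R := by
  have hQ : n + 1 ≤ (n + 1) ^ (t + 1) := Nat.le_self_pow (by omega) _
  have hN : 1 ≤ (n + 1) * ((n + 1) * (n + 1)) := Nat.succ_le_of_lt (by positivity)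
  unfold wordBound
  refine ⟨?_, ?_, ?_⟩
  · calc 16 * ((p + q) * ((n + 1) * ((n + 1) * ((n + 1) * (n + 1)))))
        = 8 * (2 * ((p + q) * ((n + 1) * ((n + 1) * ((n + 1) * (n + 1)))))) := by ring
      _ ≤ _ := by gcongr
  · exact Nat.mul_le_mul_left 8 (Nat.le_mul_of_pos_right _ (by positivity))
  · refine Nat.mul_le_mul_left 8 ?_
    calc (n + 1) ^ (t + 1) = 1 * (1 * ((n + 1) ^ (t + 1) * 1)) := by ring
      _ ≤ _ := by gcongr; omega

/-- The word bound also measures the running time, and here it is compared with the required order;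
`2048 = 8 * 4 * 64`. -/
theorem wordBound_le {n t p q m : ℕ} (hn : 0 < n) (ht : t ≤ n) :
    wordBound n t p q (2 + 2 * m) ≤ 2048 * (n ^ (t + 4) * max m 1 * (p + q)) := by
  have h1 : 2 + 2 * m ≤ 4 * max m 1 := by omega
  have h2 := succ_pow_le hn ht
  calc wordBound n t p q (2 + 2 * m)
      = 8 * ((2 + 2 * m) * ((p + q) * (n + 1) ^ (t + 4))) := by unfold wordBound; ring
    _ ≤ 8 * ((4 * max m 1) * ((p + q) * (64 * n ^ (t + 4)))) := by gcongr
    _ = _ := by ring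

section Final

variable {n t l : ℕ} {G : SimpleGraph (Fin n)} {cliques seps : List (Finset (Fin n))}

/-- The contents of the registers when the dynamic program starts. -/
def startRegs (n t l p q R : ℕ) : List ℕ :=
  [wordBound n t p q R, 0, 5 + n * n + (p + q) * n, 0, n, 0, p, 0, (n + 1) ^ (t + 1), 0, R, 0,
    n + 1, 0, t + 1, 0, l]

theorem startRegs_odd (n t l p q R x : ℕ) : regs (startRegs n t l p q R) (2 * x + 1) = 0 := by
  by_cases hx : x < 8
  · interval_cases x <;> rfl
  · exact List.getD_eq_default _ _ (by simp [startRegs]; omega)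

theorem startRegs_le {p q R : ℕ} (hP : 1 ≤ p + q) (hR : 2 ≤ R) (ht : t ≤ n) (hl : l ≤ n) :
    ∀ v ∈ startRegs n t l p q R, v ≤ wordBound n t p q R := by
  obtain ⟨h1, h2, h3⟩ := wordBound_large (n := n) (t := t) hP hR
  set N := n + 1 with hN
  have hN1 : 1 ≤ N := by omega
  have h4 : N ≤ N * (N * (N * N)) := Nat.le_mul_of_pos_right _ (by positivity)
  have h5 : N * N ≤ N * (N * (N * N)) :=
    Nat.mul_le_mul_left N (Nat.le_mul_of_pos_right _ (by positivity))
  have h6 : N * (N * (N * N)) ≤ (p + q) * (N * (N * (N * N))) := Nat.le_mul_of_pos_left _ hP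
  have h7 : (p + q) * N ≤ (p + q) * (N * (N * (N * N))) := Nat.mul_le_mul_left _ h4
  have h8 : n * n ≤ N * N := Nat.mul_le_mul (by omega) (by omega)
  have h9 : (p + q) * n ≤ (p + q) * N := Nat.mul_le_mul_left _ (by omega)
  have h10 : p + q ≤ (p + q) * N := Nat.le_mul_of_pos_right _ hN1
  simp only [startRegs, List.forall_mem_cons, List.not_mem_nil, IsEmpty.forall_iff,
    implies_true, and_true, ← hN]
  omega

/-- The compiled dynamic program costs at most `500 * a` times the word bound; the remaining `300`
times the word bound pay for the initialization and the output. -/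
theorem exists_run (hn : 0 < n) (ht : t ≤ n) (hl : l ≤ n)
    (hcl : Enumerates cliques G.potentialMaximalCliques) {a M : ℕ}
    (ha : ∀ e, Stmt.mainProgram.cost e ≤ a * Stmt.mainProgram.weight e)
    (hM : wordBound n t cliques.length seps.length (2 + 2 * G.edgeSet.ncard) ^
      progDegree fullProgram < M) :
    ∃ T ≤ (500 * a + 300) *
        wordBound n t cliques.length seps.length (2 + 2 * G.edgeSet.ncard), ∃ s,
      Runs M fullProgram (initState (instanceWords G cliques seps t l)) T s ∧
      ((∃ U : Finset (Fin n), U.card = l ∧ (G.induce (U : Set (Fin n))).treewidth ≤ t) →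
        s.reg 0 = 1) ∧
      ((¬ ∃ U : Finset (Fin n), U.card = l ∧ (G.induce (U : Set (Fin n))).treewidth ≤ t) →
        s.reg 0 = 0) := by
  set p := cliques.length with hp
  set q := seps.length with hq
  set R := 2 + 2 * G.edgeSet.ncard with hR
  set K := wordBound n t p q R with hK
  set m : ℕ → ℕ := fun a => (instanceWords G cliques seps t l).getD a 0 with hm
  have hp1 : 1 ≤ p := by
    obtain ⟨Ω, hΩ⟩ := potentialMaximalCliques_nonempty G
    exact List.length_pos_of_mem ((hcl.2 Ω).2 hΩ)
  have hle := startRegs_le (n := n) (t := t) (l := l) (p := p) (q := q) (R := R) (by omega)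
    (by omega) ht hl
  obtain ⟨h16, h8R, h8Q⟩ := wordBound_large (n := n) (t := t) (p := p) (q := q) (R := R) (by omega)
    (by omega)
  rw [← hK] at hle h16 h8R h8Q
  have hLK : 5 + n * n + (p + q) * n ≤ K := hle _ (by simp [startRegs])
  have hNK : n + 1 ≤ K := hle _ (by simp [startRegs])
  have hpq : p + q ≤ K := (Nat.le_mul_of_pos_right (p + q) hn).trans (by omega)
  have hK2 : 2 ≤ K := by omega
  have hmK : ∀ a, m a ≤ K := getD_instanceWords_le G cliques seps t l (by omega) (by omega)
    (by omega) (by omega) (by omega) (by omega)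
  have hpow : ∀ {d}, d ≤ progDegree fullProgram → K ^ d < M := fun hd =>
    (Nat.pow_le_pow_right (by omega) hd).trans_lt hM
  obtain ⟨T₁, hT₁, r₁⟩ := runs_setup (n := n) (t := t) (l := l) (p := p) (q := q) hK2 hmK
    (hpow (Nat.le_add_right _ _)) rfl rfl rfl rfl rfl hNK (by omega) rfl hLK rfl (by omega)
    (R := R) (by rw [hR, ← sum_instanceWords_adj G cliques seps t l]) (by omega) rfl
  have hinit : (⟨regs [0, 0, 0, 0, 0, 0, 0, 0, 0, 0, 0, 0, 0, 0, 0, 0, 0], m⟩ : State) =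
      initState (instanceWords G cliques seps t l) := by
    refine congrArg (State.mk · m) (funext fun r => ?_)
    exact (rawBounded_regs (K := 0) (m := fun _ => 0) (by simp) fun _ => le_rfl).1 r |>.antisymm
      (Nat.zero_le _)
  rw [hinit] at r₁
  set e : Env := ⟨fun i => regs (startRegs n t l p q R) (2 * i), m⟩ with he
  set s₀ : AState := ⟨fun x => regs (startRegs n t l p q R) (2 * x + 1),
    fun k a => m (5 + n * n + (p + q) * n + (8 * a + k))⟩ with hs₀
  have hraw : e.raw s₀ = ⟨regs (startRegs n t l p q R), m⟩ :=
    raw_eq ⟨regs (startRegs n t l p q R), m⟩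
  have hbd := rawBounded_regs hle hmK
  have heb : e.Bounded := ⟨hK2, fun i => hbd.1 _, hmK⟩
  have hsb : Bounded e s₀ := ⟨fun x => hbd.1 _, fun k a => hmK _⟩
  have hdesc : e.Describes G cliques t := by
    refine ⟨hK2, rfl, rfl, rfl, rfl, rfl, fun s u x => ?_, fun s i hi x => ?_⟩
    · have hux : ((u : ℕ) + 1) * n ≤ n * n := Nat.mul_le_mul_right n u.2
      rw [Nat.succ_mul] at hux
      rw [Env.mem, if_pos]
      swap
      · show 5 + (u : ℕ) * n + x < 5 + n * n + (p + q) * n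
        omega
      exact getD_instanceWords_adj G cliques seps t l u x
    · have hix : (i + 1) * n ≤ (p + q) * n := Nat.mul_le_mul_right n (by omega)
      rw [Nat.succ_mul] at hix
      rw [Env.mem, if_pos]
      swap
      · show 5 + n * n + i * n + x < 5 + n * n + (p + q) * n
        omega
      exact getD_instanceWords_clique G cliques seps t l hi x
  have hlarge : e.Large n t := ⟨show 3 < K by omega, show n < K by omega,
    show (n + 1) ^ (t + 1) ≤ K by omega⟩
  -- The arrays begin right behind the last input word, where the memory still holds zeros.
  have hzero : ∀ k a, s₀.arr k a = 0 := fun k a =>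
    List.getD_eq_default _ _ (by rw [length_instanceWords, ← hp, ← hq]; omega)
  -- All trie nodes that can be created in all rounds, and those of the final search, have numbers
  -- below the word bound.
  have hbudget : e.par 5 * (cliques.length * ((n + 1) * ((n + 1) ^ (t + 1) * (n * n + n)))) + n <
      e.par 0 := by
    have h1 : R * (p * ((n + 1) * ((n + 1) ^ (t + 1) * (n * n + n)))) ≤
        R * ((p + q) * ((n + 1) ^ (t + 1) * ((n + 1) * ((n + 1) * (n + 1))))) := by
      rw [show (n + 1) * ((n + 1) ^ (t + 1) * (n * n + n)) =
        (n + 1) ^ (t + 1) * ((n + 1) * ((n + 1) * n)) by ring]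
      gcongr <;> omega
    have h2 : 8 * (R * ((p + q) * ((n + 1) ^ (t + 1) * ((n + 1) * ((n + 1) * (n + 1)))))) = K := rfl
    show R * (p * ((n + 1) * ((n + 1) ^ (t + 1) * (n * n + n)))) + n < K
    have h3 : n + 1 ≤ (p + q) * ((n + 1) * ((n + 1) * ((n + 1) * (n + 1)))) := by
      calc n + 1 = 1 * ((n + 1) * (1 * (1 * 1))) := by ring
        _ ≤ _ := by gcongr <;> omega
    omega
  have hspec := mainProgram_spec hdesc hlarge (fun Ω hΩ => (hcl.2 Ω).2 hΩ)
    (funext (hzero 6)) (funext (hzero 7)) (startRegs_odd n t l p q R 10)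
    (show R = 2 * G.edgeSet.ncard + 1 + 1 by omega) hbudget rfl l
  obtain ⟨T₂, hT₂, r₂⟩ := runs_compile heb Stmt.mainProgram (by decide) hsb (M := M)
    (hpow (by rw [fullProgram, progDegree, progDegree]; omega))
  have hb₂ := rawBounded_raw heb (hsb.exec heb Stmt.mainProgram)
  generalize Stmt.mainProgram.exec e s₀ = s₁ at hspec r₂ hb₂
  rw [hraw] at r₂
  have hout := Runs.assign (M := M) (e.raw s₁) 0
    (.op .sub (.const 1) (.op .lt (.load (AExpr.address 7 (.reg 19))) (.reg 16)))
    (fits_of_degree hK2 hb₂ _ le_rfl (hpow (by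
      rw [fullProgram, progDegree, progDegree, output, progDegree]; omega)))
  have hval : (Expr.op .sub (.const 1) (.op .lt (.load (AExpr.address 7 (.reg 19)))
      (.reg 16))).eval (e.raw s₁) = 1 - if s₁.arr 7 (s₁.var 9) < l then 1 else 0 := by
    have h19 : (e.raw s₁).reg 19 = s₁.var 9 := raw_reg_var e s₁ 9
    have h16 : (e.raw s₁).reg 16 = l := raw_reg_par e s₁ 8
    have hmem := mem_array e s₁ 7 (s₁.var 9)
    simp only [Expr.eval, BinOp.eval, address_eval, h19, h16]
    rw [show (e.raw s₁).mem = e.mem s₁ from rfl, hmem]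
  rw [hval] at hout
  refine ⟨_, ?_, _, Runs.seq r₁ (r₂.seq hout), fun hU => ?_, fun hU => ?_⟩
  · have hw := weight_mainProgram_le (e := e) (N := n + 1) (Q := (n + 1) ^ (t + 1)) (p := p)
      (R := R) (by omega) (Nat.one_le_pow _ _ (by omega)) hp1 (by omega) rfl rfl
      (show t + 1 ≤ n + 1 by omega) rfl rfl rfl
    have h1 : R * p * (n + 1) ^ (t + 1) * (n + 1) ^ 3 ≤ K := by
      calc R * p * (n + 1) ^ (t + 1) * (n + 1) ^ 3
          ≤ R * (p + q) * (n + 1) ^ (t + 1) * (n + 1) ^ 3 := by gcongr; omega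
        _ = R * ((p + q) * ((n + 1) ^ (t + 1) * ((n + 1) * ((n + 1) * (n + 1))))) := by ring
        _ ≤ K := by rw [hK, wordBound]; omega
    have h2 : T₂ ≤ 500 * a * K := by
      calc T₂ ≤ a * (500 * (R * p * (n + 1) ^ (t + 1) * (n + 1) ^ 3)) :=
            hT₂.trans ((ha e).trans (Nat.mul_le_mul_left a hw))
        _ ≤ a * (500 * K) := by gcongr
        _ = _ := by ring
    have h3 : (500 * a + 300) * K = 500 * a * K + 300 * K := by ring
    rw [h3]
    simp only [Expr.cost, AExpr.address]
    omega
  · have := hspec.2 hU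
    simp only [Function.update_self]
    rw [if_neg (by omega)]
  · have := mt hspec.1 hU
    simp only [Function.update_self]
    rw [if_pos (by omega)]

end Final

end ArrayLang

/-- There are one program and one constant `c` such that, on every instance, the program halts within
`c * timeBound G t` steps on words of `O(log (timeBound G t))` bits, with output (register `0`) `1` if
`G` has an `ℓ`-vertex induced subgraph of treewidth at most `t`, and `0` otherwise. -/
theorem mainTheorem1 :
    ∃ (P : WordRAM.Prog) (c : ℕ),
      ∀ (n t ℓ : ℕ) (G : SimpleGraph (Fin n)) (cliques seps : List (Finset (Fin n))),
        0 < n → t ≤ n → ℓ ≤ n →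
        Enumerates cliques G.potentialMaximalCliques →
        Enumerates seps G.minimalSeparators →
        ∃ (T : ℕ) (s : WordRAM.State),
          WordRAM.Runs ((c * timeBound G t) ^ c) P
            (WordRAM.initState (instanceWords G cliques seps t ℓ)) T s ∧
          T ≤ c * timeBound G t ∧
          ((∃ U : Finset (Fin n), U.card = ℓ ∧
              (G.induce (U : Set (Fin n))).treewidth ≤ t) → s.reg 0 = 1) ∧
          ((¬ ∃ U : Finset (Fin n), U.card = ℓ ∧
              (G.induce (U : Set (Fin n))).treewidth ≤ t) → s.reg 0 = 0) := by
  obtain ⟨a, ha⟩ := ArrayLang.exists_cost_le_weight ArrayLang.Stmt.mainProgram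
  set E := ArrayLang.progDegree ArrayLang.fullProgram with hE
  -- One constant plays two parts: the first summand bounds the time, and the presence of `E` makes
  -- the exponent large enough for the degree of the program.
  refine ⟨ArrayLang.fullProgram, (500 * a + 300) * 2048 + E + 2, ?_⟩
  intro n t ℓ G cliques seps hn ht hl hcl hse
  set c := (500 * a + 300) * 2048 + E + 2 with hc
  set K := ArrayLang.wordBound n t cliques.length seps.length (2 + 2 * G.edgeSet.ncard) with hK
  have hB : timeBound G t =
      n ^ (t + 4) * max G.edgeSet.ncard 1 * (cliques.length + seps.length) := by
    rw [timeBound, hcl.ncard_eq, hse.ncard_eq]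
  have hKB : K ≤ 2048 * timeBound G t := hB ▸ ArrayLang.wordBound_le hn ht
  have hp : 0 < cliques.length := by
    obtain ⟨Ω, hΩ⟩ := ArrayLang.potentialMaximalCliques_nonempty G
    exact List.length_pos_of_mem ((hcl.2 Ω).2 hΩ)
  have hB1 : 1 ≤ timeBound G t := by
    rw [hB]
    exact Nat.mul_pos (Nat.mul_pos (Nat.pow_pos hn) (by omega)) (by omega)
  have hcB : 2048 * timeBound G t ≤ c * timeBound G t := Nat.mul_le_mul_right _ (by omega)
  have hM : K ^ E < (c * timeBound G t) ^ c :=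
    calc K ^ E ≤ (c * timeBound G t) ^ E := Nat.pow_le_pow_left (hKB.trans hcB) E
      _ < (c * timeBound G t) ^ c := Nat.pow_lt_pow_right (by omega) (by omega)
  obtain ⟨T, hT, s, hrun, h1, h0⟩ := ArrayLang.exists_run hn ht hl hcl ha hM
  refine ⟨T, s, hrun, ?_, h1, h0⟩
  calc T ≤ (500 * a + 300) * K := hT
    _ ≤ (500 * a + 300) * (2048 * timeBound G t) := Nat.mul_le_mul_left _ hKB
    _ = (500 * a + 300) * 2048 * timeBound G t := by ring
    _ ≤ c * timeBound G t := Nat.mul_le_mul_right _ (by omega)
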